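/- Let $S^2=\{(r,z)\in\mathbb R\times\mathbb C: r^2+|z|^2=1/4\}$, let $\mu$ be normalized area on $S^2$, and for $\varepsilon>0$ let $f_\varepsilon:S^2\to S^2$ be the twist map $f_\varepsilon(r,z)=(r,\exp(2\pi i(r+\tfrac12)\varepsilon)z)$. Let $\eta$ be Haar probability measure on $SO(3)$, and for $\delta>0$ let $U_\delta$ be the ball of radius $\delta$ about the identity of $SO(3)$ for the bi-invariant Riemannian metric of total volume $1$ (so $U_\delta$ consists of the rotations through an angle $\theta\in[0,\pi]$ with $\theta<2\pi^{2/3}\delta$). For a probability measure $\nu$ on area-preserving diffeomorphisms of $S^2$, let $R(\nu)=\int_{S^2}\lim_{n\to\infty}\frac1n\log\|T_x(f_n\circ\cdots\circ f_1)\|\,d\mu(x)$, where $f_1,f_2,\dots$ are independent with law $\nu$; the limit exists almost everywhere and the integral is almost surely independent of the sequence. Let $R(\varepsilon)=R(\nu_\varepsilon)$, where $\nu_\varepsilon$ is the push-forward of $\eta$ under $g\mapsto g\circ f_\varepsilon$. For $g\in SO(3)$ let $\nu_{g,\varepsilon,\delta}$ be the push-forward, under $u\mapsto u\circ g\circ f_\varepsilon$,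 of $\eta$ restricted to $U_\delta$ and normalized, and let $$R(\varepsilon,\delta)=\int_{SO(3)}R(\nu_{g,\varepsilon,\delta})\,d\eta(g).$$ Then there is a constant $C>0$ such that $$|R(\varepsilon,\delta)-R(\varepsilon)|\le C\,\delta^{-11}\varepsilon^{-1/2}\log(2+\varepsilon)\quad\text{for all }\varepsilon>0,\ \delta>0,$$ and $$|R(\varepsilon,\delta)-R(\varepsilon)|\le C\,\delta^{-11}\varepsilon^{-1/2}\log\varepsilon\quad\text{for all }\varepsilon\ge 2,\ \delta>0.$$ In particular, $\lim_{\varepsilon\to\infty}|R(\varepsilon,\delta)-R(\varepsilon)|=0$ for every $\delta>0$. -/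

import Mathlib

open MeasureTheory ProbabilityTheory Filter Topology

noncomputable section

namespace TwistExponents

/-! ### The rotation group `SO(3)` and its Haar probability measure -/

/-- The rotation group `SO(3)`. -/
abbrev SO3 : Type := Matrix.specialOrthogonalGroup (Fin 3) ℝ

theorem coe_inv_SO3 (g : SO3) :
    ((g⁻¹ : SO3) : Matrix (Fin 3) (Fin 3) ℝ) = (g : Matrix (Fin 3) (Fin 3) ℝ).transpose := rfl

instance : IsTopologicalGroup SO3 where
  continuous_mul := by
    refine Continuous.subtype_mk ?_ _
    exact (continuous_subtype_val.comp continuous_fst).matrix_mul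
      (continuous_subtype_val.comp continuous_snd)
  continuous_inv := by
    refine continuous_induced_rng.2 ?_
    exact Continuous.matrix_transpose continuous_subtype_val

theorem mem_SO3_iff (A : Matrix (Fin 3) (Fin 3) ℝ) :
    A ∈ Matrix.specialOrthogonalGroup (Fin 3) ℝ ↔ A * A.transpose = 1 ∧ A.det = 1 := by
  rw [Matrix.mem_specialOrthogonalGroup_iff, Matrix.mem_orthogonalGroup_iff]

instance : CompactSpace SO3 := by
  apply isCompact_iff_compactSpace.1
  have hbox : IsCompact (Set.univ.pi fun _ : Fin 3 => Set.univ.pi fun _ : Fin 3 =>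
      Set.Icc (-1 : ℝ) 1) :=
    isCompact_univ_pi fun _ => isCompact_univ_pi fun _ => isCompact_Icc
  refine IsCompact.of_isClosed_subset (X := Matrix (Fin 3) (Fin 3) ℝ) hbox ?_ ?_
  · have h : ((Matrix.specialOrthogonalGroup (Fin 3) ℝ : Submonoid (Matrix (Fin 3) (Fin 3) ℝ)) :
        Set (Matrix (Fin 3) (Fin 3) ℝ)) =
        {A | A * A.transpose = 1} ∩ {A | A.det = 1} := by
      ext A
      exact mem_SO3_iff A
    rw [h]
    refine IsClosed.inter (isClosed_eq ?_ continuous_const) (isClosed_eq ?_ continuous_const)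
    · exact continuous_id.matrix_mul (Continuous.matrix_transpose continuous_id)
    · exact Continuous.matrix_det continuous_id
  · intro A hA i _ j _
    have h1 : (A * A.transpose) i i = 1 := by rw [((mem_SO3_iff A).1 hA).1]; simp
    rw [Matrix.mul_apply] at h1
    have h2 : A i j * A.transpose j i ≤ ∑ k, A i k * A.transpose k i :=
      Finset.single_le_sum (f := fun k => A i k * A.transpose k i)
        (fun k _ => mul_self_nonneg (A i k)) (Finset.mem_univ j)
    rw [h1] at h2
    have h3 : A i j * A i j ≤ 1 := h2
    constructor <;> nlinarith

instance : MeasurableSpace SO3 := borel SO3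

instance : BorelSpace SO3 := ⟨rfl⟩

/-- Haar measure on `SO(3)`, normalized to be a probability measure. -/
def haar : Measure SO3 := Measure.haarMeasure ⊤

/-- The angle in `[0, π]` of the rotation `g`, determined by `tr g = 1 + 2 cos θ`. -/
def rotationAngle (g : SO3) : ℝ :=
  Real.arccos (((g : Matrix (Fin 3) (Fin 3) ℝ).trace - 1) / 2)

/-- The open ball `U_δ` of radius `δ` about the identity of `SO(3)`, for the bi-invariant
Riemannian metric of total volume one. That metric is given on the Lie algebra by
`⟨A, B⟩ = tr (A Bᵀ) / (2 c²)` with `c = 2 π^(2/3)`, so a rotation through the angle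
`θ ∈ [0, π]` is at distance `θ / c` from the identity. -/
def identityBall (δ : ℝ) : Set SO3 :=
  {g | rotationAngle g / (2 * Real.pi ^ (2 / 3 : ℝ)) < δ}

/-! ### The sphere, its area measure, and the twist maps -/

/-- Three-dimensional Euclidean space. The point `x` stands for `(r, z) ∈ ℝ × ℂ` with
`r = x 0` and `z = x 1 + i x 2`. The sphere `S²` is `Metric.sphere (0 : E3) (1 / 2)`. -/
abbrev E3 : Type := EuclideanSpace ℝ (Fin 3)

/-- The area measure of the sphere of radius `1/2` about the origin, before normalization
(up to a constant factor), as a measure on the ambient space. -/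
def areaMeasure : Measure E3 :=
  (volume : Measure E3).toSphere.map fun x : Metric.sphere (0 : E3) 1 => (1 / 2 : ℝ) • (x : E3)

/-- The measure `μ`: area on the sphere of radius `1/2` about the origin, normalized to be a
probability measure. -/
def sphereMeasure : Measure E3 := (areaMeasure Set.univ)⁻¹ • areaMeasure

/-- The rotation of Euclidean space given by `g`. -/
def rotate (g : SO3) : E3 →L[ℝ] E3 := Matrix.toEuclideanCLM (𝕜 := ℝ) (g : Matrix (Fin 3) (Fin 3) ℝ)

/-- The twist map `f_ε (r, z) = (r, exp (2 π i (r + 1/2) ε) z)`. The same formula is used on the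
whole space; it maps every sphere about the origin to itself. -/
def twist (ε : ℝ) (x : E3) : E3 :=
  let w : ℂ := Complex.exp (2 * Real.pi * Complex.I * (x 0 + 1 / 2) * ε) * ⟨x 1, x 2⟩
  !₂[x 0, w.re, w.im]

/-- The tangent map at `x` of a smooth map `F` that preserves the sphere about the origin
through `x`: the derivative of `F` restricted to the tangent plane `xᗮ`. -/
def tangentMap (F : E3 → E3) (x : E3) : (ℝ ∙ x)ᗮ →L[ℝ] E3 :=
  (fderiv ℝ F x).comp (ℝ ∙ x)ᗮ.subtypeL

/-! ### Random exponents -/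

/-- The composition `f^(n) = f_n ∘ ⋯ ∘ f_1`, where `f_i = g_i ∘ f`. (The sequence `g` is indexed
from `0`.) -/
def randomComposition (f : E3 → E3) (g : ℕ → SO3) : ℕ → E3 → E3
  | 0 => id
  | n + 1 => fun x => rotate (g n) (f (randomComposition f g n x))

/-- The exponent of a sequence at `x`: the limit of `(1/n) log ‖T_x f^(n)‖`. The limit exists for
almost every sequence and almost every `x`; it is written as an upper limit, which makes sense
everywhere. -/
def pointExponent (f : E3 → E3) (g : ℕ → SO3) (x : E3) : ℝ :=
  limsup (fun n : ℕ => (1 / n : ℝ) * Real.log ‖tangentMap (randomComposition f g n) x‖) atTop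

/-- The random exponent `R(ν)` of the push-forward `ν` of the probability measure `ρ` on `SO(3)`
under `g ↦ g ∘ f`: the integral over the sphere of the exponents of an independent sequence
`f_i = g_i ∘ f` with `g_i` distributed according to `ρ`. This integral is almost surely independent
of the sequence; the common value is written as its expectation. -/
def randomExponent (f : E3 → E3) (ρ : Measure SO3) : ℝ :=
  ∫ g, (∫ x, pointExponent f g x ∂sphereMeasure) ∂(Measure.infinitePi fun _ : ℕ => ρ)

/-- The random exponent `R(ε)` of the family `SO(3) f_ε`. -/
def R (ε : ℝ) : ℝ := randomExponent (twist ε) haar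

/-- The law of `u g`, where `u` is distributed in `U_δ` according to normalized Haar measure. -/
def diffusedLaw (g : SO3) (δ : ℝ) : Measure SO3 :=
  (haar[|identityBall δ]).map fun u => u * g

/-- The random exponent `R(g, ε, δ)` of the family `U_δ g f_ε`. -/
def localExponent (g : SO3) (ε δ : ℝ) : ℝ := randomExponent (twist ε) (diffusedLaw g δ)

/-- The `δ`-diffused random exponent `R(ε, δ)`. -/
def diffusedR (ε δ : ℝ) : ℝ := ∫ g, localExponent g ε δ ∂haar

end TwistExponents

end

noncomputable section

namespace TwistExponents

/-! The argument lives on frames. A rotation `h` encodes a point of the sphere (`pt h`, half the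
first column) and an orthonormal frame of the tangent plane there (the other two columns, identified
with ℂ by `emb`). Right multiplication by `rot0 t` rotates the tangent frame over a fixed point. In
frames the twist becomes `bstep`, and its derivative is the explicit shear z ↦ z - πε⟨ℓ, z⟩iℓ with ℓ
= `ell h`. For large ε it pushes most vectors towards the line of iℓ, and this line in the tangent
plane depends only on the base point.

Exponents reduce to a transfer operator. A subadditive ergodic argument
(`abs_integral_growth_sub_le`) reads the exponent off the means of the log-norms of the cocycle.
After averaging over directions, the norm and the growth of one vector differ by a bounded amount
(`lintegral_norm_defect_le`), and the mean growth of a vector is a sum of iterates of `stretch`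
under `trans` (`meanGrowth_eq_sum`). Hence `abs_randomExponent_sub_le` needs only the integrals of
late iterates. With Haar distributed rotations every step forgets the past, so R(ε) is the integral
of `stretch` (`R_eq`).

For the diffused law, one application of `trans` averages `stretch` over a translate of U_δ. Such an
average is Hölder of order 1/2 in the direction of the vector, because shells of the ball have small
measure (`haar_shell_le`). The image direction can therefore be replaced by the limiting one, which
gives `limitMean`, a function of the base point alone. The error is of order √(‖ℓ‖/|`gain`|), and
its Haar integral is O(ε^(-1/2)) up to factors in δ and log ε (`lintegral_gainWt_le`). A second
application turns this L¹ bound into a uniform one, since the law has density at most 1/vol(U_δ).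
Further applications keep the uniform bound and do not change integrals of functions of the base
point. So R(g, ε, δ) is within `errorBound` of the integral of `limitMean`, and averaging over g
turns that integral into R(ε).

The two applications cost vol(U_δ)^(-2) = O(δ^(-6)) when δ ≤ 1, and the size of `stretch` costs the
logarithm. When δ ≥ 1 the ball is the whole group and the difference vanishes. -/

instance : SecondCountableTopology (Matrix (Fin 3) (Fin 3) ℝ) :=
  inferInstanceAs (SecondCountableTopology (Fin 3 → Fin 3 → ℝ))

instance : SecondCountableTopology SO3 := TopologicalSpace.Subtype.secondCountableTopology _

instance : haar.IsHaarMeasure := by unfold haar; infer_instance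

instance : IsProbabilityMeasure haar :=
  ⟨by simpa [haar] using
    Measure.haarMeasure_self (K₀ := (⊤ : TopologicalSpace.PositiveCompacts SO3))⟩

/-! ### Rotations about coordinate axes -/

theorem mem_SO3_of_rows {A : Matrix (Fin 3) (Fin 3) ℝ} (h : A * A.transpose = 1)
    (hd : A.det = 1) : A ∈ Matrix.specialOrthogonalGroup (Fin 3) ℝ := (mem_SO3_iff A).2 ⟨h, hd⟩

/-- The rotation through the angle `t` about the first coordinate axis. -/
def rot0 (t : ℝ) : SO3 :=
  ⟨!![1, 0, 0; 0, Real.cos t, -Real.sin t; 0, Real.sin t, Real.cos t], by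
    have := Real.sin_sq_add_cos_sq t
    apply mem_SO3_of_rows
    · ext i j
      fin_cases i <;> fin_cases j <;> simp [Matrix.mul_apply, Fin.sum_univ_three] <;> nlinarith
    · simp [Matrix.det_fin_three]; nlinarith⟩

/-- The rotation through the angle `t` about the third coordinate axis. -/
def rot2 (t : ℝ) : SO3 :=
  ⟨!![Real.cos t, -Real.sin t, 0; Real.sin t, Real.cos t, 0; 0, 0, 1], by
    have := Real.sin_sq_add_cos_sq t
    apply mem_SO3_of_rows
    · ext i j
      fin_cases i <;> fin_cases j <;> simp [Matrix.mul_apply, Fin.sum_univ_three] <;> nlinarith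
    · simp [Matrix.det_fin_three]; nlinarith⟩

theorem coe_rot0 (t : ℝ) : ((rot0 t : SO3) : Matrix (Fin 3) (Fin 3) ℝ) =
    !![1, 0, 0; 0, Real.cos t, -Real.sin t; 0, Real.sin t, Real.cos t] := rfl

theorem coe_rot2 (t : ℝ) : ((rot2 t : SO3) : Matrix (Fin 3) (Fin 3) ℝ) =
    !![Real.cos t, -Real.sin t, 0; Real.sin t, Real.cos t, 0; 0, 0, 1] := rfl

theorem rot0_add (s t : ℝ) : rot0 (s + t) = rot0 s * rot0 t := by
  apply Subtype.ext
  ext i j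
  fin_cases i <;> fin_cases j <;>
    simp [coe_rot0, Matrix.mul_apply, Fin.sum_univ_three, Real.cos_add, Real.sin_add] <;> ring

theorem rot0_zero : rot0 0 = 1 := by
  apply Subtype.ext
  ext i j
  fin_cases i <;> fin_cases j <;> simp [coe_rot0]

theorem rot0_neg (t : ℝ) : rot0 (-t) = (rot0 t)⁻¹ := by
  rw [eq_inv_iff_mul_eq_one, ← rot0_add, neg_add_cancel, rot0_zero]

theorem rot0_add_two_pi (t : ℝ) : rot0 (t + 2 * Real.pi) = rot0 t := by
  apply Subtype.ext
  simp [coe_rot0]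

/-- The entries of a rotation. -/
def ent (h : SO3) (i j : Fin 3) : ℝ := h.1 i j

/-- The trace of a rotation. -/
def tr (h : SO3) : ℝ := ent h 0 0 + ent h 1 1 + ent h 2 2

theorem ent_def (h : SO3) (i j : Fin 3) : ent h i j = h.1 i j := rfl

@[fun_prop]
theorem continuous_ent (i j : Fin 3) : Continuous fun h : SO3 => ent h i j :=
  continuous_subtype_val.matrix_elem i j

@[fun_prop]
theorem measurable_ent (i j : Fin 3) : Measurable fun h : SO3 => ent h i j :=
  (continuous_ent i j).measurable

@[fun_prop]
theorem measurable_tr : Measurable tr := by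
  unfold tr; fun_prop

theorem continuous_rot0 : Continuous rot0 := by
  refine Continuous.subtype_mk (continuous_pi fun i => continuous_pi fun j => ?_) _
  fin_cases i <;> fin_cases j <;> simp <;> fun_prop

theorem continuous_rot2 : Continuous rot2 := by
  refine Continuous.subtype_mk (continuous_pi fun i => continuous_pi fun j => ?_) _
  fin_cases i <;> fin_cases j <;> simp <;> fun_prop

/-! ### Algebra of the entries of a rotation -/

theorem mul_rot0_00 (h : SO3) (t : ℝ) (i : Fin 3) : ent (h * rot0 t) i 0 = ent h i 0 := by
  simp [ent_def, coe_rot0, Matrix.mul_apply, Fin.sum_univ_three]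

theorem mul_rot0_01 (h : SO3) (t : ℝ) (i : Fin 3) :
    ent (h * rot0 t) i 1 = ent h i 1 * Real.cos t + ent h i 2 * Real.sin t := by
  simp [ent_def, coe_rot0, Matrix.mul_apply, Fin.sum_univ_three]

theorem mul_rot0_02 (h : SO3) (t : ℝ) (i : Fin 3) :
    ent (h * rot0 t) i 2 = ent h i 2 * Real.cos t - ent h i 1 * Real.sin t := by
  simp [ent_def, coe_rot0, Matrix.mul_apply, Fin.sum_univ_three]; ring

theorem mul_rot2_00 (h : SO3) (t : ℝ) (i : Fin 3) :
    ent (h * rot2 t) i 0 = ent h i 0 * Real.cos t + ent h i 1 * Real.sin t := by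
  simp [ent_def, coe_rot2, Matrix.mul_apply, Fin.sum_univ_three]

theorem mul_rot2_01 (h : SO3) (t : ℝ) (i : Fin 3) :
    ent (h * rot2 t) i 1 = ent h i 1 * Real.cos t - ent h i 0 * Real.sin t := by
  simp [ent_def, coe_rot2, Matrix.mul_apply, Fin.sum_univ_three]; ring

theorem mul_rot2_02 (h : SO3) (t : ℝ) (i : Fin 3) : ent (h * rot2 t) i 2 = ent h i 2 := by
  simp [ent_def, coe_rot2, Matrix.mul_apply, Fin.sum_univ_three]

theorem SO3_rows (h : SO3) (i j : Fin 3) :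
    ent h i 0 * ent h j 0 + ent h i 1 * ent h j 1 + ent h i 2 * ent h j 2 = if i = j then 1 else 0 := by
  have := congrFun (congrFun ((mem_SO3_iff h.1).1 h.2).1 i) j
  simpa [ent_def, Matrix.mul_apply, Fin.sum_univ_three, Matrix.one_apply] using this

theorem SO3_cols (h : SO3) (i j : Fin 3) :
    ent h 0 i * ent h 0 j + ent h 1 i * ent h 1 j + ent h 2 i * ent h 2 j = if i = j then 1 else 0 := by
  have h1 : h.1.transpose * h.1 = 1 := mul_eq_one_comm.1 ((mem_SO3_iff h.1).1 h.2).1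
  have := congrFun (congrFun h1 i) j
  simpa [ent_def, Matrix.mul_apply, Fin.sum_univ_three, Matrix.one_apply] using this

/-- Both are the inverse, the determinant being 1. Thus every entry equals its own cofactor. -/
theorem SO3_adjugate (h : SO3) : h.1.transpose = h.1.adjugate := by
  have h1 : h.1.transpose * h.1 = 1 := mul_eq_one_comm.1 ((mem_SO3_iff h.1).1 h.2).1
  have h2 : h.1 * h.1.adjugate = 1 := by
    rw [Matrix.mul_adjugate, ((mem_SO3_iff h.1).1 h.2).2, one_smul]
  calc h.1.transpose = h.1.transpose * (h.1 * h.1.adjugate) := by rw [h2, mul_one]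
    _ = _ := by rw [← mul_assoc, h1, one_mul]

theorem SO3_minor (h : SO3) : ent h 0 0 = ent h 1 1 * ent h 2 2 - ent h 1 2 * ent h 2 1 := by
  have := congrFun (congrFun (SO3_adjugate h) 0) 0
  simpa [ent_def, Matrix.adjugate_fin_three] using this

theorem SO3_adj20 (h : SO3) : ent h 0 1 * ent h 1 2 - ent h 0 2 * ent h 1 1 = ent h 2 0 := by
  have := congrFun (congrFun (SO3_adjugate h) 0) 2
  simp only [ent_def]
  simp [Matrix.adjugate_fin_three] at this
  linarith

theorem SO3_adj10 (h : SO3) : ent h 0 2 * ent h 2 1 - ent h 0 1 * ent h 2 2 = ent h 1 0 := by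
  have := congrFun (congrFun (SO3_adjugate h) 0) 1
  simp only [ent_def]
  simp [Matrix.adjugate_fin_three] at this
  linarith

theorem SO3_row0 (h : SO3) : ent h 0 0 ^ 2 + ent h 0 1 ^ 2 + ent h 0 2 ^ 2 = 1 := by
  have := SO3_rows h 0 0
  simp at this
  nlinarith

/-- This is the squared amplitude of the trace along `h * rot0 t`; the cofactor identity for the
corner entry makes it a perfect square. -/
theorem SO3_minor_sq (h : SO3) :
    (ent h 1 1 + ent h 2 2) ^ 2 + (ent h 1 2 - ent h 2 1) ^ 2 = (1 + ent h 0 0) ^ 2 := by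
  have h1 := SO3_rows h 1 1
  have h2 := SO3_rows h 2 2
  have h3 := SO3_cols h 0 0
  have h4 := SO3_minor h
  simp at h1 h2 h3
  nlinarith

theorem trace_eq (h : SO3) : h.1.trace = ent h 0 0 + ent h 1 1 + ent h 2 2 := by
  simp [ent_def, Matrix.trace, Fin.sum_univ_three]

theorem tr_mul_rot0 (h : SO3) (t : ℝ) : tr (h * rot0 t) =
    ent h 0 0 + ((ent h 1 1 + ent h 2 2) * Real.cos t + (ent h 1 2 - ent h 2 1) * Real.sin t) := by
  rw [tr, mul_rot0_00, mul_rot0_01, mul_rot0_02]; ring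

theorem abs_entry_le_one (h : SO3) (i j : Fin 3) : |ent h i j| ≤ 1 := by
  have := SO3_rows h i i
  simp at this
  rw [abs_le_one_iff_mul_self_le_one]
  fin_cases j <;> simp <;> nlinarith [sq_nonneg (ent h i 0), sq_nonneg (ent h i 1), sq_nonneg (ent h i 2)]

/-- A compact group is unimodular: a right translate of Haar measure is again a Haar probability
measure, and there is only one. -/
instance : haar.IsMulRightInvariant :=
  ⟨fun g => by
    have : (haar.map (· * g)).IsHaarMeasure := inferInstance
    have : IsProbabilityMeasure (haar.map (· * g)) :=
      Measure.isProbabilityMeasure_map (measurable_mul_const g).aemeasurable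
    exact Measure.isHaarMeasure_eq_of_isProbabilityMeasure _ _⟩

/-! ### Averages over the circle -/

/-- Normalized Lebesgue measure on a period. -/
def circ : Measure ℝ :=
  (ENNReal.ofReal (2 * Real.pi))⁻¹ • volume.restrict (Set.Ioc 0 (2 * Real.pi))

theorem ofReal_two_pi_ne_zero : ENNReal.ofReal (2 * Real.pi) ≠ 0 := by
  simp [Real.pi_pos]

instance : IsProbabilityMeasure circ :=
  ⟨by simp only [circ, Measure.smul_apply, Measure.restrict_apply_univ, Real.volume_Ioc, sub_zero,
        smul_eq_mul]
      exact ENNReal.inv_mul_cancel ofReal_two_pi_ne_zero ENNReal.ofReal_ne_top⟩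

theorem lintegral_circ (f : ℝ → ENNReal) : ∫⁻ t, f t ∂circ =
    (ENNReal.ofReal (2 * Real.pi))⁻¹ * ∫⁻ t in Set.Ioc 0 (2 * Real.pi), f t := by
  rw [circ, lintegral_smul_measure, smul_eq_mul]

/-- A periodic function descends to `AddCircle`, whose measure is translation invariant. -/
theorem lintegral_circ_add {f : ℝ → ENNReal} (hf : Function.Periodic f (2 * Real.pi)) (a : ℝ) :
    ∫⁻ t, f (t + a) ∂circ = ∫⁻ t, f t ∂circ := by
  have : Fact (0 < 2 * Real.pi) := ⟨Real.two_pi_pos⟩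
  have key : ∀ b : ℝ, ∫⁻ t in Set.Ioc 0 (2 * Real.pi), f (t + b) =
      ∫⁻ x : AddCircle (2 * Real.pi), hf.lift x := by
    intro b
    have := AddCircle.lintegral_preimage (2 * Real.pi) 0 (fun x => hf.lift (x + (b : ℝ)))
    rw [lintegral_add_right_eq_self (fun x => hf.lift x)] at this
    rw [← this, zero_add]
    refine lintegral_congr fun t => ?_
    rw [← AddCircle.coe_add, Function.Periodic.lift_coe]
  rw [lintegral_circ, lintegral_circ, key a]
  have := key 0
  simp only [add_zero] at this
  rw [this]

theorem exists_phase (A B : ℝ) : ∃ s : ℝ, ∀ t : ℝ,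
    A * Real.cos t + B * Real.sin t = √(A ^ 2 + B ^ 2) * Real.cos (t + s) := by
  have h1 := Complex.norm_mul_cos_arg (⟨A, B⟩ : ℂ)
  have h2 := Complex.norm_mul_sin_arg (⟨A, B⟩ : ℂ)
  have h3 : ‖(⟨A, B⟩ : ℂ)‖ = √(A ^ 2 + B ^ 2) := by
    rw [Complex.norm_def, Complex.normSq_mk]; ring_nf
  rw [h3] at h1 h2
  refine ⟨-Complex.arg ⟨A, B⟩, fun t => ?_⟩
  rw [Real.cos_add, Real.cos_neg, Real.sin_neg]
  simp only at h1 h2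
  linear_combination (-Real.cos t) * h1 - (Real.sin t) * h2

/-- The phase is averaged away, so only the amplitude of a trigonometric combination matters.
Entries and traces along one-parameter rotations have this form. -/
theorem lintegral_circ_phase (f : ℝ → ENNReal) (A B : ℝ) :
    ∫⁻ t, f (A * Real.cos t + B * Real.sin t) ∂circ =
      ∫⁻ t, f (√(A ^ 2 + B ^ 2) * Real.cos t) ∂circ := by
  obtain ⟨s, hs⟩ := exists_phase A B
  simp only [hs]
  exact lintegral_circ_add (f := fun t => f (√(A ^ 2 + B ^ 2) * Real.cos t))
    (fun t => by simp only [Real.cos_add_two_pi]) s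

/-- The singular weight `|q|^(-1/2)`, infinite at `0`. -/
def wt (q : ℝ) : ENNReal := ENNReal.ofReal |q| ^ (-(1 / 2) : ℝ)

@[fun_prop]
theorem measurable_wt : Measurable wt := by
  unfold wt; fun_prop

theorem wt_mul (a b : ℝ) : wt (a * b) = wt a * wt b := by
  simp only [wt, abs_mul]
  rw [ENNReal.ofReal_mul (abs_nonneg _),
    ENNReal.mul_rpow_of_ne_top ENNReal.ofReal_ne_top ENNReal.ofReal_ne_top]

theorem wt_anti {a b : ℝ} (h : |a| ≤ |b|) : wt b ≤ wt a := by
  unfold wt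
  rw [ENNReal.rpow_neg, ENNReal.rpow_neg]
  gcongr

theorem wt_of_ne_zero {q : ℝ} (hq : q ≠ 0) : wt q = ENNReal.ofReal (|q| ^ (-(1 / 2) : ℝ)) := by
  rw [wt, ENNReal.ofReal_rpow_of_pos (abs_pos.2 hq)]

/-- Jordan's inequality, centred at each of the two zeros of the cosine in the period. -/
theorem abs_cos_ge {t : ℝ} (h0 : 0 ≤ t) (h1 : t ≤ 2 * Real.pi) :
    2 / Real.pi * |t - Real.pi / 2| ≤ |Real.cos t| ∨
      2 / Real.pi * |t - 3 * Real.pi / 2| ≤ |Real.cos t| := by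
  have key : ∀ x, |x| ≤ Real.pi / 2 → 2 / Real.pi * |x| ≤ |Real.sin x| :=
    fun x hx => Real.mul_abs_le_abs_sin hx
  rcases le_total t Real.pi with h | h
  · left
    have := key (t - Real.pi / 2) (by rw [abs_le]; constructor <;> linarith)
    rwa [Real.sin_sub_pi_div_two, abs_neg] at this
  · right
    have := key (t - 3 * Real.pi / 2) (by rw [abs_le]; constructor <;> linarith)
    rwa [show t - 3 * Real.pi / 2 = t - Real.pi - Real.pi / 2 by ring, Real.sin_sub_pi_div_two,
      Real.cos_sub_pi, neg_neg, sub_sub, show Real.pi + Real.pi / 2 = 3 * Real.pi / 2 by ring]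
      at this

theorem lintegral_wt_ball_lt_top (r : ℝ) : ∫⁻ x in Metric.ball (0 : ℝ) r, wt x < ⊤ := by
  have h : IntegrableOn (fun x : ℝ => ‖x‖ ^ (-(1 / 2) : ℝ)) (Metric.ball 0 r) := by
    -- Polar coordinates in dimension one leave the integrable singularity y^(-1/2) on (0, r).
    rw [integrableOn_fun_norm_addHaar volume (f := fun y => y ^ (-(1 / 2) : ℝ))]
    simp only [Module.finrank_self, Nat.sub_self, pow_zero, one_smul]
    rcases le_or_gt r 0 with hr | hr
    · rw [Set.Ioo_eq_empty (by linarith)]; simp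
    · exact ((intervalIntegral.intervalIntegrable_rpow' (a := 0) (b := r) (by norm_num)).1).mono_set
        Set.Ioo_subset_Ioc_self
  refine lt_of_le_of_lt (le_of_eq ?_) h.2
  refine lintegral_congr_ae (ae_restrict_of_ae ?_)
  have : ∀ᵐ x : ℝ, x ≠ 0 := by simp [ae_iff]
  filter_upwards [this] with x hx
  rw [wt_of_ne_zero hx, Real.enorm_eq_ofReal (by positivity), Real.norm_eq_abs]

/-- The average of `|cos t|^(-1/2)`. -/
def cosAvg : ENNReal := ∫⁻ t, wt (Real.cos t) ∂circ

theorem cosAvg_lt_top : cosAvg < ⊤ := by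
  have hpi := Real.pi_pos
  have hpi4 := Real.pi_le_four
  have shift : ∀ c : ℝ, 0 ≤ c → c ≤ 2 * Real.pi →
      ∫⁻ t in Set.Ioc 0 (2 * Real.pi), wt (t - c) < ⊤ := by
    intro c hc hc'
    -- Here |t - c| ≤ 2π ≤ 8, so the ball of radius 9 contains every shifted point.
    refine lt_of_le_of_lt ?_ (lintegral_wt_ball_lt_top 9)
    rw [← lintegral_indicator measurableSet_Ioc, ← lintegral_indicator Metric.isOpen_ball.measurableSet,
      ← lintegral_sub_right_eq_self ((Metric.ball (0 : ℝ) 9).indicator wt) c]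
    refine lintegral_mono fun t => ?_
    by_cases ht : t ∈ Set.Ioc 0 (2 * Real.pi)
    · have : t - c ∈ Metric.ball (0 : ℝ) 9 := by
        rw [mem_ball_zero_iff, Real.norm_eq_abs, abs_lt]
        constructor <;> linarith [ht.1, ht.2]
      rw [Set.indicator_of_mem ht, Set.indicator_of_mem this]
    · rw [Set.indicator_of_notMem ht]; exact zero_le
  have h2 : wt (2 / Real.pi) < ⊤ := by
    rw [wt_of_ne_zero (by positivity)]; exact ENNReal.ofReal_lt_top
  rw [cosAvg, lintegral_circ]
  refine ENNReal.mul_lt_top (ENNReal.inv_lt_top.2 (pos_iff_ne_zero.2 ofReal_two_pi_ne_zero)) ?_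
  have : ∫⁻ t in Set.Ioc 0 (2 * Real.pi), wt (Real.cos t) ≤ ∫⁻ t in Set.Ioc 0 (2 * Real.pi),
      wt (2 / Real.pi) * (wt (t - Real.pi / 2) + wt (t - 3 * Real.pi / 2)) := by
    refine setLIntegral_mono' measurableSet_Ioc fun t ht => ?_
    rcases abs_cos_ge ht.1.le ht.2 with h | h
    · calc _ ≤ wt (2 / Real.pi * (t - Real.pi / 2)) := wt_anti (by
            rw [abs_mul, abs_of_pos (by positivity : 0 < 2 / Real.pi)]; exact h)
        _ ≤ _ := by rw [wt_mul]; gcongr; exact le_self_add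
    · calc _ ≤ wt (2 / Real.pi * (t - 3 * Real.pi / 2)) := wt_anti (by
            rw [abs_mul, abs_of_pos (by positivity : 0 < 2 / Real.pi)]; exact h)
        _ ≤ _ := by rw [wt_mul]; gcongr; exact le_add_self
  refine this.trans_lt ?_
  rw [lintegral_const_mul _ (by fun_prop),
    lintegral_add_left (by fun_prop)]
  exact ENNReal.mul_lt_top h2 (ENNReal.add_lt_top.2
    ⟨shift _ (by linarith) (by linarith), shift _ (by linarith) (by linarith)⟩)

theorem lintegral_circ_wt (A B : ℝ) :
    ∫⁻ t, wt (A * Real.cos t + B * Real.sin t) ∂circ = wt (√(A ^ 2 + B ^ 2)) * cosAvg := by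
  rw [lintegral_circ_phase wt, cosAvg, ← lintegral_const_mul _ (by fun_prop)]
  simp only [wt_mul]

/-! ### Measures of arcs cut out by the cosine. -/

theorem circ_eq_lintegral {s : Set ℝ} (hs : MeasurableSet s) :
    circ s = ∫⁻ t, s.indicator 1 t ∂circ := by
  rw [lintegral_indicator_one hs]

theorem circ_preimage_add {s : Set ℝ} (hs : MeasurableSet s)
    (h : ∀ t, t + 2 * Real.pi ∈ s ↔ t ∈ s) (a : ℝ) : circ ((· + a) ⁻¹' s) = circ s := by
  rw [circ_eq_lintegral hs, ← lintegral_circ_add (a := a),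
    circ_eq_lintegral (hs.preimage (measurable_add_const a))]
  · rfl
  · intro t
    by_cases ht : t ∈ s
    · rw [Set.indicator_of_mem ht, Set.indicator_of_mem ((h t).2 ht)]; rfl
    · rw [Set.indicator_of_notMem ht, Set.indicator_of_notMem (mt (h t).1 ht)]

theorem circ_apply {s : Set ℝ} (hs : MeasurableSet s) : circ s =
    (ENNReal.ofReal (2 * Real.pi))⁻¹ * volume (s ∩ Set.Ioc 0 (2 * Real.pi)) := by
  rw [circ, Measure.smul_apply, Measure.restrict_apply hs, smul_eq_mul]

theorem circ_one_sub_cos_le {l : ℝ} (hl : 0 ≤ l) :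
    circ {t | 1 - Real.cos t ≤ l} ≤ ENNReal.ofReal √l := by
  have hm : MeasurableSet {t : ℝ | 1 - Real.cos t ≤ l} :=
    measurableSet_le (by fun_prop) measurable_const
  -- The shift by π places the arc around 0 in the middle of the period, where it is a single
  -- interval.
  rw [← circ_preimage_add hm (fun t => by simp) (-Real.pi),
    circ_apply (hm.preimage (measurable_add_const _))]
  have hsub : (· + -Real.pi) ⁻¹' {t : ℝ | 1 - Real.cos t ≤ l} ∩ Set.Ioc 0 (2 * Real.pi) ⊆
      Set.Icc (Real.pi - Real.pi * √l) (Real.pi + Real.pi * √l) := by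
    rintro t ⟨h1, h2, h3⟩
    simp only [Set.mem_preimage, Set.mem_ofPred_eq] at h1
    have h4 := Real.cos_le_one_sub_mul_cos_sq (x := t + -Real.pi) (by rw [abs_le]; constructor <;> linarith)
    have h5 : (t + -Real.pi) ^ 2 ≤ (Real.pi * √l) ^ 2 := by
      have : 2 / Real.pi ^ 2 * (t + -Real.pi) ^ 2 ≤ l := by linarith
      rw [div_mul_eq_mul_div, div_le_iff₀ (by positivity)] at this
      rw [mul_pow, Real.sq_sqrt hl]; nlinarith [sq_nonneg Real.pi]
    have h6 := abs_le_of_sq_le_sq h5 (by positivity)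
    rw [abs_le] at h6
    constructor <;> linarith
  calc _ ≤ (ENNReal.ofReal (2 * Real.pi))⁻¹ *
        volume (Set.Icc (Real.pi - Real.pi * √l) (Real.pi + Real.pi * √l)) := by gcongr
    _ = _ := by
      rw [Real.volume_Icc, show Real.pi + Real.pi * √l - (Real.pi - Real.pi * √l) =
        (2 * Real.pi) * √l by ring, ENNReal.ofReal_mul (p := 2 * Real.pi) (by positivity), ← mul_assoc,
        ENNReal.inv_mul_cancel ofReal_two_pi_ne_zero ENNReal.ofReal_ne_top, one_mul]

theorem circ_abs_cos_sub_le (y : ℝ) {l : ℝ} (hl : 0 ≤ l) :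
    circ {t | |Real.cos t - y| ≤ l} ≤ ENNReal.ofReal (2 * √l) := by
  have hm : MeasurableSet {t : ℝ | 1 - Real.cos t ≤ l} :=
    measurableSet_le (by fun_prop) measurable_const
  -- Clamping y to [-1, 1] only brings it closer to the values of the cosine.
  obtain ⟨b, hb⟩ : ∃ b : ℝ, ∀ t, |Real.cos t - y| ≤ l → |Real.cos t - Real.cos b| ≤ l := by
    refine ⟨Real.arccos y, fun t ht => ?_⟩
    rw [abs_le] at ht ⊢
    rcases lt_or_ge y (-1) with h | h
    · rw [Real.arccos_of_le_neg_one h.le, Real.cos_pi]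
      constructor <;> linarith [Real.neg_one_le_cos t]
    rcases lt_or_ge 1 y with h' | h'
    · rw [Real.arccos_of_one_le h'.le, Real.cos_zero]
      constructor <;> linarith [Real.cos_le_one t]
    rw [Real.cos_arccos h h']
    exact ht
  have hsub : {t | |Real.cos t - y| ≤ l} ⊆ (· + b) ⁻¹' {t : ℝ | 1 - Real.cos t ≤ l} ∪
      (· + -b) ⁻¹' {t : ℝ | 1 - Real.cos t ≤ l} := by
    intro t ht
    by_contra hcon
    simp only [Set.mem_union, Set.mem_preimage, Set.mem_ofPred_eq, not_or, not_le] at hcon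
    have h1 := hb t ht
    -- If the product of the two factors is at most l², one factor is at most l, so t is close to b
    -- or to -b modulo 2π.
    have e : (Real.cos t - Real.cos b) ^ 2 =
        (1 - Real.cos (t + b)) * (1 - Real.cos (t + -b)) := by
      rw [← sub_eq_add_neg, Real.cos_add, Real.cos_sub]
      have h2 := Real.sin_sq_add_cos_sq t
      have h3 := Real.sin_sq_add_cos_sq b
      have h4 : Real.sin t ^ 2 = 1 - Real.cos t ^ 2 := by linarith
      have h5 : Real.sin b ^ 2 = 1 - Real.cos b ^ 2 := by linarith
      linear_combination Real.sin b ^ 2 * h4 + (1 - Real.cos t ^ 2) * h5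
    have h2 : (Real.cos t - Real.cos b) ^ 2 ≤ l ^ 2 := sq_le_sq' (abs_le.1 h1).1 (abs_le.1 h1).2
    nlinarith
  calc _ ≤ _ := measure_mono hsub
    _ ≤ _ := measure_union_le _ _
    _ = circ {t : ℝ | 1 - Real.cos t ≤ l} + circ {t : ℝ | 1 - Real.cos t ≤ l} := by
      rw [circ_preimage_add hm (fun t => by simp), circ_preimage_add hm (fun t => by simp)]
    _ ≤ ENNReal.ofReal √l + ENNReal.ofReal √l :=
      add_le_add (circ_one_sub_cos_le hl) (circ_one_sub_cos_le hl)
    _ = _ := by rw [← ENNReal.ofReal_add (by positivity) (by positivity), two_mul]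

theorem le_circ_cos_gt {η : ℝ} (h0 : 0 < η) (h1 : η ≤ 1) :
    ENNReal.ofReal (√η / (2 * Real.pi)) ≤ circ {t | 1 - η < Real.cos t} := by
  have hpi := Real.pi_gt_three
  have hm : MeasurableSet {t : ℝ | 1 - η < Real.cos t} :=
    measurableSet_lt measurable_const (by fun_prop)
  have hs1 : √η ≤ 1 := by simpa using Real.sqrt_le_sqrt h1
  have hsub : Set.Ioo 0 √η ⊆ {t : ℝ | 1 - η < Real.cos t} ∩ Set.Ioc 0 (2 * Real.pi) := by
    rintro t ⟨h2, h3⟩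
    refine ⟨?_, h2, by linarith⟩
    have h4 : t ^ 2 < η := by
      have := Real.sq_sqrt h0.le
      nlinarith
    have h5 := Real.one_sub_sq_div_two_le_cos (x := t)
    simp only [Set.mem_ofPred_eq]
    nlinarith
  rw [circ_apply hm]
  calc _ = (ENNReal.ofReal (2 * Real.pi))⁻¹ * volume (Set.Ioo 0 √η) := by
        rw [Real.volume_Ioo, sub_zero, div_eq_mul_inv, mul_comm, ENNReal.ofReal_mul (by positivity),
          ENNReal.ofReal_inv_of_pos (by positivity)]
    _ ≤ _ := by gcongr

/-! ### Haar measure estimates -/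

@[fun_prop]
theorem measurable_rot0 : Measurable rot0 := continuous_rot0.measurable

@[fun_prop]
theorem measurable_rot2 : Measurable rot2 := continuous_rot2.measurable

/-- Tonelli and invariance: for each t the translation by `γ t` can be undone. Integrals over the
group thus become averages over an angle, which `lintegral_circ_phase` evaluates. -/
theorem lintegral_haar_right {f : SO3 → ENNReal} (hf : Measurable f) {γ : ℝ → SO3}
    (hγ : Measurable γ) : ∫⁻ h, f h ∂haar = ∫⁻ h, ∫⁻ t, f (h * γ t) ∂circ ∂haar := by
  rw [lintegral_lintegral_swap (by fun_prop)]
  simp [lintegral_mul_right_eq_self]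

theorem lintegral_haar_left {f : SO3 → ENNReal} (hf : Measurable f) {γ : ℝ → SO3}
    (hγ : Measurable γ) : ∫⁻ h, f h ∂haar = ∫⁻ h, ∫⁻ t, f (γ t * h) ∂circ ∂haar := by
  rw [lintegral_lintegral_swap (by fun_prop)]
  simp [lintegral_mul_left_eq_self]

theorem haar_apply_right {s : Set SO3} (hs : MeasurableSet s) {γ : ℝ → SO3}
    (hγ : Measurable γ) : haar s = ∫⁻ h, circ ((fun t => h * γ t) ⁻¹' s) ∂haar := by
  rw [← lintegral_indicator_one hs, lintegral_haar_right (measurable_one.indicator hs) hγ]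
  refine lintegral_congr fun h => ?_
  rw [← lintegral_indicator_one (hs.preimage (by fun_prop : Measurable fun t => h * γ t))]
  rfl

theorem circ_phase {S : Set ℝ} (hS : MeasurableSet S) (A B : ℝ) :
    circ {t | A * Real.cos t + B * Real.sin t ∈ S} =
      circ {t | √(A ^ 2 + B ^ 2) * Real.cos t ∈ S} := by
  have := lintegral_circ_phase (S.indicator 1) A B
  have e1 := circ_eq_lintegral (hS.preimage (by fun_prop : Measurable fun t =>
    A * Real.cos t + B * Real.sin t))
  have e2 := circ_eq_lintegral (hS.preimage (by fun_prop : Measurable fun t =>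
    √(A ^ 2 + B ^ 2) * Real.cos t))
  exact e1.trans (this.trans e2.symm)

theorem mul_measure_le_lintegral {α : Type*} [MeasurableSpace α] {μ : Measure α} {s : Set α}
    (hs : MeasurableSet s) {p : ENNReal} {f : α → ENNReal} (h : ∀ x ∈ s, p ≤ f x) :
    p * μ s ≤ ∫⁻ x, f x ∂μ := by
  rw [← lintegral_indicator_const hs]
  refine lintegral_mono fun x => ?_
  by_cases hx : x ∈ s
  · rw [Set.indicator_of_mem hx]; exact h x hx
  · rw [Set.indicator_of_notMem hx]; exact zero_le

theorem wt_neg (q : ℝ) : wt (-q) = wt q := by simp [wt]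

theorem wt_half_le : wt (1 / 2) ≤ 2 := by
  have h : (4 : ℝ)⁻¹ ^ (-(1 / 2) : ℝ) = 2 := by
    rw [Real.inv_rpow (by norm_num), Real.rpow_neg (by norm_num), inv_inv,
      show (4 : ℝ) = 2 ^ (2 : ℝ) by norm_num, ← Real.rpow_mul (by norm_num)]
    norm_num
  calc wt (1 / 2) ≤ wt (4⁻¹) := wt_anti (by rw [abs_of_pos, abs_of_pos] <;> norm_num)
    _ = 2 := by rw [wt_of_ne_zero (by norm_num), abs_of_pos (by norm_num), h]; simp

/-! ### Integrability of singular weights on the rotation group. -/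

theorem measurable_wt_ent (i j : Fin 3) : Measurable fun h : SO3 => wt (ent h i j) :=
  measurable_wt.comp (measurable_ent i j)

theorem abs_cos_le_sqrt (h : SO3) (t : ℝ) : |Real.cos t| ≤
    √(ent h 0 0 ^ 2 + (√(ent h 0 1 ^ 2 + ent h 0 2 ^ 2) * Real.cos t) ^ 2) := by
  have h1 := SO3_row0 h
  refine Real.abs_le_sqrt ?_
  rw [mul_pow, Real.sq_sqrt (by positivity)]
  have := Real.cos_sq_le_one t
  nlinarith [mul_nonneg (sq_nonneg (ent h 0 0)) (sub_nonneg.2 this)]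

/-- Averaging along `rot2` replaces the entry by an amplitude and gives one factor `cosAvg`. Along
`rot0` that amplitude is at least a shifted |cos t|, which gives the other. -/
theorem lintegral_wt_01_le : ∫⁻ h : SO3, wt (ent h 0 1) ∂haar ≤ cosAvg ^ 2 := by
  calc ∫⁻ h : SO3, wt (ent h 0 1) ∂haar
      = ∫⁻ h : SO3, wt (√(ent h 0 0 ^ 2 + ent h 0 1 ^ 2)) * cosAvg ∂haar := by
        rw [lintegral_haar_right (measurable_wt_ent 0 1) measurable_rot2]
        refine lintegral_congr fun h => ?_
        have := lintegral_circ_wt (ent h 0 1) (-ent h 0 0)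
        rw [neg_sq, add_comm (ent h 0 1 ^ 2)] at this
        rw [← this]
        refine lintegral_congr fun t => ?_
        rw [mul_rot2_01, neg_mul, sub_eq_add_neg]
    _ = (∫⁻ h : SO3, wt (√(ent h 0 0 ^ 2 + ent h 0 1 ^ 2)) ∂haar) * cosAvg :=
        lintegral_mul_const _ (by fun_prop)
    _ ≤ cosAvg * cosAvg := by
        gcongr
        rw [lintegral_haar_right (by fun_prop) measurable_rot0]
        calc _ ≤ ∫⁻ _ : SO3, cosAvg ∂haar := lintegral_mono fun h => by
              simp only [mul_rot0_00, mul_rot0_01]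
              rw [lintegral_circ_phase fun y => wt (√(ent h 0 0 ^ 2 + y ^ 2))]
              refine lintegral_mono fun t => wt_anti ?_
              rw [abs_of_nonneg (Real.sqrt_nonneg _)]
              exact abs_cos_le_sqrt h t
          _ = _ := by simp
    _ = _ := (sq _).symm

theorem lintegral_wt_02_le : ∫⁻ h : SO3, wt (ent h 0 2) ∂haar ≤ cosAvg ^ 2 := by
  rw [← lintegral_mul_right_eq_self _ (rot0 (Real.pi / 2))]
  simpa [mul_rot0_02, wt_neg] using lintegral_wt_01_le

/-- The squared length of the projection of the first axis to the tangent plane of a frame. -/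
def tilt (h : SO3) : ℝ := ent h 0 1 ^ 2 + ent h 0 2 ^ 2

@[fun_prop]
theorem measurable_tilt : Measurable tilt :=
  ((measurable_ent 0 1).pow_const 2).add ((measurable_ent 0 2).pow_const 2)

theorem tilt_nonneg (h : SO3) : 0 ≤ tilt h := by unfold tilt; positivity

theorem tilt_le_one (h : SO3) : tilt h ≤ 1 := by
  have := SO3_row0 h
  unfold tilt; nlinarith [sq_nonneg (ent h 0 0)]

/-- The average of the inverse length of the projection of the first axis to the tangent plane. -/
def tiltAvg : ENNReal := ∫⁻ h, wt (tilt h) ∂haar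

/-- Since a² + b² ≥ |ab|, the weight is at most a product of weights of two entries. Averaging along
`rot2` fixes one entry and turns the other into an amplitude. -/
theorem tiltAvg_lt_top : tiltAvg < ⊤ := by
  have hJ := cosAvg_lt_top
  have h0 : tiltAvg ≤ ∫⁻ h : SO3, wt (ent h 0 1) * wt (ent h 0 2) ∂haar := by
    refine lintegral_mono fun h => ?_
    rw [← wt_mul]
    refine wt_anti ?_
    rw [abs_of_nonneg (tilt_nonneg h), abs_le, tilt]
    constructor <;> nlinarith [sq_nonneg (ent h 0 1 + ent h 0 2), sq_nonneg (ent h 0 1 - ent h 0 2)]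
  refine h0.trans_lt ?_
  rw [lintegral_haar_right (by fun_prop) measurable_rot2]
  have h1 : ∀ h : SO3, ∫⁻ t, wt (ent (h * rot2 t) 0 1) * wt (ent (h * rot2 t) 0 2) ∂circ ≤
      2 * cosAvg * (wt (ent h 0 1) + wt (ent h 0 2)) := by
    intro h
    have e : ∫⁻ t, wt (ent (h * rot2 t) 0 1) * wt (ent (h * rot2 t) 0 2) ∂circ =
        wt (√(ent h 0 1 ^ 2 + (-ent h 0 0) ^ 2)) * cosAvg * wt (ent h 0 2) := by
      rw [← lintegral_circ_wt, ← lintegral_mul_const _ (by fun_prop)]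
      refine lintegral_congr fun t => ?_
      rw [mul_rot2_01, mul_rot2_02, neg_mul, sub_eq_add_neg]
    have hrow := SO3_row0 h
    rw [e, neg_sq]
    -- The first row is a unit vector, so the fixed entry and the amplitude cannot both be small;
    -- the weight of the large one is at most 2.
    rcases le_total (1 / 2) |ent h 0 2| with hc | hc
    · have a1 : wt (ent h 0 2) ≤ 2 := (wt_anti (by rwa [abs_of_pos (by norm_num)])).trans wt_half_le
      have a2 : wt (√(ent h 0 1 ^ 2 + ent h 0 0 ^ 2)) ≤ wt (ent h 0 1) := wt_anti (by
        rw [abs_of_nonneg (Real.sqrt_nonneg _)]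
        exact Real.abs_le_sqrt (by nlinarith [sq_nonneg (ent h 0 0)]))
      calc _ ≤ wt (ent h 0 1) * cosAvg * 2 := by gcongr
        _ = 2 * cosAvg * wt (ent h 0 1) := by ring
        _ ≤ _ := by gcongr; exact le_self_add
    · have a1 : wt (√(ent h 0 1 ^ 2 + ent h 0 0 ^ 2)) ≤ 2 := (wt_anti (by
        rw [abs_of_pos (by norm_num), abs_of_nonneg (Real.sqrt_nonneg _)]
        refine Real.le_sqrt_of_sq_le ?_
        have := sq_le_sq' (by linarith [abs_nonneg (ent h 0 2)]) hc
        rw [sq_abs] at this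
        nlinarith)).trans wt_half_le
      calc _ ≤ 2 * cosAvg * wt (ent h 0 2) := by gcongr
        _ ≤ _ := by gcongr; exact le_add_self
  refine (lintegral_mono h1).trans_lt ?_
  rw [lintegral_const_mul _ (by fun_prop), lintegral_add_left (by fun_prop)]
  have a1 := lintegral_wt_01_le.trans_lt (ENNReal.pow_lt_top hJ)
  have a2 := lintegral_wt_02_le.trans_lt (ENNReal.pow_lt_top hJ)
  exact ENNReal.mul_lt_top (ENNReal.mul_lt_top (by simp) hJ) (ENNReal.add_lt_top.2 ⟨a1, a2⟩)

/-- With c the corner entry, the tilt is (1 - c)(1 + c) ≤ 2(1 + c). -/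
theorem wt_one_add_le (h : SO3) : wt (1 + ent h 0 0) ≤ 2 * wt (tilt h) := by
  have h1 := SO3_row0 h
  have h2 := abs_le.1 (abs_entry_le_one h 0 0)
  calc wt (1 + ent h 0 0) = wt (1 / 2 * (2 * (1 + ent h 0 0))) := by ring_nf
    _ = wt (1 / 2) * wt (2 * (1 + ent h 0 0)) := wt_mul _ _
    _ ≤ 2 * wt (tilt h) := by
      gcongr
      · exact wt_half_le
      · refine wt_anti ?_
        rw [abs_of_nonneg (tilt_nonneg h), abs_of_nonneg (by linarith), tilt]
        nlinarith

theorem wt_eq_ofReal_inv_sqrt {q : ℝ} (hq : 0 < q) : wt q = ENNReal.ofReal (√q)⁻¹ := by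
  rw [wt_of_ne_zero hq.ne', abs_of_pos hq, Real.rpow_neg hq.le, Real.sqrt_eq_rpow]

/-- Shells around the identity have small measure. -/
theorem haar_shell_le (c : ℝ) {s : ℝ} (hs : 0 < s) :
    haar {h : SO3 | |tr h - c| ≤ s} ≤ ENNReal.ofReal (4 * √s) * tiltAvg := by
  have hm : MeasurableSet {h : SO3 | |tr h - c| ≤ s} := by
    exact measurableSet_le (by fun_prop) measurable_const
  rw [haar_apply_right hm measurable_rot0, tiltAvg,
    ← lintegral_const_mul _ (by fun_prop)]
  refine lintegral_mono fun h => ?_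
  have h00 := abs_le.1 (abs_entry_le_one h 0 0)
  have hset : MeasurableSet {y : ℝ | |ent h 0 0 + y - c| ≤ s} :=
    measurableSet_le (by fun_prop) measurable_const
  -- Along `h * rot0 t` the trace is a cosine of amplitude 1 + `ent h 0 0`, centred at `ent h 0 0`.
  have e : circ ((fun t => h * rot0 t) ⁻¹' {h : SO3 | |tr h - c| ≤ s}) =
      circ {t | |ent h 0 0 + (1 + ent h 0 0) * Real.cos t - c| ≤ s} := by
    have := circ_phase hset (ent h 1 1 + ent h 2 2) (ent h 1 2 - ent h 2 1)
    rw [SO3_minor_sq, Real.sqrt_sq (by linarith)] at this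
    refine Eq.trans (congrArg circ (Set.ext fun t => ?_)) this
    simp only [Set.mem_preimage, Set.mem_ofPred_eq, tr_mul_rot0]
  rw [e]
  -- When the amplitude vanishes the trace is constant along the orbit, but then the weight on the
  -- right is infinite.
  rcases h00.1.eq_or_lt with h0 | h0
  · have : wt (tilt h) = ⊤ := by
      have h1 := wt_one_add_le h
      rw [← h0] at h1
      rw [add_neg_cancel, show wt 0 = ⊤ by simp [wt], top_le_iff] at h1
      by_contra hcon
      exact absurd h1 (ENNReal.mul_ne_top (by simp) hcon)
    rw [this, ENNReal.mul_top]
    · exact le_top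
    · simpa using hs
  · have hp : 0 < 1 + ent h 0 0 := by linarith
    calc _ ≤ circ {t | |Real.cos t - (c - ent h 0 0) / (1 + ent h 0 0)| ≤ s / (1 + ent h 0 0)} := by
          refine measure_mono fun t ht => ?_
          simp only [Set.mem_ofPred_eq] at ht ⊢
          rw [le_div_iff₀ hp]
          calc _ = |(Real.cos t - (c - ent h 0 0) / (1 + ent h 0 0)) * (1 + ent h 0 0)| := by
                rw [abs_mul, abs_of_pos hp]
            _ = |ent h 0 0 + (1 + ent h 0 0) * Real.cos t - c| := by
                congr 1; field_simp; ring
            _ ≤ s := ht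
      _ ≤ ENNReal.ofReal (2 * √(s / (1 + ent h 0 0))) := circ_abs_cos_sub_le _ (by positivity)
      _ = ENNReal.ofReal (2 * √s) * wt (1 + ent h 0 0) := by
          rw [wt_eq_ofReal_inv_sqrt hp, ← ENNReal.ofReal_mul (by positivity),
            Real.sqrt_div hs.le]
          congr 1; ring
      _ ≤ ENNReal.ofReal (2 * √s) * (2 * wt (tilt h)) := by gcongr; exact wt_one_add_le h
      _ = _ := by
          rw [← mul_assoc, show (4 : ℝ) * √s = (2 * √s) * 2 by ring,
            ENNReal.ofReal_mul (p := 2 * √s) (by positivity)]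
          simp

/-- A `rot0` angle makes the first two entries of the first row carry almost all its length, then a
`rot2` angle moves this length to the corner. Each succeeds with probability at least p, and (1 -
η/2)² ≥ 1 - η. -/
theorem haar_col_gt_ge {η : ℝ} (h1 : η ≤ 1) :
    circ {t | 1 - η / 2 < Real.cos t} ^ 2 ≤ haar {h : SO3 | 1 - η < ent h 0 0} := by
  set p := circ {t | 1 - η / 2 < Real.cos t} with hp
  have hm : MeasurableSet {h : SO3 | 1 - η < ent h 0 0} :=
    measurableSet_lt measurable_const (measurable_ent 0 0)
  have hm' : MeasurableSet {h : SO3 | 1 - η / 2 < √(ent h 0 0 ^ 2 + ent h 0 1 ^ 2)} :=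
    measurableSet_lt measurable_const (by fun_prop)
  have s1 : p ≤ haar {h : SO3 | 1 - η / 2 < √(ent h 0 0 ^ 2 + ent h 0 1 ^ 2)} := by
    rw [haar_apply_right hm' measurable_rot0]
    calc p = ∫⁻ _ : SO3, p ∂haar := by simp
      _ ≤ _ := lintegral_mono fun h => ?_
    have := circ_phase (S := {y : ℝ | 1 - η / 2 < √(ent h 0 0 ^ 2 + y ^ 2)})
      (measurableSet_lt measurable_const (by fun_prop)) (ent h 0 1) (ent h 0 2)
    calc p ≤ _ := measure_mono fun t ht => ?_
      _ = _ := this.symm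
      _ = _ := congrArg circ (Set.ext fun t => by
        simp only [Set.mem_ofPred_eq, Set.mem_preimage, mul_rot0_00, mul_rot0_01])
    simp only [Set.mem_ofPred_eq] at ht ⊢
    exact ht.trans_le ((le_abs_self _).trans (abs_cos_le_sqrt h t))
  rw [haar_apply_right hm measurable_rot2, sq]
  calc p * p ≤ p * haar {h : SO3 | 1 - η / 2 < √(ent h 0 0 ^ 2 + ent h 0 1 ^ 2)} := by gcongr
    _ ≤ _ := mul_measure_le_lintegral hm' fun h hh => ?_
  have hh' : 1 - η / 2 < √(ent h 0 0 ^ 2 + ent h 0 1 ^ 2) := hh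
  have := circ_phase (S := {y : ℝ | 1 - η < y})
    (measurableSet_lt measurable_const measurable_id) (ent h 0 0) (ent h 0 1)
  calc p ≤ _ := measure_mono fun t ht => ?_
    _ = _ := this.symm
    _ = _ := congrArg circ (Set.ext fun t => by
      simp only [Set.mem_ofPred_eq, Set.mem_preimage, mul_rot2_00])
  simp only [Set.mem_ofPred_eq] at ht ⊢
  nlinarith [mul_pos (sub_pos.2 ht) (sub_pos.2 hh'), sq_nonneg η]

/-- A third angle, along `rot0`, brings the trace near its maximum once the corner entry is near 1.
Three angles for a three-dimensional group give the cube. -/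
theorem haar_trace_gt_ge {η : ℝ} (h0 : 0 < η) (h1 : η ≤ 1) :
    circ {t | 1 - η / 2 < Real.cos t} ^ 3 ≤ haar {h : SO3 | 3 - 4 * η < tr h} := by
  set p := circ {t | 1 - η / 2 < Real.cos t} with hp
  have hm : MeasurableSet {h : SO3 | 3 - 4 * η < tr h} :=
    measurableSet_lt measurable_const measurable_tr
  have hm' : MeasurableSet {h : SO3 | 1 - η < ent h 0 0} :=
    measurableSet_lt measurable_const (measurable_ent 0 0)
  rw [haar_apply_right hm measurable_rot0, pow_succ']
  calc p * p ^ 2 ≤ p * haar {h : SO3 | 1 - η < ent h 0 0} := by gcongr; exact haar_col_gt_ge h1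
    _ ≤ _ := mul_measure_le_lintegral hm' fun h hh => ?_
  have hh' : 1 - η < ent h 0 0 := hh
  have := circ_phase (S := {y : ℝ | 3 - 4 * η < ent h 0 0 + y})
    (measurableSet_lt measurable_const (by fun_prop))
    (ent h 1 1 + ent h 2 2) (ent h 1 2 - ent h 2 1)
  rw [SO3_minor_sq, Real.sqrt_sq (by linarith)] at this
  calc p ≤ _ := measure_mono fun t ht => ?_
    _ = _ := this.symm
    _ = _ := congrArg circ (Set.ext fun t => by
      simp only [Set.mem_ofPred_eq, Set.mem_preimage, tr_mul_rot0])
  simp only [Set.mem_ofPred_eq] at ht ⊢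
  nlinarith [mul_nonneg (sub_pos.2 ht).le (sub_pos.2 hh').le, sq_nonneg η]

/-! ### The ball U_δ as a superlevel set of the trace, and its volume. -/

theorem mem_identityBall {g : SO3} {δ : ℝ} : g ∈ identityBall δ ↔
    Real.arccos ((tr g - 1) / 2) / (2 * Real.pi ^ (2 / 3 : ℝ)) < δ := by
  rw [tr, ← trace_eq]; rfl

theorem exists_identityBall_eq {δ : ℝ} (hδ : 0 < δ) :
    ∃ c : ℝ, identityBall δ = {h : SO3 | c < tr h} := by
  have hc : 0 < 2 * Real.pi ^ (2 / 3 : ℝ) := by positivity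
  rcases le_or_gt (δ * (2 * Real.pi ^ (2 / 3 : ℝ))) Real.pi with h | h
  · refine ⟨1 + 2 * Real.cos (δ * (2 * Real.pi ^ (2 / 3 : ℝ))), Set.ext fun g => ?_⟩
    rw [mem_identityBall, Set.mem_ofPred_eq, div_lt_iff₀ hc, Real.arccos, sub_lt_comm, Real.lt_arcsin_iff_sin_lt', Real.sin_pi_div_two_sub]
    · constructor <;> intro h <;> linarith
    · exact ⟨by linarith, by nlinarith⟩
  -- The ball is everything here, and a sum of three entries is at least -3.
  · refine ⟨-4, Set.ext fun g => ?_⟩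
    rw [mem_identityBall, Set.mem_ofPred_eq, div_lt_iff₀ hc]
    refine iff_of_true ((Real.arccos_le_pi _).trans_lt h) ?_
    rw [tr]
    linarith [abs_le.1 (abs_entry_le_one g 0 0), abs_le.1 (abs_entry_le_one g 1 1),
      abs_le.1 (abs_entry_le_one g 2 2)]

theorem one_le_pi_rpow : 1 ≤ Real.pi ^ (2 / 3 : ℝ) :=
  Real.one_le_rpow (by linarith [Real.pi_gt_three]) (by norm_num)

/-- The largest distance from the identity is π^(1/3)/2, which is less than 1. -/
theorem identityBall_eq_univ {δ : ℝ} (hδ : 1 ≤ δ) : identityBall δ = Set.univ := by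
  refine Set.eq_univ_of_forall fun g => ?_
  rw [mem_identityBall]
  have h2 : Real.pi < 2 * Real.pi ^ (2 / 3 : ℝ) := by
    have h4 : Real.pi = Real.pi ^ (2 / 3 : ℝ) * Real.pi ^ (1 / 3 : ℝ) := by
      rw [← Real.rpow_add Real.pi_pos]; norm_num
    have h5 : Real.pi ^ (1 / 3 : ℝ) < 2 := by
      calc Real.pi ^ (1 / 3 : ℝ) < 8 ^ (1 / 3 : ℝ) :=
            Real.rpow_lt_rpow Real.pi_pos.le (by linarith [Real.pi_le_four]) (by norm_num)
        _ = 2 := by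
            rw [show (8 : ℝ) = 2 ^ (3 : ℝ) by norm_num, ← Real.rpow_mul (by norm_num)]; norm_num
    nlinarith [one_le_pi_rpow]
  rw [div_lt_iff₀ (by positivity)]
  nlinarith [Real.arccos_le_pi ((tr g - 1) / 2), one_le_pi_rpow]

/-- A lower bound for the volume of the ball of radius `δ ≤ 1`. -/
theorem haar_identityBall_ge {δ : ℝ} (h0 : 0 < δ) (h1 : δ ≤ 1) :
    ENNReal.ofReal ((δ / 48) ^ 3) ≤ haar (identityBall δ) := by
  have hpi := Real.pi_gt_three
  have hpi4 := Real.pi_le_four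
  -- With η = δ²/16, a trace above 3 - 4η forces a rotation angle below δ. Each of the three arcs
  -- has measure at least √(η/2)/(2π) ≥ (δ/6)/8, whence 48.
  have hη : δ ^ 2 / 16 ≤ 1 := by nlinarith
  have hp : ENNReal.ofReal (δ / 48) ≤ circ {t | 1 - δ ^ 2 / 16 / 2 < Real.cos t} := by
    refine le_trans (ENNReal.ofReal_le_ofReal ?_)
      (le_circ_cos_gt (η := δ ^ 2 / 16 / 2) (by positivity) (by linarith))
    have : δ / 6 ≤ √(δ ^ 2 / 16 / 2) := Real.le_sqrt_of_sq_le (by nlinarith [sq_nonneg δ])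
    rw [le_div_iff₀ (by positivity)]
    nlinarith
  calc _ = ENNReal.ofReal (δ / 48) ^ 3 := ENNReal.ofReal_pow (by positivity) 3
    _ ≤ circ {t | 1 - δ ^ 2 / 16 / 2 < Real.cos t} ^ 3 := by gcongr
    _ ≤ haar {h : SO3 | 3 - 4 * (δ ^ 2 / 16) < tr h} :=
      haar_trace_gt_ge (by positivity) hη
    _ ≤ _ := measure_mono fun g hg => by
      rw [mem_identityBall]
      rw [Set.mem_ofPred_eq] at hg
      have hcos := Real.cos_le_one_sub_mul_cos_sq (x := δ) (by rw [abs_of_pos h0]; linarith)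
      have h3 : δ ^ 2 / 8 ≤ 2 / Real.pi ^ 2 * δ ^ 2 := by
        rw [div_mul_eq_mul_div, le_div_iff₀ (by positivity)]
        have : Real.pi ^ 2 ≤ 16 := by nlinarith
        nlinarith [sq_nonneg δ]
      have h4 : Real.arccos ((tr g - 1) / 2) < δ := by
        rw [Real.arccos, sub_lt_comm, Real.lt_arcsin_iff_sin_lt' ⟨by linarith, by linarith⟩,
          Real.sin_pi_div_two_sub]
        linarith
      rw [div_lt_iff₀ (by positivity)]
      nlinarith [one_le_pi_rpow]

/-! ### The derivative cocycle in moving frames -/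

/-- The projection of the first axis to the tangent plane of the frame `h`, as a complex number. -/
def ell (h : SO3) : ℂ := ⟨ent h 0 1, ent h 0 2⟩

@[fun_prop]
theorem continuous_ell : Continuous ell := by
  have : ell = fun h => (ent h 0 1 : ℂ) + ent h 0 2 * Complex.I := by
    funext h; exact Complex.mk_eq_add_mul_I _ _
  rw [this]; fun_prop

theorem normSq_ell (h : SO3) : Complex.normSq (ell h) = tilt h := by
  rw [ell, Complex.normSq_mk, tilt]; ring

theorem norm_ell_sq (h : SO3) : ‖ell h‖ ^ 2 = tilt h := by
  rw [← normSq_ell, Complex.sq_norm]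

theorem norm_ell_le_one (h : SO3) : ‖ell h‖ ≤ 1 := by
  have := tilt_le_one h
  rw [← norm_ell_sq] at this
  nlinarith [norm_nonneg (ell h)]

theorem ell_mul_rot0 (h : SO3) (t : ℝ) :
    ell (h * rot0 t) = Complex.exp (-(t * Complex.I)) * ell h := by
  have : Complex.exp (-(t * Complex.I)) = ⟨Real.cos t, -Real.sin t⟩ := by
    rw [← neg_mul, ← Complex.ofReal_neg, Complex.exp_mul_I, ← Complex.ofReal_cos,
      ← Complex.ofReal_sin, Real.cos_neg, Real.sin_neg, Complex.mk_eq_add_mul_I]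
  rw [this, ell, ell, mul_rot0_01, mul_rot0_02]
  apply Complex.ext <;> simp <;> ring

/-- The tangent map of the twist in moving frames. -/
def shear (ε : ℝ) (h : SO3) : ℂ →L[ℝ] ℂ :=
  ContinuousLinearMap.id ℝ ℂ -
    (innerSL ℝ (ell h)).smulRight (((Real.pi * ε : ℝ) : ℂ) * (Complex.I * ell h))

theorem shear_apply (ε : ℝ) (h : SO3) (z : ℂ) : shear ε h z =
    z - ((inner ℝ (ell h) z : ℝ) : ℂ) * ((Real.pi * ε : ℝ) * (Complex.I * ell h)) := by
  simp [shear]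

theorem continuous_shear (ε : ℝ) : Continuous (shear ε) := by
  unfold shear
  refine continuous_const.sub ?_
  exact ((ContinuousLinearMap.smulRightL ℝ ℂ ℂ).continuous₂).comp
    (((innerSL ℝ).continuous.comp continuous_ell).prodMk
      (continuous_const.mul (continuous_const.mul continuous_ell)))

theorem inner_exp_mul (t : ℝ) (z w : ℂ) :
    inner ℝ (Complex.exp (-(t * Complex.I)) * z) w =
      inner ℝ z (Complex.exp (t * Complex.I) * w) := by
  rw [Complex.inner, Complex.inner, map_mul, ← Complex.exp_conj]
  simp only [map_neg, map_mul, Complex.conj_ofReal, Complex.conj_I, mul_neg, neg_neg]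
  congr 1; ring

/-- Rotating the tangent frame conjugates the shear. The norm of the image of a direction can thus
be read off at 1 in a rotated frame. -/
theorem shear_mul_rot0 (ε : ℝ) (h : SO3) (t : ℝ) (z : ℂ) : shear ε (h * rot0 t) z =
    Complex.exp (-(t * Complex.I)) * shear ε h (Complex.exp (t * Complex.I) * z) := by
  rw [shear_apply, shear_apply, ell_mul_rot0, inner_exp_mul, mul_sub,
    ← mul_assoc (Complex.exp (-(t * Complex.I))) (Complex.exp (t * Complex.I)),
    ← Complex.exp_add, neg_add_cancel, Complex.exp_zero, one_mul]
  ring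

theorem inner_ell_I_mul_ell (h : SO3) (c : ℝ) : inner ℝ (ell h) (c * (Complex.I * ell h)) = 0 := by
  rw [Complex.inner]; simp; ring

/-- The displacement is along iℓ, orthogonal to ℓ. Hence the inverse is the same shear with opposite
sign, which gives the lower bound on its stretching. -/
theorem inner_ell_shear (ε : ℝ) (h : SO3) (z : ℂ) :
    inner ℝ (ell h) (shear ε h z) = inner ℝ (ell h) z := by
  have h1 : ((inner ℝ (ell h) z : ℝ) : ℂ) * ((Real.pi * ε : ℝ) * (Complex.I * ell h)) =
      ((inner ℝ (ell h) z * (Real.pi * ε) : ℝ) : ℂ) * (Complex.I * ell h) := by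
    push_cast; ring
  rw [shear_apply, inner_sub_right, h1, inner_ell_I_mul_ell, sub_zero]

theorem norm_shear_aux {ε : ℝ} (hε : 0 ≤ ε) (h : SO3) (z : ℂ) :
    ‖((inner ℝ (ell h) z : ℝ) : ℂ) * ((Real.pi * ε : ℝ) * (Complex.I * ell h))‖ ≤
      Real.pi * ε * ‖z‖ := by
  have h1 : |inner ℝ (ell h) z| ≤ ‖z‖ := (abs_real_inner_le_norm _ _).trans
    (mul_le_of_le_one_left (norm_nonneg _) (norm_ell_le_one h))
  have hp : 0 ≤ Real.pi * ε := mul_nonneg Real.pi_pos.le hε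
  rw [norm_mul, norm_mul, norm_mul, Complex.norm_I, one_mul, Complex.norm_real, Complex.norm_real,
    Real.norm_eq_abs, Real.norm_eq_abs, abs_of_nonneg hp]
  calc |inner ℝ (ell h) z| * (Real.pi * ε * ‖ell h‖) ≤ ‖z‖ * (Real.pi * ε * 1) := by
        gcongr; exact norm_ell_le_one h
    _ = _ := by ring

theorem norm_shear_apply_le {ε : ℝ} (hε : 0 ≤ ε) (h : SO3) (z : ℂ) :
    ‖shear ε h z‖ ≤ (1 + Real.pi * ε) * ‖z‖ := by
  rw [shear_apply]
  refine (norm_sub_le _ _).trans ?_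
  linarith [norm_shear_aux hε h z]

theorem norm_le_norm_shear_apply {ε : ℝ} (hε : 0 ≤ ε) (h : SO3) (z : ℂ) :
    ‖z‖ ≤ (1 + Real.pi * ε) * ‖shear ε h z‖ := by
  have h1 : z = shear ε h z + ((inner ℝ (ell h) (shear ε h z) : ℝ) : ℂ) *
      ((Real.pi * ε : ℝ) * (Complex.I * ell h)) := by
    rw [inner_ell_shear, shear_apply]; ring
  calc ‖z‖ = _ := congrArg norm h1
    _ ≤ _ := norm_add_le _ _
    _ ≤ _ := by linarith [norm_shear_aux hε h (shear ε h z)]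

/-- The twist on frames that moves tangent planes by rotations about the first axis. -/
def bstep (ε : ℝ) (h : SO3) : SO3 := rot0 (Real.pi * ε * (ent h 0 0 + 1)) * h

theorem bstep_mul_rot0 (ε : ℝ) (h : SO3) (t : ℝ) : bstep ε (h * rot0 t) = bstep ε h * rot0 t := by
  rw [bstep, bstep, mul_rot0_00, ← mul_assoc (rot0 _)]

@[fun_prop]
theorem measurable_bstep (ε : ℝ) : Measurable (bstep ε) := by
  unfold bstep; fun_prop

/-- Sequences of rotations together with a frame. -/
abbrev Orbit : Type := (ℕ → SO3) × SO3

/-- The random dynamics on frames, as a skew product over the shift. -/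
def skew (ε : ℝ) (y : Orbit) : Orbit := (fun n => y.1 (n + 1), y.1 0 * bstep ε y.2)

@[fun_prop]
theorem measurable_skew (ε : ℝ) : Measurable (skew ε) := by
  unfold skew
  refine Measurable.prodMk (measurable_pi_lambda _ fun n => ?_) ?_ <;> fun_prop

/-- The derivative cocycle of the random dynamics in moving frames. -/
def cocyc (ε : ℝ) : ℕ → Orbit → ℂ →L[ℝ] ℂ
  | 0, _ => ContinuousLinearMap.id ℝ ℂ
  | n + 1, y => (cocyc ε n (skew ε y)).comp (shear ε y.2)

theorem measurable_cocyc (ε : ℝ) (n : ℕ) : Measurable (cocyc ε n) := by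
  induction n with
  | zero => exact measurable_const
  | succ n ih =>
    have h1 : Continuous fun p : (ℂ →L[ℝ] ℂ) × (ℂ →L[ℝ] ℂ) => p.1.comp p.2 := by fun_prop
    exact h1.measurable.comp ((ih.comp (measurable_skew ε)).prodMk
      ((continuous_shear ε).measurable.comp measurable_snd))

theorem cocyc_add (ε : ℝ) (m n : ℕ) (y : Orbit) :
    cocyc ε (n + m) y = (cocyc ε m ((skew ε)^[n] y)).comp (cocyc ε n y) := by
  induction n generalizing y with
  | zero => simp [cocyc]
  | succ n ih =>
    rw [Nat.add_right_comm, cocyc, ih, Function.iterate_succ_apply, cocyc]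
    rfl

theorem cocyc_mul_rot0 (ε : ℝ) (n : ℕ) (ω : ℕ → SO3) (h : SO3) (t : ℝ) (z : ℂ) :
    cocyc ε n (ω, h * rot0 t) z =
      Complex.exp (-(t * Complex.I)) * cocyc ε n (ω, h) (Complex.exp (t * Complex.I) * z) := by
  induction n generalizing ω h z with
  | zero => simp [cocyc, ← mul_assoc, ← Complex.exp_add]
  | succ n ih =>
    simp only [cocyc, ContinuousLinearMap.comp_apply, skew, bstep_mul_rot0, ← mul_assoc]
    rw [ih, shear_mul_rot0, ← mul_assoc (Complex.exp (t * Complex.I)), ← Complex.exp_add]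
    simp

theorem norm_exp_neg_mul_I (t : ℝ) : ‖Complex.exp (-(t * Complex.I))‖ = 1 := by
  rw [← neg_mul, ← Complex.ofReal_neg, Complex.norm_exp_ofReal_mul_I]

theorem norm_cocyc_mul_rot0 (ε : ℝ) (n : ℕ) (ω : ℕ → SO3) (h : SO3) (t : ℝ) :
    ‖cocyc ε n (ω, h * rot0 t) 1‖ = ‖cocyc ε n (ω, h) (Complex.exp (t * Complex.I))‖ := by
  rw [cocyc_mul_rot0, norm_mul, norm_exp_neg_mul_I, one_mul, mul_one]

theorem norm_cocyc_apply_le {ε : ℝ} (hε : 0 ≤ ε) (n : ℕ) (y : Orbit) (z : ℂ) :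
    ‖cocyc ε n y z‖ ≤ (1 + Real.pi * ε) ^ n * ‖z‖ := by
  induction n generalizing y z with
  | zero => simp [cocyc]
  | succ n ih =>
    calc _ ≤ (1 + Real.pi * ε) ^ n * ‖shear ε y.2 z‖ := ih _ _
      _ ≤ (1 + Real.pi * ε) ^ n * ((1 + Real.pi * ε) * ‖z‖) := by
        gcongr; exact norm_shear_apply_le hε _ _
      _ = _ := by ring

theorem norm_le_norm_cocyc_apply {ε : ℝ} (hε : 0 ≤ ε) (n : ℕ) (y : Orbit) (z : ℂ) :
    ‖z‖ ≤ (1 + Real.pi * ε) ^ n * ‖cocyc ε n y z‖ := by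
  induction n generalizing y z with
  | zero => simp [cocyc]
  | succ n ih =>
    calc ‖z‖ ≤ (1 + Real.pi * ε) * ‖shear ε y.2 z‖ := norm_le_norm_shear_apply hε _ _
      _ ≤ (1 + Real.pi * ε) * ((1 + Real.pi * ε) ^ n * ‖cocyc ε (n + 1) y z‖) := by
        gcongr; exact ih _ _
      _ = _ := by ring

theorem cocyc_apply_ne_zero {ε : ℝ} (hε : 0 ≤ ε) (n : ℕ) (y : Orbit) {z : ℂ} (hz : z ≠ 0) :
    cocyc ε n y z ≠ 0 := by
  intro h0
  have := norm_le_norm_cocyc_apply hε n y z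
  rw [h0, norm_zero, mul_zero] at this
  exact hz (norm_le_zero_iff.1 this)

/-- The maximal expansion rate of one step of the cocycle. -/
def rate (ε : ℝ) : ℝ := Real.log (1 + Real.pi * ε)

theorem rate_nonneg {ε : ℝ} (hε : 0 ≤ ε) : 0 ≤ rate ε :=
  Real.log_nonneg (by nlinarith [Real.pi_pos])

theorem abs_log_le_of_bounds {a b : ℝ} (n : ℕ) (ha : 1 ≤ a) (h1 : b ≤ a ^ n) (h2 : 1 ≤ a ^ n * b) :
    |Real.log b| ≤ n * Real.log a := by
  have hp : 0 < a ^ n := by positivity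
  have hb : 0 < b := by by_contra hcon; nlinarith
  rw [abs_le, ← Real.log_pow]
  constructor
  · have := Real.log_le_log one_pos h2
    rw [Real.log_one, Real.log_mul hp.ne' hb.ne'] at this
    linarith
  · exact Real.log_le_log hb h1

theorem abs_log_norm_cocyc_apply_le {ε : ℝ} (hε : 0 ≤ ε) (n : ℕ) (y : Orbit) {z : ℂ}
    (hz : ‖z‖ = 1) : |Real.log ‖cocyc ε n y z‖| ≤ n * rate ε := by
  refine abs_log_le_of_bounds n (by nlinarith [Real.pi_pos]) ?_ ?_
  · simpa [hz] using norm_cocyc_apply_le hε n y z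
  · simpa [hz] using norm_le_norm_cocyc_apply hε n y z

theorem abs_log_norm_cocyc_le {ε : ℝ} (hε : 0 ≤ ε) (n : ℕ) (y : Orbit) :
    |Real.log ‖cocyc ε n y‖| ≤ n * rate ε := by
  have hp : 0 ≤ Real.pi * ε := mul_nonneg Real.pi_pos.le hε
  refine abs_log_le_of_bounds n (by linarith) ?_ ?_
  · exact ContinuousLinearMap.opNorm_le_bound _ (by positivity) fun z => norm_cocyc_apply_le hε n y z
  · have h1 := norm_le_norm_cocyc_apply hε n y 1
    have h2 := (cocyc ε n y).le_opNorm 1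
    rw [norm_one, mul_one] at h2
    rw [norm_one] at h1
    exact h1.trans (by gcongr)

theorem norm_cocyc_pos {ε : ℝ} (hε : 0 ≤ ε) (n : ℕ) (y : Orbit) : 0 < ‖cocyc ε n y‖ := by
  refine norm_pos_iff.2 fun h0 => ?_
  exact cocyc_apply_ne_zero hε n y one_ne_zero (by rw [h0]; rfl)

theorem log_norm_cocyc_add_le {ε : ℝ} (hε : 0 ≤ ε) (m n : ℕ) (y : Orbit) :
    Real.log ‖cocyc ε (n + m) y‖ ≤
      Real.log ‖cocyc ε n y‖ + Real.log ‖cocyc ε m ((skew ε)^[n] y)‖ := by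
  rw [← Real.log_mul (norm_cocyc_pos hε _ _).ne' (norm_cocyc_pos hε _ _).ne', mul_comm]
  refine Real.log_le_log (norm_cocyc_pos hε _ _) ?_
  rw [cocyc_add]
  exact ContinuousLinearMap.opNorm_comp_le _ _

/-- The logarithmic stretch of the first tangent vector of a frame under the twist. -/
def stretch (ε : ℝ) (h : SO3) : ℝ := Real.log ‖shear ε h 1‖

/-- The projective action of the twist on frames. -/
def fstep (ε : ℝ) (h : SO3) : SO3 := bstep ε h * rot0 (Complex.arg (shear ε h 1))

@[fun_prop]
theorem measurable_shear_one (ε : ℝ) : Measurable fun h => shear ε h 1 :=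
  ((continuous_shear ε).clm_apply continuous_const).measurable

@[fun_prop]
theorem measurable_stretch (ε : ℝ) : Measurable (stretch ε) := by
  unfold stretch; fun_prop

@[fun_prop]
theorem measurable_fstep (ε : ℝ) : Measurable (fstep ε) := by
  unfold fstep; fun_prop

theorem abs_stretch_le {ε : ℝ} (hε : 0 ≤ ε) (h : SO3) : |stretch ε h| ≤ rate ε := by
  have := abs_log_norm_cocyc_apply_le hε 1 (fun _ => 1, h) (z := 1) (by simp)
  simpa [cocyc, stretch] using this

/-- The new frame `fstep` has the normalized image vector as its first tangent vector, so the
logarithmic growth of a vector becomes an additive functional of a walk on frames. -/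
theorem log_norm_cocyc_succ {ε : ℝ} (hε : 0 ≤ ε) (n : ℕ) (y : Orbit) :
    Real.log ‖cocyc ε (n + 1) y 1‖ = stretch ε y.2 +
      Real.log ‖cocyc ε n (fun n => y.1 (n + 1), y.1 0 * fstep ε y.2) 1‖ := by
  have h1 : shear ε y.2 1 = (‖shear ε y.2 1‖ : ℝ) •
      Complex.exp (Complex.arg (shear ε y.2 1) * Complex.I) := by
    rw [Complex.real_smul, Complex.norm_mul_exp_arg_mul_I]
  have h2 : shear ε y.2 1 ≠ 0 := by
    have := cocyc_apply_ne_zero hε 1 y (z := 1) one_ne_zero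
    simpa [cocyc] using this
  have h3 : cocyc ε (n + 1) y 1 = (‖shear ε y.2 1‖ : ℝ) • cocyc ε n (skew ε y)
      (Complex.exp (Complex.arg (shear ε y.2 1) * Complex.I)) := by
    rw [← map_smul, ← h1]; rfl
  rw [h3, norm_smul, norm_norm, fstep, ← mul_assoc, norm_cocyc_mul_rot0, Real.log_mul, stretch]
  · rfl
  · exact norm_ne_zero_iff.2 h2
  · exact norm_ne_zero_iff.2 (cocyc_apply_ne_zero hε _ _ (Complex.exp_ne_zero _))

/-! ### Frames and tangent vectors of the sphere -/

/-- The point of the sphere of radius `1/2` under the frame `h`. -/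
def pt (h : SO3) : E3 := !₂[ent h 0 0 / 2, ent h 1 0 / 2, ent h 2 0 / 2]

/-- The tangent vector with coordinates `z` in the frame `h`. -/
def emb (h : SO3) (z : ℂ) : E3 :=
  !₂[ent h 0 1 * z.re + ent h 0 2 * z.im, ent h 1 1 * z.re + ent h 1 2 * z.im,
    ent h 2 1 * z.re + ent h 2 2 * z.im]

theorem continuous_pt : Continuous pt := by
  unfold pt
  refine (PiLp.continuous_toLp 2 _).comp (continuous_pi fun i => ?_)
  fin_cases i <;> simp <;> fun_prop

theorem norm_pt (h : SO3) : ‖pt h‖ = 1 / 2 := by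
  have h1 := SO3_cols h 0 0
  simp only [if_true] at h1
  rw [EuclideanSpace.norm_eq, Real.sqrt_eq_iff_mul_self_eq (by positivity) (by norm_num)]
  simp [Fin.sum_univ_three, pt]
  nlinarith

theorem norm_emb (h : SO3) (z : ℂ) : ‖emb h z‖ = ‖z‖ := by
  have h1 := SO3_cols h 1 1
  have h2 := SO3_cols h 2 2
  have h3 := SO3_cols h 1 2
  simp at h1 h2 h3
  rw [EuclideanSpace.norm_eq, Complex.norm_def]
  congr 1
  simp [Fin.sum_univ_three, emb, Complex.normSq_apply]
  linear_combination z.re ^ 2 * h1 + z.im ^ 2 * h2 + 2 * z.re * z.im * h3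

theorem emb_mem (h : SO3) (z : ℂ) : emb h z ∈ (ℝ ∙ pt h)ᗮ := by
  have h1 := SO3_cols h 0 1
  have h2 := SO3_cols h 0 2
  simp at h1 h2
  rw [Submodule.mem_orthogonal_singleton_iff_inner_right]
  simp [PiLp.inner_apply, Fin.sum_univ_three, emb, pt]
  linear_combination z.re / 2 * h1 + z.im / 2 * h2

theorem exists_emb_eq (h : SO3) {v : E3} (hv : v ∈ (ℝ ∙ pt h)ᗮ) : ∃ z, v = emb h z := by
  rw [Submodule.mem_orthogonal_singleton_iff_inner_right] at hv
  simp [PiLp.inner_apply, Fin.sum_univ_three, pt] at hv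
  refine ⟨⟨ent h 0 1 * v 0 + ent h 1 1 * v 1 + ent h 2 1 * v 2,
    ent h 0 2 * v 0 + ent h 1 2 * v 1 + ent h 2 2 * v 2⟩, ?_⟩
  have r00 := SO3_rows h 0 0
  have r01 := SO3_rows h 0 1
  have r02 := SO3_rows h 0 2
  have r11 := SO3_rows h 1 1
  have r12 := SO3_rows h 1 2
  have r22 := SO3_rows h 2 2
  simp at r00 r01 r02 r11 r12 r22
  ext i
  fin_cases i <;> simp [emb]
  · linear_combination (-v 0) * r00 - v 1 * r01 - v 2 * r02 + 2 * ent h 0 0 * hv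
  · linear_combination (-v 0) * r01 - v 1 * r11 - v 2 * r12 + 2 * ent h 1 0 * hv
  · linear_combination (-v 0) * r02 - v 1 * r12 - v 2 * r22 + 2 * ent h 2 0 * hv

theorem ent_mul (g h : SO3) (i j : Fin 3) :
    ent (g * h) i j = ent g i 0 * ent h 0 j + ent g i 1 * ent h 1 j + ent g i 2 * ent h 2 j := by
  simp [ent_def, Matrix.mul_apply, Fin.sum_univ_three]

theorem rotate_apply (g : SO3) (v : E3) (i : Fin 3) :
    rotate g v i = ent g i 0 * v 0 + ent g i 1 * v 1 + ent g i 2 * v 2 := by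
  have := congrFun (Matrix.ofLp_toEuclideanCLM (𝕜 := ℝ) g.1 v) i
  refine this.trans ?_
  simp [Matrix.mulVec, dotProduct, ent_def, Fin.sum_univ_three]

theorem rotate_pt (g h : SO3) : rotate g (pt h) = pt (g * h) := by
  ext i
  rw [rotate_apply]
  fin_cases i <;> simp [pt, ent_mul] <;> ring

theorem rotate_emb (g h : SO3) (z : ℂ) : rotate g (emb h z) = emb (g * h) z := by
  ext i
  rw [rotate_apply]
  fin_cases i <;> simp [emb, ent_mul] <;> ring

/-! ### The twist map and its derivative -/

theorem twist_apply (ε : ℝ) (x : E3) : twist ε x = !₂[x 0,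
    Real.cos (2 * Real.pi * (x 0 + 1 / 2) * ε) * x 1 -
      Real.sin (2 * Real.pi * (x 0 + 1 / 2) * ε) * x 2,
    Real.sin (2 * Real.pi * (x 0 + 1 / 2) * ε) * x 1 +
      Real.cos (2 * Real.pi * (x 0 + 1 / 2) * ε) * x 2] := by
  have h1 : Complex.exp (2 * Real.pi * Complex.I * (x 0 + 1 / 2) * ε) =
      ⟨Real.cos (2 * Real.pi * (x 0 + 1 / 2) * ε), Real.sin (2 * Real.pi * (x 0 + 1 / 2) * ε)⟩ := by
    rw [show (2 * Real.pi * Complex.I * (x 0 + 1 / 2) * ε : ℂ) =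
        ((2 * Real.pi * (x 0 + 1 / 2) * ε : ℝ) : ℂ) * Complex.I by push_cast; ring,
      Complex.exp_mul_I, ← Complex.ofReal_cos, ← Complex.ofReal_sin, Complex.mk_eq_add_mul_I]
  simp only [twist]
  rw [h1]
  congr 1
  ext i
  fin_cases i <;> simp
  ring

theorem twist_pt (ε : ℝ) (h : SO3) : twist ε (pt h) = pt (bstep ε h) := by
  have e : 2 * Real.pi * (ent h 0 0 / 2 + 1 / 2) * ε = Real.pi * ε * (ent h 0 0 + 1) := by ring
  rw [twist_apply]
  ext i
  fin_cases i <;> simp [pt, bstep, ent_mul]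
  · simp [ent_def, coe_rot0]
  · rw [← one_div, e]; simp [ent_def, coe_rot0]; ring
  · rw [← one_div, e]; simp [ent_def, coe_rot0]; ring

theorem differentiable_twist (ε : ℝ) : Differentiable ℝ (twist ε) := by
  have h0 : twist ε = fun x => _ := funext (twist_apply ε)
  rw [h0, differentiable_euclidean]
  intro i
  fin_cases i <;> simp <;> fun_prop

theorem fderiv_twist_apply (ε : ℝ) (x v : E3) : fderiv ℝ (twist ε) x v = !₂[v 0,
    Real.cos (2 * Real.pi * (x 0 + 1 / 2) * ε) * (v 1 - 2 * Real.pi * ε * v 0 * x 2) -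
      Real.sin (2 * Real.pi * (x 0 + 1 / 2) * ε) * (v 2 + 2 * Real.pi * ε * v 0 * x 1),
    Real.sin (2 * Real.pi * (x 0 + 1 / 2) * ε) * (v 1 - 2 * Real.pi * ε * v 0 * x 2) +
      Real.cos (2 * Real.pi * (x 0 + 1 / 2) * ε) * (v 2 + 2 * Real.pi * ε * v 0 * x 1)] := by
  have hline : ∀ i : Fin 3, HasDerivAt (fun t : ℝ => x i + t * v i) (v i) 0 := fun i => by
    simpa using ((hasDerivAt_id (0 : ℝ)).mul_const (v i)).const_add (x i)
  have hang : HasDerivAt (fun t : ℝ => 2 * Real.pi * (x 0 + t * v 0 + 1 / 2) * ε)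
      (2 * Real.pi * v 0 * ε) 0 := (((hline 0).add_const _).const_mul _).mul_const _
  have h1 := ((differentiable_twist ε) x).hasFDerivAt.hasLineDerivAt v
  rw [HasLineDerivAt] at h1
  ext i
  have h2 := (EuclideanSpace.proj i : E3 →L[ℝ] ℝ).hasFDerivAt.comp_hasDerivAt
    (0 : ℝ) h1
  refine h2.unique ?_
  simp only [Function.comp_def, PiLp.proj_apply, twist_apply]
  fin_cases i
  · simpa using hline 0
  · simp only [Fin.mk_one, Matrix.cons_val_one, Matrix.cons_val_zero]
    refine ((hang.cos.mul (hline 1)).sub (hang.sin.mul (hline 2))).congr_deriv ?_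
    simp; ring
  · simp only [Fin.reduceFinMk, Matrix.cons_val]
    refine ((hang.sin.mul (hline 1)).add (hang.cos.mul (hline 2))).congr_deriv ?_
    simp; ring

/-- Apart from the rotation, the derivative adds a multiple of the cross product of the first axis
with the point. The cofactor identities express that tangent vector in the frame as a multiple of
iℓ. -/
theorem fderiv_twist_emb (ε : ℝ) (h : SO3) (z : ℂ) :
    fderiv ℝ (twist ε) (pt h) (emb h z) = emb (bstep ε h) (shear ε h z) := by
  have e : 2 * Real.pi * (ent h 0 0 / 2 + 1 / 2) * ε = Real.pi * ε * (ent h 0 0 + 1) := by ring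
  have hre : (shear ε h z).re = z.re + (ent h 0 1 * z.re + ent h 0 2 * z.im) *
      (Real.pi * ε) * ent h 0 2 := by
    rw [shear_apply, Complex.inner]; simp [ell]; ring
  have him : (shear ε h z).im = z.im - (ent h 0 1 * z.re + ent h 0 2 * z.im) *
      (Real.pi * ε) * ent h 0 1 := by
    rw [shear_apply, Complex.inner]; simp [ell]; ring
  have k0 : (shear ε h z).re * ent h 0 1 + (shear ε h z).im * ent h 0 2 =
      ent h 0 1 * z.re + ent h 0 2 * z.im := by rw [hre, him]; ring
  have k1 : (shear ε h z).re * ent h 1 1 + (shear ε h z).im * ent h 1 2 =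
      ent h 1 1 * z.re + ent h 1 2 * z.im - 2 * Real.pi * ε *
        (ent h 0 1 * z.re + ent h 0 2 * z.im) * (ent h 2 0 / 2) := by
    have a := SO3_adj20 h
    rw [hre, him]
    linear_combination (-Real.pi * ε * (ent h 0 1 * z.re + ent h 0 2 * z.im)) * a
  have k2 : (shear ε h z).re * ent h 2 1 + (shear ε h z).im * ent h 2 2 =
      ent h 2 1 * z.re + ent h 2 2 * z.im + 2 * Real.pi * ε *
        (ent h 0 1 * z.re + ent h 0 2 * z.im) * (ent h 1 0 / 2) := by
    have a := SO3_adj10 h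
    rw [hre, him]
    linear_combination (Real.pi * ε * (ent h 0 1 * z.re + ent h 0 2 * z.im)) * a
  rw [fderiv_twist_apply, show (pt h) 0 = ent h 0 0 / 2 by simp [pt],
    show (pt h) 1 = ent h 1 0 / 2 by simp [pt], show (pt h) 2 = ent h 2 0 / 2 by simp [pt], e]
  ext i
  fin_cases i <;> simp [emb, bstep, ent_mul]
  · simp [ent_def, coe_rot0] at k0 ⊢; linear_combination -k0
  · rw [show ent (rot0 (Real.pi * ε * (ent h 0 0 + 1))) 1 0 = 0 by simp [ent_def, coe_rot0],
      show ent (rot0 (Real.pi * ε * (ent h 0 0 + 1))) 1 1 =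
        Real.cos (Real.pi * ε * (ent h 0 0 + 1)) by simp [ent_def, coe_rot0],
      show ent (rot0 (Real.pi * ε * (ent h 0 0 + 1))) 1 2 =
        -Real.sin (Real.pi * ε * (ent h 0 0 + 1)) by simp [ent_def, coe_rot0]]
    linear_combination (-Real.cos (Real.pi * ε * (ent h 0 0 + 1))) * k1 +
      (Real.sin (Real.pi * ε * (ent h 0 0 + 1))) * k2
  · rw [show ent (rot0 (Real.pi * ε * (ent h 0 0 + 1))) 2 0 = 0 by simp [ent_def, coe_rot0],
      show ent (rot0 (Real.pi * ε * (ent h 0 0 + 1))) 2 1 =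
        Real.sin (Real.pi * ε * (ent h 0 0 + 1)) by simp [ent_def, coe_rot0],
      show ent (rot0 (Real.pi * ε * (ent h 0 0 + 1))) 2 2 =
        Real.cos (Real.pi * ε * (ent h 0 0 + 1)) by simp [ent_def, coe_rot0]]
    linear_combination (-Real.sin (Real.pi * ε * (ent h 0 0 + 1))) * k1 -
      (Real.cos (Real.pi * ε * (ent h 0 0 + 1))) * k2

/-! ### The tangent maps of random compositions -/

theorem skew_iterate_fst (ε : ℝ) (n : ℕ) (y : Orbit) :
    ((skew ε)^[n] y).1 = fun k => y.1 (n + k) := by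
  induction n with
  | zero => simp
  | succ n ih =>
    rw [Function.iterate_succ_apply']
    funext k
    simp only [skew, ih]
    rw [Nat.add_right_comm, Nat.add_assoc]

theorem skew_iterate_succ_snd (ε : ℝ) (n : ℕ) (y : Orbit) :
    ((skew ε)^[n + 1] y).2 = y.1 n * bstep ε ((skew ε)^[n] y).2 := by
  rw [Function.iterate_succ_apply', skew, skew_iterate_fst]; rfl

theorem randomComposition_pt (ε : ℝ) (ω : ℕ → SO3) (h : SO3) (n : ℕ) :
    randomComposition (twist ε) ω n (pt h) = pt ((skew ε)^[n] (ω, h)).2 := by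
  induction n with
  | zero => rfl
  | succ n ih =>
    change rotate (ω n) (twist ε (randomComposition (twist ε) ω n (pt h))) = _
    rw [ih, twist_pt, rotate_pt, skew_iterate_succ_snd]

theorem differentiable_randomComposition (ε : ℝ) (ω : ℕ → SO3) (n : ℕ) :
    Differentiable ℝ (randomComposition (twist ε) ω n) := by
  induction n with
  | zero => exact differentiable_id
  | succ n ih => exact (rotate (ω n)).differentiable.comp ((differentiable_twist ε).comp ih)

theorem fderiv_randomComposition_emb (ε : ℝ) (ω : ℕ → SO3) (h : SO3) (n : ℕ) (z : ℂ) :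
    fderiv ℝ (randomComposition (twist ε) ω n) (pt h) (emb h z) =
      emb ((skew ε)^[n] (ω, h)).2 (cocyc ε n (ω, h) z) := by
  induction n with
  | zero =>
    change fderiv ℝ id _ _ = _
    simp [cocyc]
  | succ n ih =>
    have d1 := differentiable_randomComposition ε ω n (pt h)
    have d2 := differentiable_twist ε (randomComposition (twist ε) ω n (pt h))
    have e : fderiv ℝ (randomComposition (twist ε) ω (n + 1)) (pt h) =
        (rotate (ω n)).comp ((fderiv ℝ (twist ε) (randomComposition (twist ε) ω n (pt h))).comp
          (fderiv ℝ (randomComposition (twist ε) ω n) (pt h))) :=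
      ((rotate (ω n)).hasFDerivAt.comp _ (d2.hasFDerivAt.comp _ d1.hasFDerivAt)).fderiv
    rw [e]
    simp only [ContinuousLinearMap.comp_apply]
    rw [ih, randomComposition_pt, fderiv_twist_emb, rotate_emb, skew_iterate_succ_snd,
      cocyc_add ε 1 n]
    rfl

/-- `emb h` is a linear isometry from ℂ onto the tangent plane, and likewise at the image point. -/
theorem norm_tangentMap_randomComposition (ε : ℝ) (ω : ℕ → SO3) (h : SO3) (n : ℕ) :
    ‖tangentMap (randomComposition (twist ε) ω n) (pt h)‖ = ‖cocyc ε n (ω, h)‖ := by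
  have key : ∀ z, ‖tangentMap (randomComposition (twist ε) ω n) (pt h) ⟨emb h z, emb_mem h z⟩‖ =
      ‖cocyc ε n (ω, h) z‖ := fun z => by
    rw [← norm_emb ((skew ε)^[n] (ω, h)).2, ← fderiv_randomComposition_emb]; rfl
  refine le_antisymm ?_ ?_
  · refine ContinuousLinearMap.opNorm_le_bound _ (ContinuousLinearMap.opNorm_nonneg _) fun v => ?_
    obtain ⟨v, hv⟩ := v
    obtain ⟨z, rfl⟩ := exists_emb_eq h hv
    rw [key, Submodule.coe_norm, norm_emb]
    exact ContinuousLinearMap.le_opNorm _ _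
  · refine ContinuousLinearMap.opNorm_le_bound _ (ContinuousLinearMap.opNorm_nonneg _) fun z => ?_
    rw [← key, ← norm_emb h z]
    exact ContinuousLinearMap.le_opNorm _ (⟨emb h z, emb_mem h z⟩ : (ℝ ∙ pt h)ᗮ)

/-- The exponents in moving frames. -/
def frameExponent (ε : ℝ) (y : Orbit) : ℝ :=
  limsup (fun n : ℕ => (1 / n : ℝ) * Real.log ‖cocyc ε n y‖) atTop

theorem pointExponent_pt (ε : ℝ) (ω : ℕ → SO3) (h : SO3) :
    pointExponent (twist ε) ω (pt h) = frameExponent ε (ω, h) := by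
  simp only [pointExponent, frameExponent, norm_tangentMap_randomComposition]

theorem measurable_frameExponent (ε : ℝ) : Measurable (frameExponent ε) :=
  Measurable.limsup fun n => (Real.measurable_log.comp (measurable_cocyc ε n).norm).const_mul _

/-! ### The area measure of the sphere as an orbit measure -/

theorem norm_rotate (g : SO3) (v : E3) : ‖rotate g v‖ = ‖v‖ := by
  have c00 := SO3_cols g 0 0
  have c01 := SO3_cols g 0 1
  have c02 := SO3_cols g 0 2
  have c11 := SO3_cols g 1 1
  have c12 := SO3_cols g 1 2
  have c22 := SO3_cols g 2 2
  simp at c00 c01 c02 c11 c12 c22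
  rw [EuclideanSpace.norm_eq, EuclideanSpace.norm_eq]
  congr 1
  simp only [Fin.sum_univ_three, rotate_apply, Real.norm_eq_abs, sq_abs]
  linear_combination v 0 ^ 2 * c00 + v 1 ^ 2 * c11 + v 2 ^ 2 * c22 + 2 * v 0 * v 1 * c01 +
    2 * v 0 * v 2 * c02 + 2 * v 1 * v 2 * c12

/-- A rotation as a linear isometry of Euclidean space. -/
def rotateEquiv (g : SO3) : E3 ≃ₗᵢ[ℝ] E3 :=
  LinearIsometry.toLinearIsometryEquiv ⟨(rotate g : E3 →ₗ[ℝ] E3), norm_rotate g⟩ rfl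

/-- The action of a rotation on the unit sphere. -/
def rotateSphere (g : SO3) (x : Metric.sphere (0 : E3) 1) : Metric.sphere (0 : E3) 1 :=
  ⟨rotate g x, by rw [mem_sphere_zero_iff_norm, norm_rotate]; exact mem_sphere_zero_iff_norm.1 x.2⟩

theorem measurable_rotateSphere (g : SO3) : Measurable (rotateSphere g) :=
  (((rotate g).continuous.comp continuous_subtype_val).subtype_mk _).measurable

-- Surface measure is defined through volumes of cones. The cone over a preimage is the preimage of
-- the cone, and linear isometries preserve volume.
open scoped Pointwise in
theorem map_rotateSphere (g : SO3) : (volume : Measure E3).toSphere.map (rotateSphere g) =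
    (volume : Measure E3).toSphere := by
  ext s hs
  rw [Measure.map_apply (measurable_rotateSphere g) hs, Measure.toSphere_apply' _ hs,
    Measure.toSphere_apply' _ (measurable_rotateSphere g hs)]
  congr 1
  have e : Set.Ioo (0 : ℝ) 1 • (Subtype.val '' (rotateSphere g ⁻¹' s)) =
      (rotateEquiv g).toMeasurableEquiv ⁻¹' (Set.Ioo (0 : ℝ) 1 • (Subtype.val '' s)) := by
    ext v
    constructor
    · rintro ⟨r, hr, _, ⟨x, hx, rfl⟩, rfl⟩
      exact ⟨r, hr, _, ⟨rotateSphere g x, hx, rfl⟩, ((rotate g).map_smul r (x : E3)).symm⟩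
    · rintro ⟨r, hr, _, ⟨x, hx, rfl⟩, hv⟩
      have hv' : r • (x : E3) = rotateEquiv g v := hv
      refine ⟨r, hr, (rotateEquiv g).symm x, ⟨⟨(rotateEquiv g).symm x, ?_⟩, ?_, rfl⟩, ?_⟩
      · rw [mem_sphere_zero_iff_norm, LinearIsometryEquiv.norm_map]
        exact mem_sphere_zero_iff_norm.1 x.2
      · have : rotateSphere g ⟨(rotateEquiv g).symm x, by
            rw [mem_sphere_zero_iff_norm, LinearIsometryEquiv.norm_map]
            exact mem_sphere_zero_iff_norm.1 x.2⟩ = x :=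
          Subtype.ext ((rotateEquiv g).apply_symm_apply x)
        rw [Set.mem_preimage, this]; exact hx
      · change r • (rotateEquiv g).symm x = v
        rw [← map_smul, hv', LinearIsometryEquiv.symm_apply_apply]
  rw [e]
  exact (rotateEquiv g).measurePreserving.measure_preimage_equiv
    (f := (rotateEquiv g).toMeasurableEquiv) _

theorem measurable_half_smul :
    Measurable fun x : Metric.sphere (0 : E3) 1 => (1 / 2 : ℝ) • (x : E3) := by fun_prop

theorem areaMeasure_univ : areaMeasure Set.univ = (volume : Measure E3).toSphere Set.univ := by
  rw [areaMeasure, Measure.map_apply measurable_half_smul MeasurableSet.univ, Set.preimage_univ]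

instance : IsProbabilityMeasure sphereMeasure :=
  ⟨by
    rw [sphereMeasure, Measure.smul_apply, smul_eq_mul, areaMeasure_univ]
    refine ENNReal.inv_mul_cancel ?_ (measure_ne_top _ _)
    rw [Ne, Measure.measure_univ_eq_zero]
    exact Measure.toSphere_ne_zero _⟩

theorem map_rotate_sphereMeasure (g : SO3) : sphereMeasure.map (rotate g) = sphereMeasure := by
  have h1 : areaMeasure.map (rotate g) = areaMeasure := by
    rw [areaMeasure, Measure.map_map (rotate g).continuous.measurable measurable_half_smul]
    conv_rhs => rw [← map_rotateSphere g,
      Measure.map_map measurable_half_smul (measurable_rotateSphere g)]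
    congr 1
    funext x
    exact (rotate g).map_smul _ _
  rw [sphereMeasure, Measure.map_smul, h1]

theorem ae_norm_eq_half : ∀ᵐ x ∂sphereMeasure, ‖x‖ = 1 / 2 := by
  refine Measure.ae_smul_measure ?_ _
  rw [areaMeasure, ae_map_iff measurable_half_smul.aemeasurable
    (measurableSet_eq_fun measurable_norm measurable_const)]
  refine Eventually.of_forall fun x => ?_
  rw [norm_smul, mem_sphere_zero_iff_norm.1 x.2]; norm_num

/-- A measurable section of the map from frames to the sphere. -/
def frameAt (x : E3) : SO3 := rot0 (Complex.arg ⟨x 1, x 2⟩) * rot2 (Real.arccos (2 * x 0))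

theorem measurable_frameAt : Measurable frameAt := by
  have h1 : Measurable fun x : E3 => (⟨x 1, x 2⟩ : ℂ) := by
    have : (fun x : E3 => (⟨x 1, x 2⟩ : ℂ)) = fun x => (x 1 : ℂ) + x 2 * Complex.I := by
      funext x; exact Complex.mk_eq_add_mul_I _ _
    rw [this]; fun_prop
  unfold frameAt; fun_prop

theorem pt_frameAt {x : E3} (hx : ‖x‖ = 1 / 2) : pt (frameAt x) = x := by
  have h1 : x 0 ^ 2 + x 1 ^ 2 + x 2 ^ 2 = 1 / 4 := by
    have := EuclideanSpace.real_norm_sq_eq x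
    rw [hx, Fin.sum_univ_three] at this
    linarith
  have h2 : ‖(⟨x 1, x 2⟩ : ℂ)‖ * 2 = √(1 - (2 * x 0) ^ 2) := by
    rw [Complex.norm_def, Complex.normSq_mk, eq_comm, Real.sqrt_eq_iff_mul_self_eq
      (by nlinarith [sq_nonneg (x 1), sq_nonneg (x 2)]) (by positivity), mul_mul_mul_comm,
      Real.mul_self_sqrt (by nlinarith [sq_nonneg (x 1), sq_nonneg (x 2)])]
    linarith
  have h3 := Complex.norm_mul_cos_arg (⟨x 1, x 2⟩ : ℂ)
  have h4 := Complex.norm_mul_sin_arg (⟨x 1, x 2⟩ : ℂ)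
  have h5 : Real.cos (Real.arccos (2 * x 0)) = 2 * x 0 := Real.cos_arccos
    (by nlinarith [sq_nonneg (x 1), sq_nonneg (x 2)])
    (by nlinarith [sq_nonneg (x 1), sq_nonneg (x 2)])
  have h6 : Real.sin (Real.arccos (2 * x 0)) = ‖(⟨x 1, x 2⟩ : ℂ)‖ * 2 := by
    rw [Real.sin_arccos, h2]
  simp only at h3 h4
  ext i
  fin_cases i <;> simp [pt, frameAt, ent_mul] <;> simp [ent_def, coe_rot0, coe_rot2, h5, h6]
  · linear_combination h3
  · linear_combination h4

/-- Average the rotation invariance of the sphere measure over the group and exchange the integrals.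
Each point is `pt` of some frame, which right invariance of Haar measure absorbs. -/
theorem lintegral_sphereMeasure {f : E3 → ENNReal} (hf : Measurable f) :
    ∫⁻ x, f x ∂sphereMeasure = ∫⁻ h, f (pt h) ∂haar := by
  have hrot : Measurable fun p : SO3 × E3 => rotate p.1 p.2 := by
    have : (fun p : SO3 × E3 => rotate p.1 p.2) = fun p => WithLp.toLp 2 fun i =>
        ent p.1 i 0 * p.2 0 + ent p.1 i 1 * p.2 1 + ent p.1 i 2 * p.2 2 := by
      funext p; ext i; rw [rotate_apply]
    rw [this]
    refine (WithLp.measurable_toLp 2 _).comp (measurable_pi_lambda _ fun i => ?_)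
    fun_prop
  calc ∫⁻ x, f x ∂sphereMeasure = ∫⁻ _ : SO3, ∫⁻ x, f x ∂sphereMeasure ∂haar := by simp
    _ = ∫⁻ g, ∫⁻ x, f (rotate g x) ∂sphereMeasure ∂haar := lintegral_congr fun g => by
        conv_lhs => rw [← map_rotate_sphereMeasure g,
          lintegral_map hf (rotate g).continuous.measurable]
    _ = ∫⁻ x, ∫⁻ g, f (rotate g x) ∂haar ∂sphereMeasure :=
        lintegral_lintegral_swap (hf.comp hrot).aemeasurable
    _ = ∫⁻ _, ∫⁻ g, f (pt g) ∂haar ∂sphereMeasure := by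
        refine lintegral_congr_ae (ae_norm_eq_half.mono fun x hx => ?_)
        change ∫⁻ g, f (rotate g x) ∂haar = ∫⁻ g, f (pt g) ∂haar
        rw [← lintegral_mul_right_eq_self (fun g => f (pt g)) (frameAt x)]
        refine lintegral_congr fun g => ?_
        rw [← rotate_pt, pt_frameAt hx]
    _ = _ := by simp

theorem map_pt_haar : haar.map pt = sphereMeasure := by
  ext s hs
  rw [Measure.map_apply continuous_pt.measurable hs, ← lintegral_indicator_one hs,
    lintegral_sphereMeasure (measurable_one.indicator hs),
    ← lintegral_indicator_one (continuous_pt.measurable hs)]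
  rfl

/-- The frame exponent depends only on the base point. Passing through the section `frameAt`
supplies a measurable integrand on Euclidean space for the change of variables. -/
theorem integral_pointExponent (ε : ℝ) (ω : ℕ → SO3) :
    ∫ x, pointExponent (twist ε) ω x ∂sphereMeasure = ∫ h, frameExponent ε (ω, h) ∂haar := by
  have h1 : ∫ x, pointExponent (twist ε) ω x ∂sphereMeasure =
      ∫ x, frameExponent ε (ω, frameAt x) ∂sphereMeasure := by
    refine integral_congr_ae (ae_norm_eq_half.mono fun x hx => ?_)
    change _ = frameExponent ε (ω, frameAt x)
    rw [← pointExponent_pt, pt_frameAt hx]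
  have hm : Measurable fun x => frameExponent ε (ω, frameAt x) :=
    (measurable_frameExponent ε).comp (measurable_const.prodMk measurable_frameAt)
  rw [h1, ← map_pt_haar, integral_map continuous_pt.measurable.aemeasurable
    hm.aestronglyMeasurable]
  refine integral_congr_ae (Eventually.of_forall fun h => ?_)
  change frameExponent ε (ω, frameAt (pt h)) = frameExponent ε (ω, h)
  rw [← pointExponent_pt, pt_frameAt (norm_pt h), pointExponent_pt]

/-! ### Ergodic averages of subadditive sequences -/

section Ergodic

variable {X : Type*} {T : X → X} {a : ℕ → X → ℝ} {L : ℝ}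

/-- The running maximum of the Birkhoff sums, as a recursion. -/
def runMax (T : X → X) (f : X → ℝ) : ℕ → X → ℝ
  | 0, _ => 0
  | n + 1, x => max 0 (f x + runMax T f n (T x))

theorem runMax_nonneg (f : X → ℝ) (n : ℕ) (x : X) : 0 ≤ runMax T f n x := by
  cases n with
  | zero => exact le_rfl
  | succ n => exact le_max_left _ _

theorem runMax_le_succ (f : X → ℝ) (n : ℕ) (x : X) : runMax T f n x ≤ runMax T f (n + 1) x := by
  induction n generalizing x with
  | zero => exact runMax_nonneg _ _ _
  | succ n ih => exact max_le_max le_rfl (add_le_add le_rfl (ih _))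

theorem birkhoffSum_le_runMax (f : X → ℝ) (n : ℕ) (x : X) :
    birkhoffSum T f n x ≤ runMax T f n x := by
  induction n generalizing x with
  | zero => simp [runMax]
  | succ n ih =>
    rw [birkhoffSum_succ']
    exact le_max_of_le_right (add_le_add le_rfl (ih _))

theorem runMax_le {f : X → ℝ} {M : ℝ} (hM : ∀ x, |f x| ≤ M) (n : ℕ) (x : X) :
    runMax T f n x ≤ n * M := by
  have hM0 : 0 ≤ M := (abs_nonneg _).trans (hM x)
  induction n generalizing x with
  | zero => simp [runMax]
  | succ n ih =>
    refine max_le (by positivity) ?_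
    push_cast
    linarith [ih (T x), (abs_le.1 (hM x)).2]

/-- The upper growth rate of a sequence of functions. -/
def growth (a : ℕ → X → ℝ) (x : X) : ℝ := limsup (fun n : ℕ => (1 / n : ℝ) * a n x) atTop

theorem abs_rate_le (hL : 0 ≤ L) (ha : ∀ n x, |a n x| ≤ n * L) (n : ℕ) (x : X) :
    |(1 / n : ℝ) * a n x| ≤ L := by
  rcases n.eq_zero_or_pos with rfl | hn
  · simpa using hL
  · have hn' : (0 : ℝ) < n := by exact_mod_cast hn
    rw [abs_mul, abs_of_pos (by positivity), one_div, inv_mul_le_iff₀ hn']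
    exact ha n x

theorem growth_bdd (hL : 0 ≤ L) (ha : ∀ n x, |a n x| ≤ n * L) (x : X) :
    IsBoundedUnder (· ≤ ·) atTop (fun n : ℕ => (1 / n : ℝ) * a n x) :=
  ⟨L, eventually_map.2 (Eventually.of_forall fun n => (abs_le.1 (abs_rate_le hL ha n x)).2)⟩

theorem growth_cobdd (hL : 0 ≤ L) (ha : ∀ n x, |a n x| ≤ n * L) (x : X) :
    IsCoboundedUnder (· ≤ ·) atTop (fun n : ℕ => (1 / n : ℝ) * a n x) :=
  IsBoundedUnder.isCoboundedUnder_le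
    ⟨-L, eventually_map.2 (Eventually.of_forall fun n => (abs_le.1 (abs_rate_le hL ha n x)).1)⟩

theorem abs_growth_le (hL : 0 ≤ L) (ha : ∀ n x, |a n x| ≤ n * L) (x : X) : |growth a x| ≤ L := by
  rw [abs_le]
  constructor
  · exact le_limsup_of_frequently_le (Eventually.frequently (Eventually.of_forall fun n =>
      (abs_le.1 (abs_rate_le hL ha n x)).1)) (growth_bdd hL ha x)
  · exact limsup_le_of_le (growth_cobdd hL ha x) (Eventually.of_forall fun n =>
      (abs_le.1 (abs_rate_le hL ha n x)).2)

/-- Subadditivity after one step costs only `a 1 x`, negligible after division by n. Only this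
inequality is pointwise; equality holds almost everywhere. -/
theorem growth_le_comp (hL : 0 ≤ L) (ha : ∀ n x, |a n x| ≤ n * L)
    (hsub : ∀ n m x, a (n + m) x ≤ a n x + a m (T^[n] x)) (x : X) :
    growth a x ≤ growth a (T x) := by
  refine le_of_forall_pos_le_add fun e he => ?_
  refine limsup_le_of_le (growth_cobdd hL ha x) ?_
  have h1 : ∀ᶠ n : ℕ in atTop, (1 / n : ℝ) * a n (T x) < growth a (T x) + e / 2 :=
    eventually_lt_of_limsup_lt (by change growth a (T x) < _; linarith) (growth_bdd hL ha (T x))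
  obtain ⟨N, hN⟩ := exists_nat_gt (4 * L / e)
  have h2 : ∀ᶠ n : ℕ in atTop, (1 / (n + 1 : ℕ) : ℝ) * a (n + 1) x ≤ growth a (T x) + e := by
    filter_upwards [h1, eventually_ge_atTop (N + 1)] with n hn hnN
    have hn0 : (0 : ℝ) < n := by exact_mod_cast (by lia : 0 < n)
    have hnN' : (N : ℝ) ≤ n := by exact_mod_cast (by lia : N ≤ n)
    have h3 := hsub 1 n x
    rw [add_comm 1 n, Function.iterate_one] at h3
    have h4 := (abs_le.1 (ha 1 x)).2
    have h6 : a n (T x) = n * ((1 / n : ℝ) * a n (T x)) := by field_simp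
    have h7 := (abs_le.1 (abs_growth_le hL ha (T x))).1
    have h8 : 4 * L < e * n := by
      rw [div_lt_iff₀ he] at hN; nlinarith
    push_cast at h4 ⊢
    rw [one_div, inv_mul_le_iff₀ (by positivity)]
    nlinarith [mul_lt_mul_of_pos_left hn hn0]
  rw [← map_add_atTop_eq_nat 1]
  exact h2

theorem growth_le_comp_iterate (hL : 0 ≤ L) (ha : ∀ n x, |a n x| ≤ n * L)
    (hsub : ∀ n m x, a (n + m) x ≤ a n x + a m (T^[n] x)) (j : ℕ) (x : X) :
    growth a x ≤ growth a (T^[j] x) := by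
  induction j with
  | zero => exact le_rfl
  | succ j ih =>
    rw [Function.iterate_succ_apply']
    exact ih.trans (growth_le_comp hL ha hsub _)

theorem le_birkhoffSum (ha : ∀ n x, |a n x| ≤ n * L)
    (hsub : ∀ n m x, a (n + m) x ≤ a n x + a m (T^[n] x)) (m k : ℕ) (x : X) :
    a (m * k) x ≤ birkhoffSum (T^[m]) (a m) k x := by
  induction k with
  | zero => simpa using (abs_le.1 (ha 0 x)).2
  | succ k ih =>
    rw [birkhoffSum_succ, ← Function.iterate_mul, mul_add, mul_one]
    exact (hsub _ _ _).trans (add_le_add ih le_rfl)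

variable [MeasurableSpace X] {μ : Measure X} [IsProbabilityMeasure μ]

theorem measurable_runMax (hT : Measurable T) {f : X → ℝ} (hf : Measurable f) (n : ℕ) :
    Measurable (runMax T f n) := by
  induction n with
  | zero => exact measurable_const
  | succ n ih => exact measurable_const.max (hf.add (ih.comp hT))

theorem integrable_of_abs_le {f : X → ℝ} (hf : Measurable f) {M : ℝ} (hM : ∀ x, |f x| ≤ M) :
    Integrable f μ :=
  Integrable.of_bound hf.aestronglyMeasurable M (Eventually.of_forall hM)

/-- A function whose Birkhoff sums become positive almost everywhere has nonnegative integral. -/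
theorem integral_nonneg_of_birkhoffSum_pos (hT : MeasurePreserving T μ μ) {f : X → ℝ}
    (hf : Measurable f) {M : ℝ} (hM : ∀ x, |f x| ≤ M)
    (h : ∀ᵐ x ∂μ, ∃ n, 0 < birkhoffSum T f n x) : 0 ≤ ∫ x, f x ∂μ := by
  have hm := fun n => measurable_runMax hT.measurable hf n
  have hset : ∀ n, MeasurableSet {x | 0 < runMax T f n x} := fun n =>
    measurableSet_lt measurable_const (hm n)
  -- Maximal ergodic inequality: where the running maximum M is positive, f ≥ M - M∘T, and elsewhere
  -- M - M∘T ≤ 0. The integral of M - M∘T vanishes.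
  have step : ∀ n, 0 ≤ ∫ x, Set.indicator {x | 0 < runMax T f n x} f x ∂μ := by
    intro n
    have hi : Integrable (runMax T f n) μ := integrable_of_abs_le (hm n) (M := n * M) fun x => by
      rw [abs_of_nonneg (runMax_nonneg _ _ _)]; exact runMax_le hM n x
    have hi' : Integrable (fun x => runMax T f n (T x)) μ := hT.integrable_comp_of_integrable hi
    have e : ∫ x, runMax T f n (T x) ∂μ = ∫ x, runMax T f n x ∂μ := by
      rw [← integral_map (f := runMax T f n) hT.aemeasurable (hm n).aestronglyMeasurable, hT.map_eq]
    calc (0 : ℝ) = ∫ x, (runMax T f n x - runMax T f n (T x)) ∂μ := by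
          rw [integral_sub hi hi', e, sub_self]
      _ ≤ _ := by
          refine integral_mono (hi.sub hi')
            ((integrable_of_abs_le hf hM).indicator (hset n)) fun x => ?_
          by_cases hx : 0 < runMax T f n x
          · rw [Set.indicator_of_mem (show x ∈ {x | 0 < runMax T f n x} from hx)]
            have h1 := hx.trans_le (runMax_le_succ f n x)
            have h2 : runMax T f (n + 1) x = f x + runMax T f n (T x) := by
              rw [runMax] at h1 ⊢
              exact max_eq_right ((lt_max_iff.1 h1).resolve_left (lt_irrefl _)).le
            linarith [runMax_le_succ (T := T) f n x]
          · rw [Set.indicator_of_notMem (show x ∉ {x | 0 < runMax T f n x} from hx)]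
            linarith [runMax_nonneg (T := T) f n (T x)]
  -- The positivity sets increase to a set of full measure.
  refine ge_of_tendsto' (tendsto_integral_of_dominated_convergence (fun _ => M)
    (fun n => (hf.indicator (hset n)).aestronglyMeasurable) (integrable_const M)
    (fun n => Eventually.of_forall fun x => ?_) ?_) step
  · exact (norm_indicator_le_norm_self f x).trans (hM x)
  · filter_upwards [h] with x hx
    obtain ⟨n, hn⟩ := hx
    refine tendsto_atTop_of_eventually_const (i₀ := n) fun k hk => ?_
    have h1 : 0 < runMax T f k x := (hn.trans_le (birkhoffSum_le_runMax f n x)).trans_le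
      (monotone_nat_of_le_succ (fun n => runMax_le_succ (T := T) f n x) hk)
    exact Set.indicator_of_mem (show x ∈ {x | 0 < runMax T f k x} from h1) f

/-! ### Bounds for the mean growth rate, in the spirit of Kingman's theorem. -/

theorem measurable_growth (ham : ∀ n, Measurable (a n)) : Measurable (growth a) :=
  Measurable.limsup fun n => (ham n).const_mul _

/-- The growth rate increases along orbits while its integral stays the same, so the increments
vanish almost everywhere. -/
theorem growth_comp_iterate_ae (hT : MeasurePreserving T μ μ) (ham : ∀ n, Measurable (a n))
    (hL : 0 ≤ L) (ha : ∀ n x, |a n x| ≤ n * L)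
    (hsub : ∀ n m x, a (n + m) x ≤ a n x + a m (T^[n] x)) :
    ∀ᵐ x ∂μ, ∀ j, growth a (T^[j] x) = growth a x := by
  rw [ae_all_iff]
  intro j
  have hTj := hT.iterate j
  have hm := measurable_growth ham
  have hi : Integrable (growth a) μ := integrable_of_abs_le hm (abs_growth_le hL ha)
  have hi' : Integrable (fun x => growth a (T^[j] x)) μ := hTj.integrable_comp_of_integrable hi
  have e : ∫ x, growth a (T^[j] x) ∂μ = ∫ x, growth a x ∂μ := by
    rw [← integral_map (f := growth a) hTj.aemeasurable hm.aestronglyMeasurable, hTj.map_eq]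
  have h0 : ∫ x, (growth a (T^[j] x) - growth a x) ∂μ = 0 := by
    rw [integral_sub hi' hi, e, sub_self]
  rw [integral_eq_zero_iff_of_nonneg (fun x => sub_nonneg.2
    (growth_le_comp_iterate hL ha hsub j x)) (hi'.sub hi)] at h0
  filter_upwards [h0] with x hx
  exact sub_eq_zero.1 hx

/-- The maximal inequality is applied to `a m` minus m times the growth rate, plus e, under `T^[m]`.
The upper limit supplies times n with `a n x` nearly n times the rate, and cutting n into blocks of
length m makes a Birkhoff sum positive. -/
theorem integral_growth_le (hT : MeasurePreserving T μ μ) (ham : ∀ n, Measurable (a n))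
    (hL : 0 ≤ L) (ha : ∀ n x, |a n x| ≤ n * L)
    (hsub : ∀ n m x, a (n + m) x ≤ a n x + a m (T^[n] x)) {m : ℕ} (hm : 0 < m) :
    m * ∫ x, growth a x ∂μ ≤ ∫ x, a m x ∂μ := by
  refine le_of_forall_pos_le_add fun e he => ?_
  have hm' : (0 : ℝ) < m := by exact_mod_cast hm
  have hgm := measurable_growth ham
  have hgi : Integrable (growth a) μ := integrable_of_abs_le hgm (abs_growth_le hL ha)
  have hai : Integrable (a m) μ := integrable_of_abs_le (ham m) (ha m)
  have key : 0 ≤ ∫ x, (a m x - m * growth a x + e) ∂μ := by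
    refine integral_nonneg_of_birkhoffSum_pos (hT.iterate m) (M := m * L + m * L + e)
      (((ham m).sub (hgm.const_mul _)).add_const _) (fun x => ?_) ?_
    · have h1 := abs_le.1 (ha m x)
      have h2 := abs_le.1 (abs_growth_le hL ha x)
      rw [abs_le]
      constructor <;> nlinarith
    · filter_upwards [growth_comp_iterate_ae hT ham hL ha hsub] with x hx
      have hsum : ∀ k, birkhoffSum (T^[m]) (fun x => a m x - m * growth a x + e) k x =
          birkhoffSum (T^[m]) (a m) k x - k * (m * growth a x) + k * e := by
        intro k
        simp only [birkhoffSum, ← Function.iterate_mul, hx, Finset.sum_add_distrib,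
          Finset.sum_sub_distrib, Finset.sum_const, Finset.card_range, nsmul_eq_mul]
      have hfreq : ∃ᶠ n : ℕ in atTop, growth a x - e / (2 * m) < (1 / n : ℝ) * a n x :=
        frequently_lt_of_lt_limsup (growth_cobdd hL ha x)
          (by change _ < growth a x; linarith [show 0 < e / (2 * m) by positivity])
      -- The gain is k·e/2 over k blocks; the incomplete block and its share of the rate cost at
      -- most 2mL + e/2.
      obtain ⟨N, hN⟩ := exists_nat_gt ((4 * m * L + e) / e)
      obtain ⟨n, hn, hnN⟩ := (hfreq.and_eventually (eventually_ge_atTop (m * (N + 1)))).exists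
      refine ⟨n / m, ?_⟩
      rw [hsum]
      have hsplit := Nat.div_add_mod n m
      have hk : N + 1 ≤ n / m := (Nat.le_div_iff_mul_le hm).2 (by rwa [mul_comm])
      have hr := Nat.mod_lt n hm
      set k := n / m
      set r := n % m
      have hkr : (N : ℝ) + 1 ≤ k := by exact_mod_cast hk
      have hrr : (r : ℝ) ≤ m := by exact_mod_cast hr.le
      have hn0 : (0 : ℝ) < n := by
        exact_mod_cast lt_of_lt_of_le (by positivity : 0 < m * (N + 1)) hnN
      have hnk : (n : ℝ) = m * k + r := by exact_mod_cast hsplit.symm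
      have h1 : a n x ≤ birkhoffSum (T^[m]) (a m) k x + m * L := by
        calc a n x = a (m * k + r) x := by rw [hsplit]
          _ ≤ _ := hsub _ _ _
          _ ≤ _ := add_le_add (le_birkhoffSum ha hsub m k x)
            (((abs_le.1 (ha r _)).2).trans (by gcongr))
      have h2 : (n : ℝ) * (growth a x - e / (2 * m)) < a n x := by
        rw [one_div, inv_mul_eq_div, lt_div_iff₀ hn0] at hn
        linarith
      have h3 := abs_le.1 (abs_growth_le hL ha x)
      have h4 : 4 * m * L + e < N * e := by rwa [div_lt_iff₀ he] at hN
      have h5 : (n : ℝ) * (growth a x - e / (2 * m)) =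
          m * k * growth a x - k * e / 2 + r * growth a x - r * (e / (2 * m)) := by
        rw [hnk]; field_simp; ring
      have h6 : (r : ℝ) * (e / (2 * m)) ≤ e / 2 := by
        calc (r : ℝ) * (e / (2 * m)) ≤ m * (e / (2 * m)) := by gcongr
          _ = _ := by field_simp
      nlinarith
  have e1 : ∫ x, (a m x - m * growth a x + e) ∂μ = ∫ x, a m x ∂μ - m * ∫ x, growth a x ∂μ + e := by
    have hi : Integrable (fun x => a m x - m * growth a x) μ := hai.sub (hgi.const_mul _)
    rw [integral_add hi (integrable_const _), integral_sub hai (hgi.const_mul _),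
      integral_const_mul]
    simp
  linarith

/-- Reverse Fatou, applied after adding L to make the averages nonnegative. No dynamics enters this
half. -/
theorem le_integral_growth (ham : ∀ n, Measurable (a n)) (hL : 0 ≤ L)
    (ha : ∀ n x, |a n x| ≤ n * L) {c C : ℝ} (h : ∀ n : ℕ, n * c - C ≤ ∫ x, a n x ∂μ) :
    c ≤ ∫ x, growth a x ∂μ := by
  refine le_of_forall_pos_le_add fun e he => ?_
  have hgm := measurable_growth ham
  have hgi : Integrable (growth a) μ := integrable_of_abs_le hgm (abs_growth_le hL ha)
  have hum : ∀ n : ℕ, Measurable fun x => ENNReal.ofReal (L + (1 / n : ℝ) * a n x) := fun n => by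
    have := ham n; fun_prop
  have h1 := limsup_lintegral_le (μ := μ) (f := fun (n : ℕ) x =>
    ENNReal.ofReal (L + (1 / n : ℝ) * a n x)) (fun _ => ENNReal.ofReal (2 * L)) hum
    (fun n => Eventually.of_forall fun x => ENNReal.ofReal_le_ofReal
      (by linarith [(abs_le.1 (abs_rate_le hL ha n x)).2])) (by simp [ENNReal.mul_eq_top])
  have h2 : ∫⁻ x, limsup (fun n : ℕ => ENNReal.ofReal (L + (1 / n : ℝ) * a n x)) atTop ∂μ ≤
      ENNReal.ofReal (L + ∫ x, growth a x ∂μ + e / 2) := by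
    calc _ ≤ ∫⁻ x, ENNReal.ofReal (L + growth a x + e / 2) ∂μ := by
          refine lintegral_mono fun x => limsup_le_of_le (by isBoundedDefault) ?_
          have := eventually_lt_of_limsup_lt (b := growth a x + e / 2)
            (by change growth a x < _; linarith) (growth_bdd hL ha x)
          filter_upwards [this] with n hn
          exact ENNReal.ofReal_le_ofReal (by linarith)
      _ = _ := by
          have hi : Integrable (fun x => L + growth a x + e / 2) μ :=
            ((integrable_const L).add hgi).add (integrable_const _)
          rw [← ofReal_integral_eq_lintegral_ofReal hi (Eventually.of_forall fun x => by
            have := (abs_le.1 (abs_growth_le hL ha x)).1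
            change 0 ≤ L + growth a x + e / 2
            linarith)]
          have hi' : Integrable (fun x => L + growth a x) μ := (integrable_const L).add hgi
          rw [integral_add hi' (integrable_const _), integral_add (integrable_const L) hgi]
          simp
  have h3 : ENNReal.ofReal (L + c - e / 2) ≤
      limsup (fun n : ℕ => ∫⁻ x, ENNReal.ofReal (L + (1 / n : ℝ) * a n x) ∂μ) atTop := by
    refine le_limsup_of_frequently_le (Eventually.frequently ?_) (by isBoundedDefault)
    obtain ⟨N, hN⟩ := exists_nat_gt (2 * C / e)
    filter_upwards [eventually_ge_atTop (N + 1)] with n hn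
    have hn0 : (0 : ℝ) < n := by exact_mod_cast (by lia : 0 < n)
    have hnN' : (N : ℝ) ≤ n := by exact_mod_cast (by lia : N ≤ n)
    have hai : Integrable (a n) μ := integrable_of_abs_le (ham n) (ha n)
    have hi : Integrable (fun x => L + (1 / n : ℝ) * a n x) μ :=
      (integrable_const L).add (hai.const_mul _)
    rw [← ofReal_integral_eq_lintegral_ofReal hi (Eventually.of_forall fun x => by
      have := (abs_le.1 (abs_rate_le hL ha n x)).1
      change 0 ≤ L + (1 / n : ℝ) * a n x
      linarith)]
    refine ENNReal.ofReal_le_ofReal ?_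
    rw [integral_add (integrable_const L) (hai.const_mul _), integral_const_mul]
    simp only [integral_const, probReal_univ, one_smul]
    have h4 : c - C / n ≤ (1 / n : ℝ) * ∫ x, a n x ∂μ := by
      calc c - C / n = (1 / n : ℝ) * (n * c - C) := by field_simp
        _ ≤ _ := by gcongr; exact h n
    have h5 : C / n ≤ e / 2 := by
      rw [div_le_iff₀ hn0]
      rw [div_lt_iff₀ he] at hN
      nlinarith
    linarith
  have h6 : -L ≤ ∫ x, growth a x ∂μ := by
    calc -L = ∫ _, -L ∂μ := by simp
      _ ≤ _ := integral_mono (integrable_const _) hgi fun x =>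
        (abs_le.1 (abs_growth_le hL ha x)).1
  have h7 := (ENNReal.ofReal_le_ofReal_iff (by linarith)).1 (h3.trans (h1.trans h2))
  linarith

theorem abs_integral_growth_sub_le (hT : MeasurePreserving T μ μ) (ham : ∀ n, Measurable (a n))
    (hL : 0 ≤ L) (ha : ∀ n x, |a n x| ≤ n * L)
    (hsub : ∀ n m x, a (n + m) x ≤ a n x + a m (T^[n] x)) {c B C : ℝ}
    (h : ∀ n : ℕ, |∫ x, a n x ∂μ - n * c| ≤ n * B + C) : |∫ x, growth a x ∂μ - c| ≤ B := by
  have hlow := le_integral_growth (μ := μ) ham hL ha (c := c - B) (C := C) fun n => by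
    have := (abs_le.1 (h n)).1
    linarith
  have hup : ∫ x, growth a x ∂μ ≤ c + B := by
    refine le_of_forall_pos_le_add fun e he => ?_
    obtain ⟨N, hN⟩ := exists_nat_gt (C / e)
    have h1 := integral_growth_le hT ham hL ha hsub (Nat.succ_pos N)
    have h2 := (abs_le.1 (h (N + 1))).2
    rw [div_lt_iff₀ he] at hN
    have h3 : (0 : ℝ) < (N + 1 : ℕ) := by positivity
    push_cast at h1 h2 h3
    nlinarith
  rw [abs_le]
  constructor <;> linarith

end Ergodic

/-! ### Independent sequences and the skew product -/

/-- The sequence with first term `u` followed by `ω`. -/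
def consSeq {X : Type*} (u : X) (ω : ℕ → X) : ℕ → X
  | 0 => u
  | n + 1 => ω n

theorem measurable_consSeq {X : Type*} [MeasurableSpace X] :
    Measurable fun p : X × (ℕ → X) => consSeq p.1 p.2 := by
  refine measurable_pi_lambda _ fun n => ?_
  cases n with
  | zero => exact measurable_fst
  | succ n => exact (measurable_pi_apply n).comp measurable_snd

/-- The law of an independent sequence of rotations. -/
abbrev seqLaw (ρ : Measure SO3) : Measure (ℕ → SO3) := Measure.infinitePi fun _ : ℕ => ρ

section RandomSequences

variable (ρ : Measure SO3) [IsProbabilityMeasure ρ]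

theorem map_consSeq : (ρ.prod (seqLaw ρ)).map (fun p => consSeq p.1 p.2) = seqLaw ρ := by
  refine Measure.eq_infinitePi _ fun s t ht => ?_
  obtain ⟨N, hN⟩ : ∃ N, s ⊆ Finset.range (N + 1) :=
    ⟨s.sup id, fun i hi => Finset.mem_range.2 (Nat.lt_succ_of_le (Finset.le_sup (f := id) hi))⟩
  classical
  -- Padding with the whole group turns the cylinder into one over an initial segment, from which
  -- the first coordinate splits off.
  set t' : ℕ → Set SO3 := fun i => if i ∈ s then t i else Set.univ with ht'
  have hm : ∀ i, MeasurableSet (t' i) := fun i => by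
    simp only [ht']; split_ifs
    exacts [ht i, MeasurableSet.univ]
  have h1 : (s : Set ℕ).pi t = {ω | ∀ i < N + 1, ω i ∈ t' i} := by
    ext ω
    simp only [Set.mem_pi, Finset.mem_coe, Set.mem_ofPred_eq, ht']
    constructor
    · intro h i _
      split_ifs with hi
      exacts [h i hi, trivial]
    · intro h i hi
      have := h i (Finset.mem_range.1 (hN hi))
      rwa [if_pos hi] at this
  have h2 : (fun p : SO3 × (ℕ → SO3) => consSeq p.1 p.2) ⁻¹' ((s : Set ℕ).pi t) =
      t' 0 ×ˢ ((Finset.range N : Finset ℕ) : Set ℕ).pi fun i => t' (i + 1) := by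
    rw [h1]
    ext ⟨u, ω⟩
    simp only [Set.mem_preimage, Set.mem_ofPred_eq, Set.mem_prod, Set.mem_pi, Finset.coe_range,
      Set.mem_Iio]
    constructor
    · intro h
      exact ⟨h 0 (Nat.succ_pos N), fun i hi => h (i + 1) (Nat.succ_lt_succ hi)⟩
    · rintro ⟨h0, h⟩ i hi
      cases i with
      | zero => exact h0
      | succ i => exact h i (Nat.lt_of_succ_lt_succ hi)
  rw [Measure.map_apply measurable_consSeq (MeasurableSet.pi s.countable_toSet fun i _ => ht i), h2,
    Measure.prod_prod, Measure.infinitePi_pi _ fun i _ => hm (i + 1), mul_comm,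
    ← Finset.prod_range_succ' (fun i => ρ (t' i))]
  rw [← Finset.prod_subset hN fun i _ hi => by simp [ht', hi]]
  exact Finset.prod_congr rfl fun i hi => by simp [ht', hi]

theorem lintegral_seqLaw {f : (ℕ → SO3) → ENNReal} (hf : Measurable f) :
    ∫⁻ ω, f ω ∂seqLaw ρ = ∫⁻ u, ∫⁻ ω, f (consSeq u ω) ∂seqLaw ρ ∂ρ := by
  conv_lhs => rw [← map_consSeq ρ]
  have hm : Measurable fun p : SO3 × (ℕ → SO3) => f (consSeq p.1 p.2) := hf.comp measurable_consSeq
  rw [lintegral_map hf measurable_consSeq, lintegral_prod _ hm.aemeasurable]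

theorem integral_seqLaw {f : (ℕ → SO3) → ℝ} (hf : Measurable f) {M : ℝ} (hM : ∀ ω, |f ω| ≤ M) :
    ∫ ω, f ω ∂seqLaw ρ = ∫ u, ∫ ω, f (consSeq u ω) ∂seqLaw ρ ∂ρ := by
  conv_lhs => rw [← map_consSeq ρ]
  rw [integral_map measurable_consSeq.aemeasurable hf.aestronglyMeasurable, integral_prod]
  exact integrable_of_abs_le (hf.comp measurable_consSeq) fun p => hM _

theorem bstep_rot0_mul (ε : ℝ) (h : SO3) (t : ℝ) : bstep ε (rot0 t * h) =
    rot0 (t + Real.pi * ε * (ent h 0 0 + 1)) * h := by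
  have : ent (rot0 t * h) 0 0 = ent h 0 0 := by
    rw [ent_mul]; simp [ent_def, coe_rot0]
  rw [bstep, this, add_comm t, rot0_add, mul_assoc (rot0 _)]

/-- The angle of the twist depends on the corner entry, which left multiplication by `rot0`
preserves. On each such circle the twist is a fixed rotation. -/
theorem lintegral_bstep (ε : ℝ) {f : SO3 → ENNReal} (hf : Measurable f) :
    ∫⁻ h, f (bstep ε h) ∂haar = ∫⁻ h, f h ∂haar := by
  rw [lintegral_haar_left (f := fun h => f (bstep ε h)) (by fun_prop) measurable_rot0,
    lintegral_haar_left hf measurable_rot0]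
  refine lintegral_congr fun h => ?_
  simp only [bstep_rot0_mul]
  exact lintegral_circ_add (f := fun t => f (rot0 t * h))
    (fun t => by simp only [rot0_add_two_pi]) _

theorem measurePreserving_skew (ε : ℝ) :
    MeasurePreserving (skew ε) ((seqLaw ρ).prod haar) ((seqLaw ρ).prod haar) := by
  refine ⟨measurable_skew ε, Measure.ext_of_lintegral _ fun f hf => ?_⟩
  have hfs : Measurable fun y => f (skew ε y) := hf.comp (measurable_skew ε)
  rw [lintegral_map hf (measurable_skew ε), lintegral_prod _ hfs.aemeasurable,
    lintegral_seqLaw ρ (by exact hfs.lintegral_prod_right'), lintegral_prod _ hf.aemeasurable]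
  have key : ∀ u ω, ∫⁻ h, f (skew ε (consSeq u ω, h)) ∂haar = ∫⁻ h, f (ω, h) ∂haar := by
    intro u ω
    calc _ = ∫⁻ h, f (ω, u * bstep ε h) ∂haar := rfl
      _ = ∫⁻ h, f (ω, u * h) ∂haar := lintegral_bstep ε (f := fun h => f (ω, u * h)) (by fun_prop)
      _ = _ := lintegral_mul_left_eq_self (fun h => f (ω, h)) u
  simp [key]

/-! ### Norms and vector growth -/

theorem log_le_two_mul_sqrt {x : ℝ} (hx : 0 < x) : Real.log x ≤ 2 * √x := by
  have h1 := Real.log_le_sub_one_of_pos (Real.sqrt_pos.2 hx)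
  rw [Real.log_sqrt hx.le] at h1
  linarith

theorem clm_exp_mul_I (A : ℂ →L[ℝ] ℂ) (t : ℝ) :
    A (Complex.exp (t * Complex.I)) = Real.cos t • A 1 + Real.sin t • A Complex.I := by
  have : Complex.exp (t * Complex.I) = Real.cos t • (1 : ℂ) + Real.sin t • Complex.I := by
    rw [Complex.exp_mul_I]; simp
  rw [this, map_add, map_smul, map_smul]

/-- One of the images of 1 and i has length at least ‖A‖/2. Projecting to its direction w bounds the
length of A on the circle below by a cosine of amplitude at least ‖A‖/2, and log x ≤ 2√x leads to
`wt`. The bound is uniform in A. -/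
theorem lintegral_log_norm_sub_le (A : ℂ →L[ℝ] ℂ)
    (hA : ∀ t : ℝ, A (Complex.exp (t * Complex.I)) ≠ 0) :
    ∫⁻ t, ENNReal.ofReal (Real.log ‖A‖ - Real.log ‖A (Complex.exp (t * Complex.I))‖) ∂circ ≤
      4 * cosAvg := by
  have hA0 : 0 < ‖A‖ := norm_pos_iff.2 fun h => hA 0 (by rw [h]; rfl)
  have hnorm : ‖A‖ ≤ ‖A 1‖ + ‖A Complex.I‖ := by
    refine ContinuousLinearMap.opNorm_le_bound _ (by positivity) fun z => ?_
    have hz : z = z.re • (1 : ℂ) + z.im • Complex.I := by simp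
    calc ‖A z‖ = ‖z.re • A 1 + z.im • A Complex.I‖ := by
          conv_lhs => rw [hz, map_add, map_smul, map_smul]
      _ ≤ |z.re| * ‖A 1‖ + |z.im| * ‖A Complex.I‖ := by
          refine (norm_add_le _ _).trans ?_
          rw [norm_smul, norm_smul, Real.norm_eq_abs, Real.norm_eq_abs]
      _ ≤ ‖z‖ * ‖A 1‖ + ‖z‖ * ‖A Complex.I‖ := by
          gcongr
          exacts [Complex.abs_re_le_norm z, Complex.abs_im_le_norm z]
      _ = _ := by ring
  obtain ⟨w, hw0, p, q, hp, hpq⟩ : ∃ w : ℂ, ‖w‖ ≤ 1 ∧ ∃ p q : ℝ,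
      (p = inner ℝ w (A 1) ∧ q = inner ℝ w (A Complex.I)) ∧ ‖A‖ / 2 ≤ √(p ^ 2 + q ^ 2) := by
    have aux : ∀ v : ℂ, v ≠ 0 → ‖(‖v‖⁻¹ : ℝ) • v‖ ≤ 1 ∧ inner ℝ ((‖v‖⁻¹ : ℝ) • v) v = ‖v‖ := by
      intro v hv
      have hv' : ‖v‖ ≠ 0 := norm_ne_zero_iff.2 hv
      refine ⟨by rw [norm_smul, norm_inv, norm_norm, inv_mul_cancel₀ hv'], ?_⟩
      rw [real_inner_smul_left, real_inner_self_eq_norm_sq]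
      field_simp
    rcases le_total ‖A Complex.I‖ ‖A 1‖ with h | h
    · have hv : A 1 ≠ 0 := by simpa using hA 0
      obtain ⟨h1, h2⟩ := aux _ hv
      refine ⟨_, h1, _, _, ⟨rfl, rfl⟩, ?_⟩
      rw [h2]
      refine le_trans ?_ (Real.le_sqrt_of_sq_le (x := ‖A 1‖) (le_add_of_nonneg_right (sq_nonneg _)))
      linarith
    · have hv : A Complex.I ≠ 0 := by
        have := hA (Real.pi / 2)
        rw [clm_exp_mul_I] at this
        simpa using this
      obtain ⟨h1, h2⟩ := aux _ hv
      refine ⟨_, h1, _, _, ⟨rfl, rfl⟩, ?_⟩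
      rw [h2]
      refine le_trans ?_ (Real.le_sqrt_of_sq_le (x := ‖A Complex.I‖)
        (le_add_of_nonneg_left (sq_nonneg _)))
      linarith
  have hlow : ∀ t : ℝ, |p * Real.cos t + q * Real.sin t| ≤ ‖A (Complex.exp (t * Complex.I))‖ := by
    intro t
    have : p * Real.cos t + q * Real.sin t = inner ℝ w (A (Complex.exp (t * Complex.I))) := by
      rw [clm_exp_mul_I, inner_add_right, real_inner_smul_right, real_inner_smul_right, hp.1, hp.2]
      ring
    rw [this]
    exact (abs_real_inner_le_norm _ _).trans (mul_le_of_le_one_left (norm_nonneg _) hw0)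
  calc _ ≤ ∫⁻ t, 2 * wt (‖A‖⁻¹ * p * Real.cos t + ‖A‖⁻¹ * q * Real.sin t) ∂circ := by
        refine lintegral_mono fun t => ?_
        have hpos := norm_pos_iff.2 (hA t)
        have h1 : Real.log ‖A‖ - Real.log ‖A (Complex.exp (t * Complex.I))‖ ≤
            2 * (√(‖A‖⁻¹ * ‖A (Complex.exp (t * Complex.I))‖))⁻¹ := by
          rw [← Real.log_div hA0.ne' hpos.ne', ← Real.sqrt_inv, mul_inv, inv_inv, ← div_eq_mul_inv]
          exact log_le_two_mul_sqrt (by positivity)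
        calc _ ≤ ENNReal.ofReal (2 * (√(‖A‖⁻¹ * ‖A (Complex.exp (t * Complex.I))‖))⁻¹) :=
              ENNReal.ofReal_le_ofReal h1
          _ = 2 * wt (‖A‖⁻¹ * ‖A (Complex.exp (t * Complex.I))‖) := by
              rw [wt_eq_ofReal_inv_sqrt (by positivity), ENNReal.ofReal_mul (by norm_num)]
              simp
          _ ≤ _ := by
              gcongr
              refine wt_anti ?_
              rw [mul_assoc, mul_assoc, ← mul_add, abs_mul, abs_mul, abs_norm]
              gcongr
              exact hlow t
    _ = 2 * (wt (√((‖A‖⁻¹ * p) ^ 2 + (‖A‖⁻¹ * q) ^ 2)) * cosAvg) := by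
        rw [lintegral_const_mul _ (by fun_prop), lintegral_circ_wt]
    _ ≤ 2 * (2 * cosAvg) := by
        gcongr
        refine (wt_anti ?_).trans wt_half_le
        rw [abs_of_nonneg (Real.sqrt_nonneg _), abs_of_pos (by norm_num), mul_pow, mul_pow, ← mul_add,
          Real.sqrt_mul (by positivity), Real.sqrt_sq (by positivity), inv_mul_eq_div,
          le_div_iff₀ hA0]
        linarith
    _ = _ := by ring

theorem norm_cocyc_mul_rot0_le (ε : ℝ) (n : ℕ) (ω : ℕ → SO3) (h : SO3) (t : ℝ) :
    ‖cocyc ε n (ω, h * rot0 t)‖ ≤ ‖cocyc ε n (ω, h)‖ := by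
  refine ContinuousLinearMap.opNorm_le_bound _ (ContinuousLinearMap.opNorm_nonneg _) fun z => ?_
  rw [cocyc_mul_rot0, norm_mul, norm_exp_neg_mul_I, one_mul]
  refine (ContinuousLinearMap.le_opNorm _ _).trans ?_
  rw [norm_mul, Complex.norm_exp_ofReal_mul_I, one_mul]

theorem measurable_log_norm_cocyc (ε : ℝ) (n : ℕ) :
    Measurable fun y => Real.log ‖cocyc ε n y‖ :=
  Real.measurable_log.comp (measurable_cocyc ε n).norm

theorem measurable_log_norm_cocyc_one (ε : ℝ) (n : ℕ) :
    Measurable fun y => Real.log ‖cocyc ε n y 1‖ :=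
  Real.measurable_log.comp
    (((ContinuousLinearMap.apply ℝ ℂ (1 : ℂ)).continuous.measurable.comp
      (measurable_cocyc ε n)).norm)

theorem log_norm_cocyc_one_le {ε : ℝ} (hε : 0 ≤ ε) (n : ℕ) (y : Orbit) :
    Real.log ‖cocyc ε n y 1‖ ≤ Real.log ‖cocyc ε n y‖ := by
  refine Real.log_le_log (norm_pos_iff.2 (cocyc_apply_ne_zero hε n y one_ne_zero)) ?_
  simpa using (cocyc ε n y).le_opNorm 1

/-- Averaging over the tangent direction makes the loss from norm to single vector bounded
independently of n, hence invisible in the exponent. -/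
theorem lintegral_norm_defect_le {ε : ℝ} (hε : 0 ≤ ε) (n : ℕ) (ω : ℕ → SO3) :
    ∫⁻ h, ENNReal.ofReal (Real.log ‖cocyc ε n (ω, h)‖ - Real.log ‖cocyc ε n (ω, h) 1‖) ∂haar ≤
      4 * cosAvg := by
  have m1 := measurable_log_norm_cocyc ε n
  have m2 := measurable_log_norm_cocyc_one ε n
  rw [lintegral_haar_right (by
    exact ((m1.comp measurable_prodMk_left).sub (m2.comp measurable_prodMk_left)).ennreal_ofReal)
    measurable_rot0]
  calc _ ≤ ∫⁻ _ : SO3, 4 * cosAvg ∂haar := lintegral_mono fun h => ?_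
    _ = _ := by simp
  refine le_trans (lintegral_mono fun t => ENNReal.ofReal_le_ofReal ?_)
    (lintegral_log_norm_sub_le (cocyc ε n (ω, h))
      fun t => cocyc_apply_ne_zero hε _ _ (Complex.exp_ne_zero _))
  rw [norm_cocyc_mul_rot0]
  exact sub_le_sub_right (Real.log_le_log (norm_cocyc_pos hε _ _)
    (norm_cocyc_mul_rot0_le ε n ω h t)) _

/-! ### The transfer operator -/

/-- The expected growth of the first tangent vector of a frame. -/
def meanGrowth (ε : ℝ) (n : ℕ) (h : SO3) : ℝ :=
  ∫ ω, Real.log ‖cocyc ε n (ω, h) 1‖ ∂seqLaw ρ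

/-- The transfer operator of the random projective action on frames. -/
def trans (ε : ℝ) (ψ : SO3 → ℝ) (h : SO3) : ℝ := ∫ u, ψ (u * fstep ε h) ∂ρ

omit [IsProbabilityMeasure ρ] in
theorem measurable_trans [SFinite ρ] (ε : ℝ) {ψ : SO3 → ℝ} (hψ : Measurable ψ) :
    Measurable (trans ρ ε ψ) := by
  have : Measurable fun p : SO3 × SO3 => ψ (p.2 * fstep ε p.1) := by fun_prop
  exact (this.stronglyMeasurable.integral_prod_right').measurable

theorem abs_integral_le_of_abs_le {X : Type*} [MeasurableSpace X] {μ : Measure X}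
    [IsProbabilityMeasure μ] {ψ : X → ℝ} {M : ℝ} (hM : ∀ h, |ψ h| ≤ M) : |∫ x, ψ x ∂μ| ≤ M := by
  have := norm_integral_le_of_norm_le_const (μ := μ) (C := M) (f := ψ)
    (Eventually.of_forall fun x => by rw [Real.norm_eq_abs]; exact hM x)
  simpa using this

theorem abs_trans_le (ε : ℝ) {ψ : SO3 → ℝ} {M : ℝ} (hM : ∀ h, |ψ h| ≤ M) (h : SO3) :
    |trans ρ ε ψ h| ≤ M := abs_integral_le_of_abs_le fun _ => hM _

theorem measurable_trans_iterate (ε : ℝ) {ψ : SO3 → ℝ} (hψ : Measurable ψ) (k : ℕ) :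
    Measurable ((trans ρ ε)^[k] ψ) := by
  induction k with
  | zero => exact hψ
  | succ k ih => rw [Function.iterate_succ_apply']; exact measurable_trans ρ ε ih

theorem abs_trans_iterate_le (ε : ℝ) {ψ : SO3 → ℝ} {M : ℝ} (hM : ∀ h, |ψ h| ≤ M) (k : ℕ) (h : SO3) :
    |(trans ρ ε)^[k] ψ h| ≤ M := by
  induction k generalizing h with
  | zero => exact hM h
  | succ k ih => rw [Function.iterate_succ_apply']; exact abs_trans_le ρ ε ih h

theorem integrable_comp_mul_right {ψ : SO3 → ℝ} (hψ : Measurable ψ) {M : ℝ} (hM : ∀ h, |ψ h| ≤ M)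
    (g : SO3) : Integrable (fun u => ψ (u * g)) ρ :=
  integrable_of_abs_le (hψ.comp (measurable_mul_const g)) fun _ => hM _

theorem meanGrowth_succ {ε : ℝ} (hε : 0 ≤ ε) (n : ℕ) (h : SO3) :
    meanGrowth ρ ε (n + 1) h = stretch ε h + trans ρ ε (meanGrowth ρ ε n) h := by
  have m : Measurable fun ω => Real.log ‖cocyc ε (n + 1) (ω, h) 1‖ :=
    (measurable_log_norm_cocyc_one ε (n + 1)).comp measurable_prodMk_right
  rw [meanGrowth, integral_seqLaw ρ m
    fun ω => abs_log_norm_cocyc_apply_le hε (n + 1) (ω, h) (by simp)]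
  simp only [log_norm_cocyc_succ hε]
  have hint : ∀ w : SO3, Integrable (fun ω => Real.log ‖cocyc ε n (ω, w) 1‖) (seqLaw ρ) := fun w =>
    integrable_of_abs_le ((measurable_log_norm_cocyc_one ε n).comp measurable_prodMk_right)
      fun ω => abs_log_norm_cocyc_apply_le hε n (ω, w) (by simp)
  have hin : ∀ u : SO3, ∫ ω, (stretch ε h + Real.log ‖cocyc ε n
      (fun n => consSeq u ω (n + 1), consSeq u ω 0 * fstep ε h) 1‖) ∂seqLaw ρ =
      stretch ε h + meanGrowth ρ ε n (u * fstep ε h) := fun u => by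
    change ∫ ω, (stretch ε h + Real.log ‖cocyc ε n (ω, u * fstep ε h) 1‖) ∂seqLaw ρ = _
    rw [integral_add (integrable_const _) (hint (u * fstep ε h))]
    simp [meanGrowth]
  simp only [hin]
  have hmg : Measurable (meanGrowth ρ ε n) :=
    ((measurable_log_norm_cocyc_one ε n).comp measurable_swap).stronglyMeasurable.integral_prod_right'.measurable
  rw [integral_add (integrable_const _) (integrable_comp_mul_right ρ hmg (M := n * rate ε)
    (fun w => abs_integral_le_of_abs_le fun ω =>
      abs_log_norm_cocyc_apply_le hε n (ω, w) (by simp)) _)]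
  simp [trans]

theorem meanGrowth_eq_sum {ε : ℝ} (hε : 0 ≤ ε) (n : ℕ) (h : SO3) :
    meanGrowth ρ ε n h = ∑ k ∈ Finset.range n, (trans ρ ε)^[k] (stretch ε) h := by
  induction n generalizing h with
  | zero => simp [meanGrowth, cocyc]
  | succ n ih =>
    rw [meanGrowth_succ ρ hε, Finset.sum_range_succ', add_comm]
    congr 1
    simp only [trans, ih, Function.iterate_succ_apply']
    exact integral_finsetSum _ fun k _ => integrable_comp_mul_right ρ
      (measurable_trans_iterate ρ ε (measurable_stretch ε) k)
      (abs_trans_iterate_le ρ ε (abs_stretch_le hε) k) _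

theorem abs_integral_log_norm_sub_le {ε : ℝ} (hε : 0 ≤ ε) (n : ℕ) :
    |∫ y, Real.log ‖cocyc ε n y‖ ∂(seqLaw ρ).prod haar - ∫ h, meanGrowth ρ ε n h ∂haar| ≤
      (4 * cosAvg).toReal := by
  have m1 := measurable_log_norm_cocyc ε n
  have m2 := measurable_log_norm_cocyc_one ε n
  have i1 : Integrable (fun y => Real.log ‖cocyc ε n y‖) ((seqLaw ρ).prod haar) :=
    integrable_of_abs_le m1 (abs_log_norm_cocyc_le hε n)
  have i2 : Integrable (fun y => Real.log ‖cocyc ε n y 1‖) ((seqLaw ρ).prod haar) :=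
    integrable_of_abs_le m2 fun y => abs_log_norm_cocyc_apply_le hε n y (by simp)
  have e : ∫ h, meanGrowth ρ ε n h ∂haar =
      ∫ y, Real.log ‖cocyc ε n y 1‖ ∂(seqLaw ρ).prod haar := (integral_prod_symm _ i2).symm
  have hnn : ∀ y, 0 ≤ Real.log ‖cocyc ε n y‖ - Real.log ‖cocyc ε n y 1‖ := fun y =>
    sub_nonneg.2 (log_norm_cocyc_one_le hε n y)
  rw [e, ← integral_sub i1 i2, abs_of_nonneg (integral_nonneg hnn),
    integral_eq_lintegral_of_nonneg_ae (Eventually.of_forall hnn) (m1.sub m2).aestronglyMeasurable]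
  refine ENNReal.toReal_mono (ENNReal.mul_ne_top (by simp) cosAvg_lt_top.ne) ?_
  have m3 : Measurable fun y =>
      ENNReal.ofReal (Real.log ‖cocyc ε n y‖ - Real.log ‖cocyc ε n y 1‖) :=
    (m1.sub m2).ennreal_ofReal
  rw [lintegral_prod _ m3.aemeasurable]
  calc _ ≤ ∫⁻ _, 4 * cosAvg ∂seqLaw ρ := lintegral_mono fun ω => lintegral_norm_defect_le hε n ω
    _ = _ := by simp

theorem randomExponent_eq {ε : ℝ} (hε : 0 ≤ ε) : randomExponent (twist ε) ρ =
    ∫ y, growth (fun n y => Real.log ‖cocyc ε n y‖) y ∂(seqLaw ρ).prod haar := by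
  rw [integral_prod _ (integrable_of_abs_le (measurable_growth (measurable_log_norm_cocyc ε))
    (abs_growth_le (rate_nonneg hε) (abs_log_norm_cocyc_le hε)))]
  simp only [randomExponent, integral_pointExponent]
  rfl

/-- The random exponent is close to `c` if the averages of the iterates of the stretch under the
transfer operator are eventually close to `c`. -/
theorem abs_randomExponent_sub_le {ε : ℝ} (hε : 0 ≤ ε) {c B : ℝ} (hB : 0 ≤ B) (N : ℕ)
    (h : ∀ k, N ≤ k → |∫ h, (trans ρ ε)^[k] (stretch ε) h ∂haar - c| ≤ B) :
    |randomExponent (twist ε) ρ - c| ≤ B := by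
  rw [randomExponent_eq ρ hε]
  refine abs_integral_growth_sub_le (C := N * (rate ε + |c|) + (4 * cosAvg).toReal)
    (measurePreserving_skew ρ ε) (measurable_log_norm_cocyc ε)
    (rate_nonneg hε) (abs_log_norm_cocyc_le hε)
    (fun n m y => log_norm_cocyc_add_le hε m n y) fun n => ?_
  have hr := rate_nonneg hε
  have h1 := abs_integral_log_norm_sub_le ρ hε n
  -- The first N iterates satisfy only the trivial bound; their total contribution does not grow
  -- with n.
  have h2 : ∀ k, |∫ h, (trans ρ ε)^[k] (stretch ε) h ∂haar - c| ≤
      B + if k < N then rate ε + |c| else 0 := by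
    intro k
    split_ifs with hk
    · have := abs_integral_le_of_abs_le (μ := haar)
        (abs_trans_iterate_le ρ ε (abs_stretch_le hε) k)
      linarith [abs_sub (∫ h, (trans ρ ε)^[k] (stretch ε) h ∂haar) c]
    · rw [add_zero]; exact h k (not_lt.1 hk)
  have h3 : ∫ h, meanGrowth ρ ε n h ∂haar =
      ∑ k ∈ Finset.range n, ∫ h, (trans ρ ε)^[k] (stretch ε) h ∂haar := by
    simp only [meanGrowth_eq_sum ρ hε]
    exact integral_finsetSum _ fun k _ => integrable_of_abs_le
      (measurable_trans_iterate ρ ε (measurable_stretch ε) k)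
      (abs_trans_iterate_le ρ ε (abs_stretch_le hε) k)
  have h4 : |∫ h, meanGrowth ρ ε n h ∂haar - n * c| ≤ n * B + N * (rate ε + |c|) := by
    have e : ∫ h, meanGrowth ρ ε n h ∂haar - n * c =
        ∑ k ∈ Finset.range n, (∫ h, (trans ρ ε)^[k] (stretch ε) h ∂haar - c) := by
      rw [h3, Finset.sum_sub_distrib]; simp
    rw [e]
    refine (Finset.abs_sum_le_sum_abs _ _).trans ((Finset.sum_le_sum fun k _ => h2 k).trans ?_)
    rw [Finset.sum_add_distrib, ← Finset.sum_filter]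
    simp only [Finset.sum_const, Finset.card_range, nsmul_eq_mul]
    gcongr
    calc ((Finset.range n).filter (· < N)).card ≤ (Finset.range N).card :=
          Finset.card_le_card fun k hk => Finset.mem_range.2 (Finset.mem_filter.1 hk).2
      _ = N := Finset.card_range N
  rw [abs_le] at h1 h4 ⊢
  constructor <;> linarith

/-- A Haar distributed rotation makes the next frame Haar distributed whatever the present one is,
so the transfer operator maps every function to its mean. -/
theorem R_eq {ε : ℝ} (hε : 0 ≤ ε) : R ε = ∫ h, stretch ε h ∂haar := by
  have h1 : ∀ ψ : SO3 → ℝ, trans haar ε ψ = fun _ => ∫ h, ψ h ∂haar := fun ψ =>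
    funext fun h => integral_mul_right_eq_self ψ _
  have h2 : ∀ k, ∫ h, (trans haar ε)^[k] (stretch ε) h ∂haar = ∫ h, stretch ε h ∂haar := by
    intro k
    induction k with
    | zero => rfl
    | succ k ih => rw [Function.iterate_succ_apply', h1, ih]; simp
  have := abs_randomExponent_sub_le haar hε (c := ∫ h, stretch ε h ∂haar) le_rfl 0
    fun k _ => by rw [h2, sub_self, abs_zero]
  exact sub_eq_zero.1 (abs_nonpos_iff.1 this)

end RandomSequences

/-! ### The diffused laws -/

theorem measurableSet_identityBall {δ : ℝ} (hδ : 0 < δ) : MeasurableSet (identityBall δ) := by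
  obtain ⟨c, hc⟩ := exists_identityBall_eq hδ
  rw [hc]; exact measurableSet_lt measurable_const measurable_tr

/-- The volume of the ball `U_δ`. -/
def ballVol (δ : ℝ) : ℝ := (haar (identityBall δ)).toReal

theorem ballVol_ge {δ : ℝ} (h0 : 0 < δ) (h1 : δ ≤ 1) : (δ / 48) ^ 3 ≤ ballVol δ :=
  (ENNReal.ofReal_le_iff_le_toReal (measure_ne_top _ _)).1 (haar_identityBall_ge h0 h1)

theorem ballVol_pos {δ : ℝ} (h0 : 0 < δ) (h1 : δ ≤ 1) : 0 < ballVol δ :=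
  lt_of_lt_of_le (by positivity) (ballVol_ge h0 h1)

theorem haar_identityBall_eq {δ : ℝ} : haar (identityBall δ) = ENNReal.ofReal (ballVol δ) :=
  (ENNReal.ofReal_toReal (measure_ne_top _ _)).symm

theorem haar_identityBall_ne_zero {δ : ℝ} (h0 : 0 < δ) (h1 : δ ≤ 1) :
    haar (identityBall δ) ≠ 0 := by
  rw [haar_identityBall_eq]; simpa using ballVol_pos h0 h1

theorem isProbabilityMeasure_cond {δ : ℝ} (h0 : 0 < δ) (h1 : δ ≤ 1) :
    IsProbabilityMeasure (haar[|identityBall δ]) :=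
  cond_isProbabilityMeasure (haar_identityBall_ne_zero h0 h1)

theorem isProbabilityMeasure_diffusedLaw (g : SO3) {δ : ℝ} (h0 : 0 < δ) (h1 : δ ≤ 1) :
    IsProbabilityMeasure (diffusedLaw g δ) := by
  have := isProbabilityMeasure_cond h0 h1
  exact Measure.isProbabilityMeasure_map (measurable_mul_const g).aemeasurable

theorem integral_diffusedLaw (g : SO3) (δ : ℝ) {ψ : SO3 → ℝ} (hψ : Measurable ψ) :
    ∫ u, ψ u ∂diffusedLaw g δ = ∫ u, ψ (u * g) ∂haar[|identityBall δ] := by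
  rw [diffusedLaw, integral_map (measurable_mul_const g).aemeasurable hψ.aestronglyMeasurable]

theorem integral_cond (δ : ℝ) (ψ : SO3 → ℝ) :
    ∫ u, ψ u ∂haar[|identityBall δ] = (ballVol δ)⁻¹ * ∫ u in identityBall δ, ψ u ∂haar := by
  rw [ProbabilityTheory.cond, integral_smul_measure, ENNReal.toReal_inv, ballVol, smul_eq_mul]

/-- The translated law has density at most 1/vol(U_δ) with respect to Haar measure. -/
theorem lintegral_diffusedLaw_le (g w : SO3) {δ : ℝ} (h0 : 0 < δ) (h1 : δ ≤ 1)
    {F : SO3 → ENNReal} (hF : Measurable F) : ∫⁻ u, F (u * w) ∂diffusedLaw g δ ≤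
      ENNReal.ofReal (ballVol δ)⁻¹ * ∫⁻ h, F h ∂haar := by
  rw [diffusedLaw, lintegral_map (by fun_prop) (measurable_mul_const g), ProbabilityTheory.cond,
    lintegral_smul_measure, haar_identityBall_eq, smul_eq_mul,
    ENNReal.ofReal_inv_of_pos (ballVol_pos h0 h1)]
  refine mul_le_mul' le_rfl ?_
  calc _ ≤ ∫⁻ u, F (u * g * w) ∂haar := setLIntegral_le_lintegral _ _
    _ = ∫⁻ u, F (u * (g * w)) ∂haar := by simp only [mul_assoc]
    _ = _ := lintegral_mul_right_eq_self F _

theorem tr_mul_comm (g h : SO3) : tr (g * h) = tr (h * g) := by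
  simp only [tr, ent_mul]; ring

theorem tr_mul_rot0_sub (y : SO3) (s t : ℝ) : |tr (y * rot0 s) - tr (y * rot0 t)| ≤
    2 * |Real.cos s - Real.cos t| + 2 * |Real.sin s - Real.sin t| := by
  have h1 := abs_le.1 (abs_entry_le_one y 1 1)
  have h2 := abs_le.1 (abs_entry_le_one y 2 2)
  have h3 := abs_le.1 (abs_entry_le_one y 1 2)
  have h4 := abs_le.1 (abs_entry_le_one y 2 1)
  have e : tr (y * rot0 s) - tr (y * rot0 t) = (ent y 1 1 + ent y 2 2) *
      (Real.cos s - Real.cos t) + (ent y 1 2 - ent y 2 1) * (Real.sin s - Real.sin t) := by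
    rw [tr_mul_rot0, tr_mul_rot0]; ring
  rw [e]
  refine (abs_add_le _ _).trans ?_
  rw [abs_mul, abs_mul]
  gcongr <;> rw [abs_le] <;> constructor <;> linarith

/-- Averages over the ball are Hölder continuous in the direction of the tangent vector. -/
theorem abs_setIntegral_identityBall_sub_le {δ : ℝ} (hδ : 0 < δ) {ψ : SO3 → ℝ}
    (hψ : Measurable ψ) {M : ℝ} (hM : ∀ h, |ψ h| ≤ M) (k : SO3) {θ β s : ℝ} (hs : 0 < s)
    (hsθ : 2 * |Real.cos θ - Real.cos β| + 2 * |Real.sin θ - Real.sin β| ≤ s) :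
    |∫ u in identityBall δ, ψ (u * (k * rot0 θ)) ∂haar -
      ∫ u in identityBall δ, ψ (u * (k * rot0 β)) ∂haar| ≤
      M * (ENNReal.ofReal (4 * √s) * tiltAvg).toReal := by
  obtain ⟨c, hc⟩ := exists_identityBall_eq hδ
  have hU := measurableSet_identityBall hδ
  have hM0 : 0 ≤ M := (abs_nonneg _).trans (hM 1)
  set U := identityBall δ
  -- Substituting h = u w makes the direction move the domain of integration and not ψ, which is
  -- merely bounded and measurable.
  set F : SO3 → SO3 → ℝ := fun w h => ((· * w⁻¹) ⁻¹' U).indicator ψ h with hF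
  have hUw : ∀ w : SO3, MeasurableSet ((· * w⁻¹) ⁻¹' U) := fun w => hU.preimage (by fun_prop)
  have e : ∀ w : SO3, ∫ u in U, ψ (u * w) ∂haar = ∫ h, F w h ∂haar := by
    intro w
    rw [← integral_indicator hU, ← integral_mul_right_eq_self (F w) w]
    refine integral_congr_ae (Eventually.of_forall fun u => ?_)
    have hiff : u * w ∈ (· * w⁻¹) ⁻¹' U ↔ u ∈ U := by rw [Set.mem_preimage, mul_inv_cancel_right]
    change U.indicator (fun u => ψ (u * w)) u = ((· * w⁻¹) ⁻¹' U).indicator ψ (u * w)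
    by_cases hu : u ∈ U
    · rw [Set.indicator_of_mem hu, Set.indicator_of_mem (hiff.2 hu)]
    · rw [Set.indicator_of_notMem hu, Set.indicator_of_notMem (mt hiff.1 hu)]
  have hFi : ∀ w, Integrable (F w) haar := fun w =>
    (integrable_of_abs_le hψ hM).indicator (hUw w)
  set S : Set SO3 := (· * (k * rot0 θ)⁻¹) ⁻¹' {u | |tr u - c| ≤ s} with hS
  have hSm : MeasurableSet S := (measurableSet_le (by fun_prop) measurable_const).preimage
    (by fun_prop)
  -- A point lying in just one of the two translated balls has a trace within s of the threshold c,
  -- hence lies in a shell.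
  have hpt : ∀ h, |F (k * rot0 θ) h - F (k * rot0 β) h| ≤ S.indicator (fun _ => M) h := by
    intro h
    have htr : |tr (h * (k * rot0 θ)⁻¹) - tr (h * (k * rot0 β)⁻¹)| ≤ s := by
      have e1 : ∀ t : ℝ, tr (h * (k * rot0 t)⁻¹) = tr (k⁻¹ * h * rot0 (-t)) := fun t => by
        rw [mul_inv_rev, ← rot0_neg, ← mul_assoc, tr_mul_comm, ← mul_assoc]
      rw [e1, e1]
      refine (tr_mul_rot0_sub _ _ _).trans (le_trans (le_of_eq ?_) hsθ)
      rw [Real.cos_neg, Real.cos_neg, Real.sin_neg, Real.sin_neg, neg_sub_neg, abs_sub_comm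
        (Real.sin β)]
    rw [abs_le] at htr
    by_cases h1 : h * (k * rot0 θ)⁻¹ ∈ U <;> by_cases h2 : h * (k * rot0 β)⁻¹ ∈ U
    · simp only [hF, Set.indicator_of_mem (show h ∈ (· * (k * rot0 θ)⁻¹) ⁻¹' U from h1),
        Set.indicator_of_mem (show h ∈ (· * (k * rot0 β)⁻¹) ⁻¹' U from h2), sub_self, abs_zero]
      exact Set.indicator_nonneg (fun _ _ => hM0) h
    · simp only [hF, Set.indicator_of_mem (show h ∈ (· * (k * rot0 θ)⁻¹) ⁻¹' U from h1),
        Set.indicator_of_notMem (show h ∉ (· * (k * rot0 β)⁻¹) ⁻¹' U from h2), sub_zero]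
      rw [hc, Set.mem_ofPred_eq] at h1 h2
      rw [Set.indicator_of_mem]
      · exact hM h
      · change |tr (h * (k * rot0 θ)⁻¹) - c| ≤ s
        rw [abs_le]; constructor <;> linarith
    · simp only [hF, Set.indicator_of_notMem (show h ∉ (· * (k * rot0 θ)⁻¹) ⁻¹' U from h1),
        Set.indicator_of_mem (show h ∈ (· * (k * rot0 β)⁻¹) ⁻¹' U from h2), zero_sub, abs_neg]
      rw [hc, Set.mem_ofPred_eq] at h1 h2
      rw [Set.indicator_of_mem]
      · exact hM h
      · change |tr (h * (k * rot0 θ)⁻¹) - c| ≤ s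
        rw [abs_le]; constructor <;> linarith
    · simp only [hF, Set.indicator_of_notMem (show h ∉ (· * (k * rot0 θ)⁻¹) ⁻¹' U from h1),
        Set.indicator_of_notMem (show h ∉ (· * (k * rot0 β)⁻¹) ⁻¹' U from h2), sub_self, abs_zero]
      exact Set.indicator_nonneg (fun _ _ => hM0) h
  rw [e, e, ← integral_sub (hFi _) (hFi _)]
  calc _ ≤ ∫ h, |F (k * rot0 θ) h - F (k * rot0 β) h| ∂haar := abs_integral_le_integral_abs
    _ ≤ ∫ h, S.indicator (fun _ => M) h ∂haar :=
        integral_mono ((hFi _).sub (hFi _)).abs ((integrable_const M).indicator hSm) hpt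
    _ = M * (haar S).toReal := by
        rw [integral_indicator_const _ hSm, smul_eq_mul, mul_comm]; rfl
    _ ≤ _ := by
        gcongr
        · exact ENNReal.mul_ne_top ENNReal.ofReal_ne_top tiltAvg_lt_top.ne
        · rw [hS, measure_preimage_mul_right]
          exact haar_shell_le c hs

/-! ### The limiting direction -/

/-- The frames whose first tangent vector is the limit of the images of tangent vectors under
strong twists. -/
def lstep (ε : ℝ) (h : SO3) : SO3 := bstep ε h * rot0 (Complex.arg (-(Complex.I * ell h)))

@[fun_prop]
theorem measurable_lstep (ε : ℝ) : Measurable (lstep ε) := by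
  have := continuous_ell.measurable
  unfold lstep; fun_prop

/-- The component of the image of the first tangent vector in the limiting direction. -/
def gain (ε : ℝ) (h : SO3) : ℝ := ent h 0 2 + Real.pi * ε * tilt h * ent h 0 1

theorem inner_gain (ε : ℝ) (h : SO3) :
    (shear ε h 1 * (starRingEnd ℂ) (-(Complex.I * ell h))).re = gain ε h := by
  rw [shear_apply, Complex.inner, gain, tilt]
  simp [ell]; ring

/-- The transverse component of the image does not grow with ε, while `gain` does in general; their
ratio controls the angle to the limiting direction. -/
theorem cross_gain (ε : ℝ) (h : SO3) :
    (shear ε h 1 * (starRingEnd ℂ) (-(Complex.I * ell h))).im = ent h 0 1 := by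
  rw [shear_apply, Complex.inner]
  simp [ell]; ring

theorem norm_mul_norm_mul_sin_arg_sub (z w : ℂ) :
    ‖z‖ * ‖w‖ * Real.sin (z.arg - w.arg) = (z * (starRingEnd ℂ) w).im := by
  have h1 := Complex.norm_mul_cos_arg z
  have h2 := Complex.norm_mul_sin_arg z
  have h3 := Complex.norm_mul_cos_arg w
  have h4 := Complex.norm_mul_sin_arg w
  rw [Real.sin_sub, Complex.mul_im, Complex.conj_re, Complex.conj_im, ← h1, ← h2, ← h3, ← h4]
  ring

/-- The angle between the image of the first tangent vector and the limiting direction. -/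
theorem abs_sin_angle_le (ε : ℝ) (h : SO3) (hg : gain ε h ≠ 0) :
    |Real.sin ((shear ε h 1).arg - (-(Complex.I * ell h)).arg)| ≤ ‖ell h‖ / |gain ε h| := by
  set B := shear ε h 1
  set E := -(Complex.I * ell h)
  have h1 := norm_mul_norm_mul_sin_arg_sub B E
  rw [cross_gain] at h1
  have h2 : |gain ε h| ≤ ‖B‖ * ‖E‖ := by
    rw [← inner_gain, ← Complex.norm_conj E, ← norm_mul]
    exact Complex.abs_re_le_norm _
  have h3 : |ent h 0 1| ≤ ‖ell h‖ := Complex.abs_re_le_norm (ell h)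
  rw [le_div_iff₀ (abs_pos.2 hg)]
  calc _ ≤ |Real.sin (B.arg - E.arg)| * (‖B‖ * ‖E‖) := by gcongr
    _ = |‖B‖ * ‖E‖ * Real.sin (B.arg - E.arg)| := by
        rw [abs_mul, abs_of_nonneg (by positivity : 0 ≤ ‖B‖ * ‖E‖), mul_comm]
    _ ≤ _ := by rw [h1]; exact h3

/-- The sine of the difference sees angles only modulo π, so the nearer of the two opposite
directions is chosen. -/
theorem exists_angle_close (θ α : ℝ) : ∃ β, (β = α ∨ β = α + Real.pi) ∧
    2 * |Real.cos θ - Real.cos β| + 2 * |Real.sin θ - Real.sin β| ≤ 8 * |Real.sin (θ - α)| := by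
  set d := (θ - α) / 2 with hd
  set m := (θ + α) / 2 with hm
  have hθ : θ = m + d := by rw [hd, hm]; ring
  have hα : α = m - d := by rw [hd, hm]; ring
  have h1 := Real.sin_sq_add_cos_sq d
  have h2 : |Real.sin (θ - α)| = 2 * |Real.sin d| * |Real.cos d| := by
    rw [show θ - α = 2 * d by rw [hd]; ring, Real.sin_two_mul, abs_mul, abs_mul]; simp
  have hsm := Real.abs_sin_le_one m
  have hcm := Real.abs_cos_le_one m
  have hs0 := abs_nonneg (Real.sin d)
  have hc0 := abs_nonneg (Real.cos d)
  rw [← sq_abs (Real.sin d), ← sq_abs (Real.cos d)] at h1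
  rcases le_total |Real.sin d| |Real.cos d| with h | h
  · refine ⟨α, Or.inl rfl, ?_⟩
    have h3 : 1 / 2 ≤ |Real.cos d| := by nlinarith
    have e1 : Real.cos θ - Real.cos α = -(2 * Real.sin m * Real.sin d) := by
      rw [hθ, hα, Real.cos_add, Real.cos_sub]; ring
    have e2 : Real.sin θ - Real.sin α = 2 * Real.cos m * Real.sin d := by
      rw [hθ, hα, Real.sin_add, Real.sin_sub]; ring
    rw [e1, e2, h2, abs_neg, abs_mul, abs_mul, abs_mul, abs_mul, abs_two]
    nlinarith [mul_le_mul_of_nonneg_right hsm hs0, mul_le_mul_of_nonneg_right hcm hs0,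
      mul_le_mul_of_nonneg_left h3 hs0]
  · refine ⟨α + Real.pi, Or.inr rfl, ?_⟩
    have h3 : 1 / 2 ≤ |Real.sin d| := by nlinarith
    have e1 : Real.cos θ - Real.cos (α + Real.pi) = 2 * Real.cos m * Real.cos d := by
      rw [Real.cos_add_pi, hθ, hα, Real.cos_add, Real.cos_sub]; ring
    have e2 : Real.sin θ - Real.sin (α + Real.pi) = 2 * Real.sin m * Real.cos d := by
      rw [Real.sin_add_pi, hθ, hα, Real.sin_add, Real.sin_sub]; ring
    rw [e1, e2, h2, abs_mul, abs_mul, abs_mul, abs_mul, abs_two]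
    nlinarith [mul_le_mul_of_nonneg_right hsm hc0, mul_le_mul_of_nonneg_right hcm hc0,
      mul_le_mul_of_nonneg_left h3 hc0]

/-- Opposite vectors are stretched equally, so the sign left open by `exists_angle_close` is
harmless. -/
theorem stretch_mul_rot0_add_pi (ε : ℝ) (h : SO3) (t : ℝ) :
    stretch ε (h * rot0 (t + Real.pi)) = stretch ε (h * rot0 t) := by
  have e : Complex.exp (((t + Real.pi : ℝ) : ℂ) * Complex.I) =
      -Complex.exp (t * Complex.I) := by
    rw [Complex.ofReal_add, add_mul, Complex.exp_add, Complex.exp_pi_mul_I]; ring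
  rw [stretch, stretch, shear_mul_rot0, shear_mul_rot0, norm_mul, norm_mul, norm_exp_neg_mul_I,
    norm_exp_neg_mul_I, mul_one, mul_one, e, map_neg, norm_neg]

/-- The expected stretch after the twist followed by a diffused rotation, starting from the
limiting direction. -/
def limitMean (ε δ : ℝ) (g h : SO3) : ℝ :=
  {h | ell h ≠ 0}.indicator (fun h => ∫ u, stretch ε (u * lstep ε h) ∂diffusedLaw g δ) h

/-- The singular weight controlling the approach to the limiting direction. -/
def gainWt (ε : ℝ) (h : SO3) : ENNReal := wt (‖ell h‖⁻¹ * gain ε h)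

@[fun_prop]
theorem measurable_gainWt (ε : ℝ) : Measurable (gainWt ε) := by
  have := continuous_ell.measurable
  unfold gainWt gain; fun_prop

/-- Along `rot0` the normalized gain is a cosine of squared amplitude 1 + τ² when ℓ ≠ 0, with τ =
πε·`tilt`. Bounding the amplitude below by τ gives the decay in ε; the remaining weight of the tilt
is integrable. -/
theorem lintegral_gainWt_le (ε : ℝ) :
    ∫⁻ h, gainWt ε h ∂haar ≤ wt (Real.pi * ε) * tiltAvg * cosAvg := by
  rw [lintegral_haar_right (measurable_gainWt ε) measurable_rot0, tiltAvg,
    ← lintegral_const_mul _ (by fun_prop), ← lintegral_mul_const _ (by fun_prop)]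
  refine lintegral_mono fun h => ?_
  set r := ‖ell h‖ with hr
  set τ := Real.pi * ε * tilt h with hτ
  have hr2 : r ^ 2 = tilt h := norm_ell_sq h
  have e : ∀ t, gainWt ε (h * rot0 t) = wt (r⁻¹ * (ent h 0 2 + τ * ent h 0 1) * Real.cos t +
      r⁻¹ * (τ * ent h 0 2 - ent h 0 1) * Real.sin t) := by
    intro t
    have hn : ‖ell (h * rot0 t)‖ = r := by rw [ell_mul_rot0, norm_mul, norm_exp_neg_mul_I, one_mul]
    have ht : tilt (h * rot0 t) = tilt h := by rw [← norm_ell_sq, hn, hr2]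
    rw [gainWt, gain, hn, ht, mul_rot0_01, mul_rot0_02]
    congr 1; ring
  simp only [e]
  rw [lintegral_circ_wt, ← wt_mul]
  gcongr
  refine wt_anti ?_
  rw [abs_of_nonneg (Real.sqrt_nonneg _)]
  refine Real.abs_le_sqrt ?_
  rcases eq_or_ne r 0 with h0 | h0
  · have : tilt h = 0 := by rw [← hr2, h0]; ring
    rw [this, mul_zero, zero_pow two_ne_zero]
    positivity
  · have e2 : (r⁻¹ * (ent h 0 2 + τ * ent h 0 1)) ^ 2 + (r⁻¹ * (τ * ent h 0 2 - ent h 0 1)) ^ 2 =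
        1 + τ ^ 2 := by
      have : ent h 0 1 ^ 2 + ent h 0 2 ^ 2 = r ^ 2 := by rw [hr2, tilt]
      field_simp
      linear_combination (1 + τ ^ 2) * this
    rw [e2]; linarith

theorem one_le_tiltAvg : 1 ≤ tiltAvg := by
  calc (1 : ENNReal) = ∫⁻ _ : SO3, 1 ∂haar := by simp
    _ ≤ tiltAvg := lintegral_mono fun h => by
      calc (1 : ENNReal) = wt 1 := by simp [wt]
        _ ≤ wt (tilt h) := wt_anti (by
          rw [abs_one, abs_of_nonneg (tilt_nonneg h)]; exact tilt_le_one h)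

theorem rate_pos {ε : ℝ} (hε : 0 < ε) : 0 < rate ε :=
  Real.log_pos (by nlinarith [Real.pi_pos])

theorem ofReal_abs_trans_stretch_sub_le {ε δ : ℝ} (hε : 0 < ε) (h0 : 0 < δ) (h1 : δ ≤ 1)
    (g h : SO3) : ENNReal.ofReal |trans (diffusedLaw g δ) ε (stretch ε) h - limitMean ε δ g h| ≤
      ENNReal.ofReal (12 * (ballVol δ)⁻¹ * rate ε) * tiltAvg * gainWt ε h := by
  have hv := ballVol_pos h0 h1
  have hr := rate_pos hε
  -- If ℓ or the gain vanishes the weight is infinite and there is nothing to estimate.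
  rcases eq_or_ne (‖ell h‖⁻¹ * gain ε h) 0 with hz | hz
  · have : gainWt ε h = ⊤ := by rw [gainWt, hz]; simp [wt]
    rw [this, ENNReal.mul_top]
    · exact le_top
    · refine mul_ne_zero ?_ (one_pos.trans_le one_le_tiltAvg).ne'
      simp only [ne_eq, ENNReal.ofReal_eq_zero, not_le]; positivity
  have hl : ‖ell h‖ ≠ 0 := fun h => hz (by rw [h]; simp)
  have hg : gain ε h ≠ 0 := fun h => hz (by rw [h]; simp)
  have hl' : 0 < ‖ell h‖ := lt_of_le_of_ne (norm_nonneg _) hl.symm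
  set q := ‖ell h‖ / |gain ε h| with hq
  have hs := abs_sin_angle_le ε h hg
  obtain ⟨β, hβ, hclose⟩ := exists_angle_close (shear ε h 1).arg (-(Complex.I * ell h)).arg
  have e1 : trans (diffusedLaw g δ) ε (stretch ε) h = (ballVol δ)⁻¹ *
      ∫ u in identityBall δ, stretch ε (u * (g * bstep ε h * rot0 (shear ε h 1).arg)) ∂haar := by
    rw [trans, integral_diffusedLaw g δ (ψ := fun u => stretch ε (u * fstep ε h)) (by fun_prop),
      integral_cond]
    simp only [fstep, mul_assoc]
  have e2 : limitMean ε δ g h = (ballVol δ)⁻¹ *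
      ∫ u in identityBall δ, stretch ε (u * (g * bstep ε h * rot0 β)) ∂haar := by
    rw [limitMean, Set.indicator_of_mem (show ell h ≠ 0 from norm_ne_zero_iff.1 hl),
      integral_diffusedLaw g δ (ψ := fun u => stretch ε (u * lstep ε h)) (by fun_prop),
      integral_cond]
    congr 2
    funext u
    rcases hβ with rfl | rfl
    · simp only [lstep, mul_assoc]
    · rw [← mul_assoc, stretch_mul_rot0_add_pi]
      simp only [lstep, mul_assoc]
  rw [e1, e2, ← mul_sub, abs_mul, abs_of_pos (inv_pos.2 hv)]
  -- The sine of the angle is at most q, and `exists_angle_close` supplies the factor 8; √q is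
  -- exactly `gainWt`.
  have key := abs_setIntegral_identityBall_sub_le h0 (measurable_stretch ε)
    (abs_stretch_le hε.le) (g * bstep ε h) (θ := (shear ε h 1).arg) (β := β) (s := 8 * q)
    (by positivity) (hclose.trans (by gcongr))
  have hwt : gainWt ε h = ENNReal.ofReal √q := by
    rw [gainWt, wt_of_ne_zero hz, Real.rpow_neg (abs_nonneg _), ← Real.sqrt_eq_rpow, abs_mul,
      abs_inv, abs_norm, ← Real.sqrt_inv, mul_inv, inv_inv, ← div_eq_mul_inv]
  have hsq : 4 * √(8 * q) ≤ 12 * √q := by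
    rw [Real.sqrt_mul (by norm_num)]
    have : √8 ≤ 3 := by rw [Real.sqrt_le_left (by norm_num)]; norm_num
    nlinarith [Real.sqrt_nonneg q]
  calc _ ≤ ENNReal.ofReal ((ballVol δ)⁻¹ *
        (rate ε * (ENNReal.ofReal (4 * √(8 * q)) * tiltAvg).toReal)) := by gcongr
    _ = ENNReal.ofReal ((ballVol δ)⁻¹ * rate ε) * (ENNReal.ofReal (4 * √(8 * q)) * tiltAvg) := by
        rw [← mul_assoc, ENNReal.ofReal_mul (by positivity), ENNReal.ofReal_toReal
          (ENNReal.mul_ne_top ENNReal.ofReal_ne_top tiltAvg_lt_top.ne)]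
    _ ≤ ENNReal.ofReal ((ballVol δ)⁻¹ * rate ε) * (ENNReal.ofReal (12 * √q) * tiltAvg) := by
        gcongr
    _ = _ := by
        rw [hwt, ENNReal.ofReal_mul (p := 12) (by norm_num), mul_assoc 12,
          ENNReal.ofReal_mul (p := 12) (by norm_num)]
        ring

/-! ### Functions of the base point -/

theorem measurePreserving_bstep (ε : ℝ) : MeasurePreserving (bstep ε) haar haar :=
  ⟨measurable_bstep ε, Measure.ext_of_lintegral _ fun f hf => by
    rw [lintegral_map hf (measurable_bstep ε), lintegral_bstep ε hf]⟩

/-- Invariance under `rot0` on the right means that χ depends only on the base point. The direction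
of the vector drops out and only the measure-preserving `bstep` remains. -/
theorem trans_eq_of_invariant (ρ : Measure SO3) (ε : ℝ) {χ : SO3 → ℝ}
    (hinv : ∀ h t, χ (h * rot0 t) = χ h) (h : SO3) :
    trans ρ ε χ h = ∫ u, χ (u * bstep ε h) ∂ρ := by
  simp only [trans, fstep, ← mul_assoc, hinv]

theorem trans_mul_rot0 (ρ : Measure SO3) (ε : ℝ) {χ : SO3 → ℝ}
    (hinv : ∀ h t, χ (h * rot0 t) = χ h) (h : SO3) (t : ℝ) :
    trans ρ ε χ (h * rot0 t) = trans ρ ε χ h := by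
  simp only [trans_eq_of_invariant ρ ε hinv, bstep_mul_rot0, ← mul_assoc, hinv]

theorem integral_trans_of_invariant (ρ : Measure SO3) [IsProbabilityMeasure ρ] (ε : ℝ)
    {χ : SO3 → ℝ} (hχ : Measurable χ) {M : ℝ} (hM : ∀ h, |χ h| ≤ M)
    (hinv : ∀ h t, χ (h * rot0 t) = χ h) : ∫ h, trans ρ ε χ h ∂haar = ∫ h, χ h ∂haar := by
  simp only [trans_eq_of_invariant ρ ε hinv]
  have hm : Measurable fun p : SO3 × SO3 => χ (p.2 * bstep ε p.1) := by fun_prop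
  rw [integral_integral_swap (f := fun h u => χ (u * bstep ε h))
    (integrable_of_abs_le hm fun p => hM _)]
  have key : ∀ u, ∫ h, χ (u * bstep ε h) ∂haar = ∫ h, χ h ∂haar := by
    intro u
    have hu : Measurable fun h => χ (u * h) := by fun_prop
    rw [← integral_map (f := fun h => χ (u * h)) (measurable_bstep ε).aemeasurable
      hu.aestronglyMeasurable, (measurePreserving_bstep ε).map_eq, integral_mul_left_eq_self]
  simp [key]

theorem integral_trans_iterate_of_invariant (ρ : Measure SO3) [IsProbabilityMeasure ρ] (ε : ℝ)
    {χ : SO3 → ℝ} (hχ : Measurable χ) {M : ℝ} (hM : ∀ h, |χ h| ≤ M)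
    (hinv : ∀ h t, χ (h * rot0 t) = χ h) (k : ℕ) :
    ∫ h, (trans ρ ε)^[k] χ h ∂haar = ∫ h, χ h ∂haar := by
  induction k generalizing χ with
  | zero => rfl
  | succ k ih =>
    rw [Function.iterate_succ_apply, ih (measurable_trans ρ ε hχ) (abs_trans_le ρ ε hM)
      (trans_mul_rot0 ρ ε hinv), integral_trans_of_invariant ρ ε hχ hM hinv]

theorem abs_trans_sub_le (ρ : Measure SO3) [IsProbabilityMeasure ρ] (ε : ℝ) {ψ χ : SO3 → ℝ}
    (hψ : Measurable ψ) (hχ : Measurable χ) {M : ℝ} (hψM : ∀ h, |ψ h| ≤ M) (hχM : ∀ h, |χ h| ≤ M)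
    {D : ℝ} (hD : ∀ h, |ψ h - χ h| ≤ D) (h : SO3) : |trans ρ ε ψ h - trans ρ ε χ h| ≤ D := by
  rw [trans, trans, ← integral_sub (integrable_comp_mul_right ρ hψ hψM _)
    (integrable_comp_mul_right ρ hχ hχM _)]
  exact abs_integral_le_of_abs_le fun u => hD _

theorem abs_trans_iterate_sub_le (ρ : Measure SO3) [IsProbabilityMeasure ρ] (ε : ℝ)
    {ψ χ : SO3 → ℝ} (hψ : Measurable ψ) (hχ : Measurable χ) {M : ℝ} (hψM : ∀ h, |ψ h| ≤ M)
    (hχM : ∀ h, |χ h| ≤ M) {D : ℝ} (hD : ∀ h, |ψ h - χ h| ≤ D) (k : ℕ) (h : SO3) :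
    |(trans ρ ε)^[k] ψ h - (trans ρ ε)^[k] χ h| ≤ D := by
  induction k generalizing h with
  | zero => exact hD h
  | succ k ih =>
    rw [Function.iterate_succ_apply', Function.iterate_succ_apply']
    exact abs_trans_sub_le ρ ε (measurable_trans_iterate ρ ε hψ k)
      (measurable_trans_iterate ρ ε hχ k) (abs_trans_iterate_le ρ ε hψM k)
      (abs_trans_iterate_le ρ ε hχM k) ih h

/-- One step of the diffused random walk turns an integral estimate into a uniform one. -/
theorem abs_trans_diffusedLaw_sub_le (g : SO3) {δ : ℝ} (h0 : 0 < δ) (h1 : δ ≤ 1) (ε : ℝ)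
    {ψ χ : SO3 → ℝ} (hψ : Measurable ψ) (hχ : Measurable χ) {M : ℝ} (hψM : ∀ h, |ψ h| ≤ M)
    (hχM : ∀ h, |χ h| ≤ M) (h : SO3) :
    |trans (diffusedLaw g δ) ε ψ h - trans (diffusedLaw g δ) ε χ h| ≤
      (ENNReal.ofReal (ballVol δ)⁻¹ * ∫⁻ h, ENNReal.ofReal |ψ h - χ h| ∂haar).toReal := by
  have := isProbabilityMeasure_diffusedLaw g h0 h1
  have hfin : ∫⁻ h, ENNReal.ofReal |ψ h - χ h| ∂haar ≤ ENNReal.ofReal (M + M) := by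
    calc _ ≤ ∫⁻ _ : SO3, ENNReal.ofReal (M + M) ∂haar := lintegral_mono fun h =>
          ENNReal.ofReal_le_ofReal ((abs_sub _ _).trans (add_le_add (hψM h) (hχM h)))
      _ = _ := by simp
  rw [trans, trans, ← integral_sub (integrable_comp_mul_right _ hψ hψM _)
    (integrable_comp_mul_right _ hχ hχM _)]
  refine abs_integral_le_integral_abs.trans ?_
  rw [integral_eq_lintegral_of_nonneg_ae (Eventually.of_forall fun _ => abs_nonneg _)
    (by fun_prop)]
  refine ENNReal.toReal_mono (ENNReal.mul_ne_top ENNReal.ofReal_ne_top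
    (hfin.trans_lt ENNReal.ofReal_lt_top).ne) ?_
  exact lintegral_diffusedLaw_le g (fstep ε h) h0 h1 (F := fun h => ENNReal.ofReal |ψ h - χ h|)
    (by fun_prop)

/-! ### The limiting mean -/

theorem rot0_eq_of_angle_eq {s t : ℝ} (h : (s : Real.Angle) = t) : rot0 s = rot0 t := by
  have hc : Real.cos s = Real.cos t := by simpa using congrArg Real.Angle.cos h
  have hs : Real.sin s = Real.sin t := by simpa using congrArg Real.Angle.sin h
  apply Subtype.ext
  simp only [coe_rot0, hc, hs]

/-- The limiting direction is fixed by the base point, not by the frame. Where ℓ = 0 it is undefined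
and the conventional argument 0 would break this, which is why `limitMean` is cut off there. -/
theorem lstep_mul_rot0 (ε : ℝ) {h : SO3} (hl : ell h ≠ 0) (t : ℝ) :
    lstep ε (h * rot0 t) = lstep ε h := by
  rw [lstep, lstep, bstep_mul_rot0, mul_assoc, ← rot0_add, ell_mul_rot0]
  congr 1
  refine rot0_eq_of_angle_eq ?_
  have e : -(Complex.I * (Complex.exp (-(t * Complex.I)) * ell h)) =
      Complex.exp ((-t : ℝ) * Complex.I) * -(Complex.I * ell h) := by
    rw [Complex.ofReal_neg, neg_mul]; ring
  rw [e, Real.Angle.coe_add, Complex.arg_mul_coe_angle (Complex.exp_ne_zero _)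
    (neg_ne_zero.2 (mul_ne_zero Complex.I_ne_zero hl)), Complex.arg_exp_mul_I]
  simp

theorem limitMean_mul_rot0 (ε δ : ℝ) (g h : SO3) (t : ℝ) :
    limitMean ε δ g (h * rot0 t) = limitMean ε δ g h := by
  have hiff : ell (h * rot0 t) = 0 ↔ ell h = 0 := by
    rw [ell_mul_rot0, mul_eq_zero, or_iff_right (Complex.exp_ne_zero _)]
  by_cases hl : ell h = 0
  · rw [limitMean, limitMean, Set.indicator_of_notMem (by simpa using hiff.2 hl),
      Set.indicator_of_notMem (by simpa using hl)]
  · rw [limitMean, limitMean, Set.indicator_of_mem (by simpa using mt hiff.1 hl),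
      Set.indicator_of_mem (by simpa using hl), lstep_mul_rot0 ε hl]

theorem limitMean_eq (ε δ : ℝ) (g h : SO3) : limitMean ε δ g h = {h | ell h ≠ 0}.indicator
    (fun h => ∫ u, stretch ε (u * (g * lstep ε h)) ∂haar[|identityBall δ]) h := by
  rw [limitMean]
  congr 1
  funext w
  rw [integral_diffusedLaw g δ (ψ := fun u => stretch ε (u * lstep ε w)) (by fun_prop)]
  simp only [mul_assoc]

theorem measurable_limitMean (ε : ℝ) {δ : ℝ} (h0 : 0 < δ) (h1 : δ ≤ 1) :
    Measurable fun p : SO3 × SO3 => limitMean ε δ p.1 p.2 := by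
  have := isProbabilityMeasure_cond h0 h1
  have hl := continuous_ell.measurable
  have m1 : Measurable fun q : (SO3 × SO3) × SO3 => stretch ε (q.2 * (q.1.1 * lstep ε q.1.2)) := by
    fun_prop
  have m2 : Measurable fun p : SO3 × SO3 =>
      ∫ u, stretch ε (u * (p.1 * lstep ε p.2)) ∂haar[|identityBall δ] :=
    m1.stronglyMeasurable.integral_prod_right'.measurable
  have hs : MeasurableSet {p : SO3 × SO3 | ell p.2 ≠ 0} :=
    (measurableSet_eq_fun (hl.comp measurable_snd) measurable_const).compl
  convert m2.indicator hs using 1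
  funext p
  rw [limitMean_eq]
  rfl

theorem abs_limitMean_le {ε δ : ℝ} (hε : 0 ≤ ε) (h0 : 0 < δ) (h1 : δ ≤ 1) (g h : SO3) :
    |limitMean ε δ g h| ≤ rate ε := by
  have := isProbabilityMeasure_diffusedLaw g h0 h1
  rw [limitMean]
  by_cases hl : ell h = 0
  · rw [Set.indicator_of_notMem (by simp [hl]), abs_zero]
    exact rate_nonneg hε
  · rw [Set.indicator_of_mem (by simpa using hl)]
    exact abs_integral_le_of_abs_le fun u => abs_stretch_le hε _

theorem ae_ell_ne_zero : ∀ᵐ h ∂haar, ell h ≠ 0 := by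
  have hm : Measurable fun h => wt (tilt h) := by fun_prop
  filter_upwards [ae_lt_top hm tiltAvg_lt_top.ne] with h hh h0
  rw [← norm_ell_sq, h0] at hh
  simp [wt] at hh

/-- For almost every h, integrating over g makes the frame u g `lstep ε h` Haar distributed for each
u, so the ball and the limiting direction both disappear. -/
theorem integral_limitMean {ε δ : ℝ} (hε : 0 ≤ ε) (h0 : 0 < δ) (h1 : δ ≤ 1) :
    ∫ g, ∫ h, limitMean ε δ g h ∂haar ∂haar = ∫ h, stretch ε h ∂haar := by
  have := isProbabilityMeasure_cond h0 h1
  rw [integral_integral_swap (integrable_of_abs_le (measurable_limitMean ε h0 h1)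
    fun p => abs_limitMean_le hε h0 h1 p.1 p.2)]
  have key : ∀ h, ell h ≠ 0 → ∫ g, limitMean ε δ g h ∂haar = ∫ h, stretch ε h ∂haar := by
    intro h hl
    have e : ∀ g, limitMean ε δ g h =
        ∫ u, stretch ε (u * (g * lstep ε h)) ∂haar[|identityBall δ] := fun g => by
      rw [limitMean_eq, Set.indicator_of_mem (by simpa using hl)]
    simp only [e]
    have m1 : Measurable fun q : SO3 × SO3 => stretch ε (q.2 * (q.1 * lstep ε h)) := by fun_prop
    rw [integral_integral_swap (f := fun g u => stretch ε (u * (g * lstep ε h)))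
      (integrable_of_abs_le m1 fun q => abs_stretch_le hε _)]
    have e2 : ∀ u, ∫ g, stretch ε (u * (g * lstep ε h)) ∂haar = ∫ h, stretch ε h ∂haar := by
      intro u
      rw [integral_mul_right_eq_self (fun g => stretch ε (u * g)), integral_mul_left_eq_self]
    simp [e2]
  rw [integral_congr_ae (ae_ell_ne_zero.mono key)]
  simp

/-! ### Comparison of the exponents -/

/-- The bound for the difference of the exponents. -/
def errorBound (ε δ : ℝ) : ℝ := 12 * (tiltAvg.toReal ^ 2 * cosAvg.toReal) *
  ((ballVol δ)⁻¹ ^ 2 * rate ε * (wt (Real.pi * ε)).toReal)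

/-- One step of the walk gives closeness to `limitMean` in L¹, a second makes it uniform. Iterating
`trans` further preserves both the uniform bound and the integral of `limitMean`. -/
theorem abs_localExponent_sub_le {ε δ : ℝ} (hε : 0 < ε) (h0 : 0 < δ) (h1 : δ ≤ 1) (g : SO3) :
    |localExponent g ε δ - ∫ h, limitMean ε δ g h ∂haar| ≤ errorBound ε δ := by
  have := isProbabilityMeasure_diffusedLaw g h0 h1
  have hv := ballVol_pos h0 h1
  have hr := rate_pos hε
  have hwt : wt (Real.pi * ε) ≠ ⊤ := by
    rw [wt_of_ne_zero (by positivity)]; exact ENNReal.ofReal_ne_top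
  have hψ := measurable_trans (diffusedLaw g δ) ε (measurable_stretch ε)
  have hχ : Measurable (limitMean ε δ g) :=
    (measurable_limitMean ε h0 h1).comp measurable_prodMk_left
  have hψM := abs_trans_le (diffusedLaw g δ) ε (abs_stretch_le hε.le)
  have hχM := abs_limitMean_le hε.le h0 h1 g
  have hinv := limitMean_mul_rot0 ε δ g
  have hD : ∀ h, |trans (diffusedLaw g δ) ε (trans (diffusedLaw g δ) ε (stretch ε)) h -
      trans (diffusedLaw g δ) ε (limitMean ε δ g) h| ≤ errorBound ε δ := by
    intro h
    refine (abs_trans_diffusedLaw_sub_le g h0 h1 ε hψ hχ hψM hχM h).trans ?_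
    have hint : ∫⁻ h, ENNReal.ofReal
        |trans (diffusedLaw g δ) ε (stretch ε) h - limitMean ε δ g h| ∂haar ≤
        ENNReal.ofReal (12 * (ballVol δ)⁻¹ * rate ε) * tiltAvg *
          (wt (Real.pi * ε) * tiltAvg * cosAvg) := by
      refine (lintegral_mono (ofReal_abs_trans_stretch_sub_le hε h0 h1 g)).trans ?_
      rw [lintegral_const_mul _ (measurable_gainWt ε)]
      exact mul_le_mul' le_rfl (lintegral_gainWt_le ε)
    have hfin : ENNReal.ofReal (ballVol δ)⁻¹ * (ENNReal.ofReal (12 * (ballVol δ)⁻¹ * rate ε) *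
        tiltAvg * (wt (Real.pi * ε) * tiltAvg * cosAvg)) ≠ ⊤ := by
      have := tiltAvg_lt_top.ne
      have := cosAvg_lt_top.ne
      finiteness
    refine (ENNReal.toReal_mono hfin (mul_le_mul' le_rfl hint)).trans (le_of_eq ?_)
    simp only [ENNReal.toReal_mul]
    rw [ENNReal.toReal_ofReal (by positivity), ENNReal.toReal_ofReal (by positivity), errorBound]
    ring
  have hB : 0 ≤ errorBound ε δ := (abs_nonneg _).trans (hD 1)
  -- With k = j + 2, the two innermost applications produce the uniform estimate and the other j
  -- propagate it.
  refine abs_randomExponent_sub_le (diffusedLaw g δ) hε.le hB 2 fun k hk => ?_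
  obtain ⟨j, rfl⟩ := Nat.exists_eq_add_of_le' hk
  have e : ∫ h, limitMean ε δ g h ∂haar =
      ∫ h, (trans (diffusedLaw g δ) ε)^[j] (trans (diffusedLaw g δ) ε (limitMean ε δ g)) h ∂haar := by
    rw [← Function.iterate_succ_apply, integral_trans_iterate_of_invariant _ ε hχ hχM hinv]
  have m1 := measurable_trans (diffusedLaw g δ) ε hψ
  have m2 := measurable_trans (diffusedLaw g δ) ε hχ
  have b1 := abs_trans_le (diffusedLaw g δ) ε hψM
  have b2 := abs_trans_le (diffusedLaw g δ) ε hχM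
  rw [e, Function.iterate_add_apply, Function.iterate_succ_apply, Function.iterate_one, ← integral_sub
    (integrable_of_abs_le (measurable_trans_iterate _ ε m1 j) (abs_trans_iterate_le _ ε b1 j))
    (integrable_of_abs_le (measurable_trans_iterate _ ε m2 j) (abs_trans_iterate_le _ ε b2 j))]
  exact abs_integral_le_of_abs_le
    (abs_trans_iterate_sub_le _ ε m1 m2 b1 b2 hD j)

/-! ### Dependence on the centre g, and averaging over it. -/

theorem seqLaw_diffusedLaw (g : SO3) {δ : ℝ} (h0 : 0 < δ) (h1 : δ ≤ 1) :
    seqLaw (diffusedLaw g δ) =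
      (seqLaw haar[|identityBall δ]).map fun ω i => ω i * g := by
  have := isProbabilityMeasure_cond h0 h1
  have := isProbabilityMeasure_diffusedLaw g h0 h1
  exact (Measure.infinitePi_map_pi (fun _ => haar[|identityBall δ])
    (fun _ => measurable_mul_const g)).symm

theorem abs_frameExponent_le {ε : ℝ} (hε : 0 ≤ ε) (y : Orbit) : |frameExponent ε y| ≤ rate ε :=
  abs_growth_le (rate_nonneg hε) (abs_log_norm_cocyc_le hε) y

/-- Moving g from the measure into the integrand makes measurability in g a matter of parametrized
integrals. -/
theorem localExponent_eq (ε : ℝ) {δ : ℝ} (h0 : 0 < δ) (h1 : δ ≤ 1) (g : SO3) :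
    localExponent g ε δ = ∫ ω, ∫ h, frameExponent ε (fun i => ω i * g, h) ∂haar
      ∂seqLaw haar[|identityBall δ] := by
  have hm : Measurable fun ω => ∫ h, frameExponent ε (ω, h) ∂haar :=
    (measurable_frameExponent ε).stronglyMeasurable.integral_prod_right'.measurable
  rw [localExponent, randomExponent]
  simp only [integral_pointExponent]
  change ∫ ω, _ ∂seqLaw (diffusedLaw g δ) = _
  have hg : Measurable fun (ω : ℕ → SO3) i => ω i * g := by fun_prop
  rw [seqLaw_diffusedLaw g h0 h1, integral_map hg.aemeasurable hm.aestronglyMeasurable]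

theorem measurable_localExponent (ε : ℝ) {δ : ℝ} (h0 : 0 < δ) (h1 : δ ≤ 1) :
    Measurable fun g => localExponent g ε δ := by
  have := isProbabilityMeasure_cond h0 h1
  simp only [localExponent_eq ε h0 h1]
  have m0 : Measurable fun q : (SO3 × (ℕ → SO3)) × SO3 =>
      ((fun i => q.1.2 i * q.1.1, q.2) : Orbit) := by fun_prop
  have m1 : Measurable fun q : (SO3 × (ℕ → SO3)) × SO3 =>
      frameExponent ε (fun i => q.1.2 i * q.1.1, q.2) := (measurable_frameExponent ε).comp m0
  have m2 : Measurable fun q : SO3 × (ℕ → SO3) =>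
      ∫ h, frameExponent ε (fun i => q.2 i * q.1, h) ∂haar :=
    m1.stronglyMeasurable.integral_prod_right'.measurable
  exact m2.stronglyMeasurable.integral_prod_right'.measurable

theorem abs_localExponent_le {ε δ : ℝ} (hε : 0 ≤ ε) (h0 : 0 < δ) (h1 : δ ≤ 1) (g : SO3) :
    |localExponent g ε δ| ≤ rate ε := by
  have := isProbabilityMeasure_cond h0 h1
  rw [localExponent_eq ε h0 h1]
  exact abs_integral_le_of_abs_le fun ω =>
    abs_integral_le_of_abs_le fun h => abs_frameExponent_le hε _

theorem abs_diffusedR_sub_le {ε δ : ℝ} (hε : 0 < ε) (h0 : 0 < δ) (h1 : δ ≤ 1) :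
    |diffusedR ε δ - R ε| ≤ errorBound ε δ := by
  have m2 : Measurable fun g => ∫ h, limitMean ε δ g h ∂haar :=
    (measurable_limitMean ε h0 h1).stronglyMeasurable.integral_prod_right'.measurable
  rw [R_eq hε.le, ← integral_limitMean hε.le h0 h1, diffusedR, ← integral_sub
    (integrable_of_abs_le (measurable_localExponent ε h0 h1) (abs_localExponent_le hε.le h0 h1))
    (integrable_of_abs_le m2 fun g => abs_integral_le_of_abs_le (abs_limitMean_le hε.le h0 h1 g))]
  exact abs_integral_le_of_abs_le (abs_localExponent_sub_le hε h0 h1)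

theorem diffusedR_eq_of_one_le (ε : ℝ) {δ : ℝ} (h1 : 1 ≤ δ) : diffusedR ε δ = R ε := by
  have e : ∀ g, diffusedLaw g δ = haar := fun g => by
    rw [diffusedLaw, identityBall_eq_univ h1, cond_univ, map_mul_right_eq_self]
  simp [diffusedR, localExponent, e, R]

/-! ### Explicit constants and the final estimate. -/

theorem rate_le {ε : ℝ} (hε : 0 < ε) : rate ε ≤ 2 * Real.log (2 + ε) := by
  rw [rate, ← Real.log_rpow (by positivity)]
  refine Real.log_le_log (by positivity) ?_
  norm_num
  nlinarith [Real.pi_lt_four]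

theorem toReal_wt_le {ε : ℝ} (hε : 0 < ε) :
    (wt (Real.pi * ε)).toReal ≤ ε ^ (-(1 / 2) : ℝ) := by
  rw [wt_of_ne_zero (by positivity), ENNReal.toReal_ofReal (by positivity),
    abs_of_pos (by positivity)]
  refine Real.rpow_le_rpow_of_nonpos hε ?_ (by norm_num)
  nlinarith [Real.pi_gt_three]

theorem inv_ballVol_sq_le {δ : ℝ} (h0 : 0 < δ) (h1 : δ ≤ 1) :
    (ballVol δ)⁻¹ ^ 2 ≤ 48 ^ 6 * δ ^ (-11 : ℤ) := by
  calc (ballVol δ)⁻¹ ^ 2 ≤ ((δ / 48) ^ 3)⁻¹ ^ 2 := by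
        have := ballVol_pos h0 h1
        gcongr
        exact ballVol_ge h0 h1
    _ = 48 ^ 6 * δ ^ (-6 : ℤ) := by
        rw [zpow_neg, show δ ^ (6 : ℤ) = δ ^ 6 from by norm_cast]; field_simp
    _ ≤ _ := by
        gcongr 48 ^ 6 * ?_
        -- The argument yields δ^(-6), which for δ ≤ 1 is at most the stated δ^(-11).
        exact zpow_le_zpow_right_of_le_one₀ h0 h1 (by norm_num)

theorem exists_abs_diffusedR_sub_le : ∃ C : ℝ, 0 < C ∧ ∀ ε δ : ℝ, 0 < ε → 0 < δ →
    |diffusedR ε δ - R ε| ≤ C * δ ^ (-11 : ℤ) * ε ^ (-(1 / 2) : ℝ) * Real.log (2 + ε) := by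
  set K := tiltAvg.toReal ^ 2 * cosAvg.toReal with hK
  -- The added 1 makes positivity immediate, without a lower bound for K.
  refine ⟨12 * K * (48 ^ 6 * 2) + 1, by positivity, fun ε δ hε hδ => ?_⟩
  have hl : 0 ≤ Real.log (2 + ε) := Real.log_nonneg (by linarith)
  rcases le_total δ 1 with h1 | h1
  · have hr := rate_pos hε
    calc _ ≤ errorBound ε δ := abs_diffusedR_sub_le hε hδ h1
      _ ≤ 12 * K * (48 ^ 6 * δ ^ (-11 : ℤ) * (2 * Real.log (2 + ε)) * ε ^ (-(1 / 2) : ℝ)) := by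
          rw [errorBound]
          gcongr
          exacts [inv_ballVol_sq_le hδ h1, rate_le hε, toReal_wt_le hε]
      _ = 12 * K * (48 ^ 6 * 2) * δ ^ (-11 : ℤ) * ε ^ (-(1 / 2) : ℝ) * Real.log (2 + ε) := by ring
      _ ≤ _ := by gcongr; linarith
  · rw [diffusedR_eq_of_one_le ε h1, sub_self, abs_zero]
    positivity

end TwistExponents

end

theorem mainTheorem2 :
    (∃ C : ℝ, 0 < C ∧
      (∀ ε δ : ℝ, 0 < ε → 0 < δ →
        |TwistExponents.diffusedR ε δ - TwistExponents.R ε| ≤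
          C * δ ^ (-11 : ℤ) * ε ^ (-(1 / 2) : ℝ) * Real.log (2 + ε)) ∧
      (∀ ε δ : ℝ, 2 ≤ ε → 0 < δ →
        |TwistExponents.diffusedR ε δ - TwistExponents.R ε| ≤
          C * δ ^ (-11 : ℤ) * ε ^ (-(1 / 2) : ℝ) * Real.log ε)) ∧
    (∀ δ : ℝ, 0 < δ →
      Tendsto (fun ε : ℝ => |TwistExponents.diffusedR ε δ - TwistExponents.R ε|) atTop (𝓝 0)) := by
  obtain ⟨C, hC, hbound⟩ := TwistExponents.exists_abs_diffusedR_sub_le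
  have hbound2 : ∀ ε δ : ℝ, 2 ≤ ε → 0 < δ →
      |TwistExponents.diffusedR ε δ - TwistExponents.R ε| ≤
        2 * C * δ ^ (-11 : ℤ) * ε ^ (-(1 / 2) : ℝ) * Real.log ε := by
    intro ε δ hε hδ
    have hε0 : 0 < ε := by linarith
    -- For ε ≥ 2 one has 2 + ε ≤ ε²; this doubles the constant.
    have h1 : Real.log (2 + ε) ≤ 2 * Real.log ε := by
      rw [← Real.log_rpow hε0]
      refine Real.log_le_log (by positivity) ?_
      norm_num
      nlinarith
    calc _ ≤ C * δ ^ (-11 : ℤ) * ε ^ (-(1 / 2) : ℝ) * Real.log (2 + ε) := hbound ε δ hε0 hδ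
      _ ≤ C * δ ^ (-11 : ℤ) * ε ^ (-(1 / 2) : ℝ) * (2 * Real.log ε) := by gcongr
      _ = _ := by ring
  refine ⟨⟨2 * C, by positivity, fun ε δ hε hδ => (hbound ε δ hε hδ).trans ?_, hbound2⟩,
    fun δ hδ => ?_⟩
  · have : 0 ≤ Real.log (2 + ε) := Real.log_nonneg (by linarith)
    gcongr
    linarith
  · have hlim : Tendsto (fun ε : ℝ => Real.log ε / ε ^ (1 / 2 : ℝ)) atTop (𝓝 0) :=
      (isLittleO_log_rpow_atTop (by norm_num)).tendsto_div_nhds_zero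
    have hlim2 := hlim.const_mul (2 * C * δ ^ (-11 : ℤ))
    rw [mul_zero] at hlim2
    refine squeeze_zero' (Eventually.of_forall fun _ => abs_nonneg _) ?_ hlim2
    filter_upwards [eventually_ge_atTop 2] with ε hε
    refine (hbound2 ε δ hε hδ).trans (le_of_eq ?_)
    rw [Real.rpow_neg (by linarith)]
    ring
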